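/- For $k\ge 0$ let $\Pi(k)$ be the group of all permutations of the positive integers that fix every point $>k$; products are read from left to right, so that $\alpha\beta$ means "first $\alpha$, then $\beta$". A \emph{table of order $n$} consists of entries $\sigma_{kj}$, $1\le j\le k\le n$, where each $\sigma_{kj}$ is either empty or an element of $\Pi(k)$ that takes $k\mapsto j$, and $\sigma_{kk}$ is the identity. Let $\Sigma(k)$ be the set of nonempty entries $\sigma_{kj}$, and let $\Gamma(k)$ be the set of all products $\sigma_1\sigma_2\cdots\sigma_k$ with $\sigma_i\in\Sigma(i)$. The table is a \emph{transversal system} of a group $G$ if there are sets $T(k)\subseteq\Pi(k)$ such that for $1\le k\le n$ we have $T(k)\subseteq\Gamma(k)\subseteq\langle T(k)\rangle$ and $\Gamma(k)$ is closed under multiplication (so $\Gamma(k)=\langle T(k)\rangle$), and if $\Gamma(n)=G$. The model of computation is a random access machine with indirect addressing, running a structured program (assignments, input, sequencing, conditionals, loops) over memory cells that initially contain $0$. Reading an input number, storing a number, fetching a cell, using a constant, adding, subtracting (truncated at $0$), multiplying, and testing a number against $0$ cost one step each. The input is the sequence consisting of $n$, then the arrays of images $\pi_r(1),\dots,\pi_r(n)$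 for $r=1,\dots,m$, then $0$; it is read once, sequentially, and does not occupy memory cells. \textbf{Theorem.} There are a program and constants $b,C$ such that for all $n\ge1$, $m\ge0$ and all $\pi_1,\dots,\pi_m\in\Pi(n)$, the program, given $n$ and $\pi_1,\dots,\pi_m$ as input, halts after at most $C\,(n^5+mn^2)$ steps, uses only $C\,n^3$ memory cells, computes only numbers smaller than $(n+1)^C$ (so every cell holds $O(\log (n+1))$ bits), and leaves in memory, in an array of $n^3$ cells starting at address $b$, a transversal system of the group $\langle \pi_1,\dots,\pi_m\rangle$. Here the entry $\sigma_{kj}$ is given by the array of the inverse images of $1,\dots,k$ under $\sigma_{kj}$, all $0$ if $\sigma_{kj}$ is empty. In other words, a transversal system for a permutation group generated by $m$ elements of $\Pi(n)$ can be found in $O(n^5)+O(mn^2)$ steps, using $O(n^3)$ memory cells. -/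

import Mathlib

namespace PermRep

/-! ## Random access machine with unit-cost steps

Programs are structured programs over an array of memory cells with indirect addressing.
There are `S` cells, with addresses `0, …, S - 1`, and each of them holds a natural number
smaller than `W`.  An execution that addresses any other cell, or computes a number that is not
smaller than `W`, is stuck.  The input is read once, from left to right, from a separate stream. -/

/-- Expressions; `load a` is the content of the cell whose address is the value of `a`, and `sub`
is subtraction truncated at `0`. -/
inductive Expr where
  | const (c : ℕ)
  | load (a : Expr)
  | add (a b : Expr)
  | sub (a b : Expr)
  | mul (a b : Expr)

/-- The number of operations in an expression. -/
def Expr.cost : Expr → ℕ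
  | .const _ => 1
  | .load a => a.cost + 1
  | .add a b => a.cost + b.cost + 1
  | .sub a b => a.cost + b.cost + 1
  | .mul a b => a.cost + b.cost + 1

/-- `Expr.Val S W M e v`: with memory content `M`, the expression `e` evaluates to `v` on the
machine with `S` cells holding numbers smaller than `W`. -/
inductive Expr.Val (S W : ℕ) (M : ℕ → ℕ) : Expr → ℕ → Prop
  | const {c : ℕ} (hc : c < W) : Expr.Val S W M (.const c) c
  | load {a : Expr} {i : ℕ} (ha : Expr.Val S W M a i) (hi : i < S) (hM : M i < W) :
      Expr.Val S W M (.load a) (M i)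
  | add {a b : Expr} {x y : ℕ} (ha : Expr.Val S W M a x) (hb : Expr.Val S W M b y)
      (h : x + y < W) : Expr.Val S W M (.add a b) (x + y)
  | sub {a b : Expr} {x y : ℕ} (ha : Expr.Val S W M a x) (hb : Expr.Val S W M b y) :
      Expr.Val S W M (.sub a b) (x - y)
  | mul {a b : Expr} {x y : ℕ} (ha : Expr.Val S W M a x) (hb : Expr.Val S W M b y)
      (h : x * y < W) : Expr.Val S W M (.mul a b) (x * y)

/-- Programs.  `store a e` stores the value of `e` in the cell with address `a`; `read a` stores
the next number of the input in the cell with address `a`; in the conditional and in the loop a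
test succeeds when its value is not `0`. -/
inductive Prog where
  | skip
  | store (a e : Expr)
  | read (a : Expr)
  | seq (p q : Prog)
  | cond (e : Expr) (p q : Prog)
  | loop (e : Expr) (p : Prog)

/-- The content of the memory, and the part of the input that has not been read. -/
structure State where
  mem : ℕ → ℕ
  input : List ℕ

/-- `Runs S W p s s' t`: on the machine with `S` cells holding numbers smaller than `W`, the
program `p`, started in state `s`, halts in state `s'` after `t` steps. -/
inductive Runs (S W : ℕ) : Prog → State → State → ℕ → Prop
  | skip (s : State) : Runs S W .skip s s 1
  | store {a e : Expr} {s : State} {i v : ℕ} (ha : a.Val S W s.mem i) (hi : i < S)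
      (he : e.Val S W s.mem v) :
      Runs S W (.store a e) s ⟨Function.update s.mem i v, s.input⟩ (a.cost + e.cost + 1)
  | read {a : Expr} {s : State} {i v : ℕ} {l : List ℕ} (ha : a.Val S W s.mem i) (hi : i < S)
      (hl : s.input = v :: l) (hv : v < W) :
      Runs S W (.read a) s ⟨Function.update s.mem i v, l⟩ (a.cost + 1)
  | seq {p q : Prog} {s s₁ s₂ : State} {t₁ t₂ : ℕ} (hp : Runs S W p s s₁ t₁)
      (hq : Runs S W q s₁ s₂ t₂) : Runs S W (.seq p q) s s₂ (t₁ + t₂)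
  | condTrue {e : Expr} {p q : Prog} {s s₁ : State} {v t : ℕ} (he : e.Val S W s.mem v)
      (hv : v ≠ 0) (hp : Runs S W p s s₁ t) : Runs S W (.cond e p q) s s₁ (e.cost + 1 + t)
  | condFalse {e : Expr} {p q : Prog} {s s₁ : State} {t : ℕ} (he : e.Val S W s.mem 0)
      (hq : Runs S W q s s₁ t) : Runs S W (.cond e p q) s s₁ (e.cost + 1 + t)
  | loopTrue {e : Expr} {p : Prog} {s s₁ s₂ : State} {v t₁ t₂ : ℕ} (he : e.Val S W s.mem v)
      (hv : v ≠ 0) (hp : Runs S W p s s₁ t₁) (hr : Runs S W (.loop e p) s₁ s₂ t₂) :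
      Runs S W (.loop e p) s s₂ (e.cost + 1 + t₁ + t₂)
  | loopFalse {e : Expr} {p : Prog} {s : State} (he : e.Val S W s.mem 0) :
      Runs S W (.loop e p) s s (e.cost + 1)

/-! ## Transversal systems -/

/-- `Π(k)`: the perms of the positive integers that fix all points greater than `k`.  They are
regarded as perms of `ℕ` that also fix `0`. -/
def perms (k : ℕ) : Set (Equiv.Perm ℕ) :=
  {π | ∀ i, i ∉ Set.Icc 1 k → π i = i}

/-- A table of entries `σ k j`, each of which is a perm or empty (`none`); only the entries with
`1 ≤ j ≤ k` matter. -/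
abbrev Table := ℕ → ℕ → Option (Equiv.Perm ℕ)

/-- `Σ(k)`: the set of all nonempty entries `σ k j` with `1 ≤ j ≤ k`. -/
def Table.level (σ : Table) (k : ℕ) : Set (Equiv.Perm ℕ) :=
  {π | ∃ j ∈ Set.Icc 1 k, σ k j = some π}

/-- `Γ(k)`: the set of all products of `k` perms, one from each of `Σ(1), …, Σ(k)`, applied in this
order.  In Mathlib's product `τ * γ` the perm `γ` is applied first. -/
def Table.products (σ : Table) : ℕ → Set (Equiv.Perm ℕ)
  | 0 => {1}
  | k + 1 => {π | ∃ γ ∈ σ.products k, ∃ τ ∈ σ.level (k + 1), π = τ * γ}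

/-- The data structure, up to level `n`: a table `σ` together with sets `T(1), …, T(n)`. -/
structure IsDataStructure (n : ℕ) (σ : Table) (T : ℕ → Set (Equiv.Perm ℕ)) : Prop where
  mem_perms : ∀ k ∈ Set.Icc 1 n, ∀ j ∈ Set.Icc 1 k, ∀ π, σ k j = some π → π ∈ perms k
  maps_to : ∀ k ∈ Set.Icc 1 n, ∀ j ∈ Set.Icc 1 k, ∀ π, σ k j = some π → π k = j
  diag : ∀ k ∈ Set.Icc 1 n, σ k k = some 1
  gens : ∀ k ∈ Set.Icc 1 n, T k ⊆ perms k
  generated : ∀ k ∈ Set.Icc 1 n, σ.products k ⊆ Subgroup.closure (T k)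

/-- The data structure is up-to-date of order `n`. -/
structure UpToDate (n : ℕ) (σ : Table) (T : ℕ → Set (Equiv.Perm ℕ)) : Prop
    extends IsDataStructure n σ T where
  contains : ∀ k ∈ Set.Icc 1 n, T k ⊆ σ.products k
  closed : ∀ k ∈ Set.Icc 1 n, ∀ α ∈ σ.products k, ∀ β ∈ σ.products k, α * β ∈ σ.products k

/-- The table `σ` is a transversal system, of order `n`, of the group `G`. -/
def IsTransversalSystem (n : ℕ) (σ : Table) (G : Subgroup (Equiv.Perm ℕ)) : Prop :=
  (∃ T, UpToDate n σ T) ∧ σ.products n = G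

/-! ## Input and output of the machine -/

/-- The input stream for the perms `g 0, …, g (m - 1)` of `Π(n)`: the number `n`, then the images
of `1, …, n` under each of the perms in turn, then `0`. -/
def inputStream (n m : ℕ) (g : Fin m → Equiv.Perm ℕ) : List ℕ :=
  n :: ((List.ofFn fun r => (List.range n).map fun i => g r (i + 1)).flatten ++ [0])

/-- The memory `M` holds the table `σ`, from the cell `b` on, as an array indexed by `k`, `j` and
`i` in `1, …, n`.  For `1 ≤ j ≤ k` and `1 ≤ i ≤ k`, the cell of `k`, `j`, `i` contains the inverse
image of `i` under `σ k j`, or `0` if `σ k j` is empty. -/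
def HoldsTable (n : ℕ) (M : ℕ → ℕ) (b : ℕ) (σ : Table) : Prop :=
  ∀ k ∈ Set.Icc 1 n, ∀ j ∈ Set.Icc 1 k, ∀ i ∈ Set.Icc 1 k,
    M (b + ((k - 1) * n + (j - 1)) * n + (i - 1)) =
      match σ k j with
      | none => 0
      | some π => π⁻¹ i

end PermRep

namespace PermRep

/-! ## A language with registers and four three-dimensional arrays of rows -/

/-! The data are a sparse table `E` of generators and a dense family `P` of labels. An entry `E i j`
lies in Π(i) and takes i to j < i; the entries in Π(k) generate `gen E k`. For each level k the
points are partitioned into classes, and the label `P k v`, an element of `gen E k`, takes v to the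
representative of its class; the class of k has representative k, with trivial label at k. Since all
generators preserve the classes, the classes are exactly the orbits (`Inv`, `Core.compat_of_mem`).
If G ∩ Π(k) ≤ `gen E k` for all k, the inverse labels of the orbit of k represent the cosets of
Π(k-1) ∩ G in Π(k) ∩ G, and Γ(k) = G ∩ Π(k) (`Inv.products_eq`).

A permutation z is inserted by sifting. On level i, if z i is in the orbit of i, z is multiplied by
the label of z i, and the product fixes i. Otherwise z first becomes the entry `E i (z i)` and the
classes that it connects are merged on all levels from i on (`Sift.store`, `Absorb.next_level`),
after which the multiplication is possible (`Sift.step`). At level 0 only the identity is left.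

Inserting the input makes level n complete. Then the levels are treated downwards: by Schreier's
lemma (`Inv.stabilizer_mem`), a complete level k makes level k-1 complete once the Schreier
generators of the entries in Π(k) and the points of the orbit of k have been inserted on level k-1.
These insertions do not change the labels of level k, because their permutations already belong to
its group.

The number of generators is kept small by Jerrum's idea of a forest. If two entries of row i+1 lead
into the same class of level i, one of them can be replaced by an element of Π(i) (`Inv.remove`).
Without such pairs there are at most n entries (`Inv.ent_card`), so a level has O(n²) Schreier
generators, apart from those of entries created meanwhile, and all levels have O(n³). A sift costs
O(n²), which gives O(n⁵), and the m input permutations cost O(mn²).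

Merging, storing and cleaning are paid for by the potential `pot`, which is O(n²) at the start and
is weighted by some w of order n³. Entries created during a Schreier loop are paid for by an
additional copy of `unc`, since `unc` plus the number of entries never increases.

The algorithm is written in a small language of registers and arrays, whose translation into machine
programs preserves the number of steps (`HRuns.runs`). -/

/-- Expressions over registers and arrays; `arr c k j x` is the cell `x` of the row `k`, `j` of
the array `c`. -/
inductive HE where
  | const (c : ℕ)
  | reg (r : ℕ)
  | arr (c : ℕ) (k j x : HE)
  | add (a b : HE)
  | sub (a b : HE)
  | mul (a b : HE)

/-- The content of the registers and arrays, and the rest of the input. -/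
structure HState where
  r : ℕ → ℕ
  a : ℕ → ℕ → ℕ → ℕ → ℕ
  inp : List ℕ

namespace HState

/-- Assignment to a register. -/
def setR (s : HState) (i v : ℕ) : HState :=
  { s with r := Function.update s.r i v }

/-- Assignment to an array cell. -/
def setA (s : HState) (c k j x v : ℕ) : HState :=
  { s with a := fun c' k' j' x' =>
      if c' = c ∧ k' = k ∧ j' = j ∧ x' = x then v else s.a c' k' j' x' }

@[simp] theorem setR_a (s : HState) (i v : ℕ) : (s.setR i v).a = s.a := rfl
@[simp] theorem setR_inp (s : HState) (i v : ℕ) : (s.setR i v).inp = s.inp := rfl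
@[simp] theorem setR_r_self (s : HState) (i v : ℕ) : (s.setR i v).r i = v := by simp [setR]
theorem setR_r_of_ne (s : HState) {i i' : ℕ} (v : ℕ) (h : i' ≠ i) :
    (s.setR i v).r i' = s.r i' := by simp [setR, h]
@[simp] theorem setA_inp (s : HState) (c k j x v : ℕ) : (s.setA c k j x v).inp = s.inp := rfl

/-- All values are at most `n + 1`. -/
def Bdd (n : ℕ) (s : HState) : Prop :=
  (∀ i, s.r i ≤ n + 1) ∧ ∀ c k j x, s.a c k j x ≤ n + 1

/-- The memory of the machine that represents the state. -/
def conc (n : ℕ) (s : HState) : State where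
  mem a := if a < 16 then s.r a else
    s.a ((a - 16) / n / n / n) ((a - 16) / n / n % n + 1) ((a - 16) / n % n + 1) ((a - 16) % n + 1)
  input := s.inp

end HState

/-! ### Layout of registers and arrays in the memory -/

/-- The address of an array cell. -/
def addr (n c k j x : ℕ) : ℕ := 16 + (((c * n + (k - 1)) * n + (j - 1)) * n + (x - 1))

theorem addr_decode {n c k j x : ℕ} (hk : k ∈ Set.Icc 1 n) (hj : j ∈ Set.Icc 1 n)
    (hx : x ∈ Set.Icc 1 n) :
    (addr n c k j x - 16) / n / n / n = c ∧ (addr n c k j x - 16) / n / n % n + 1 = k ∧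
      (addr n c k j x - 16) / n % n + 1 = j ∧ (addr n c k j x - 16) % n + 1 = x := by
  obtain ⟨hk1, hk2⟩ := hk
  obtain ⟨hj1, hj2⟩ := hj
  obtain ⟨hx1, hx2⟩ := hx
  have hn : 0 < n := by omega
  have key : ∀ q y, y < n → (q * n + y) / n = q ∧ (q * n + y) % n = y := fun q y hy => by
    constructor
    · rw [add_comm, Nat.add_mul_div_right _ _ hn, Nat.div_eq_of_lt hy, zero_add]
    · rw [add_comm, Nat.add_mul_mod_self_right, Nat.mod_eq_of_lt hy]
  have e : addr n c k j x - 16 = ((c * n + (k - 1)) * n + (j - 1)) * n + (x - 1) := by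
    unfold addr; omega
  rw [e, (key _ (x - 1) (by omega)).1, (key _ (x - 1) (by omega)).2, (key _ (j - 1) (by omega)).1,
    (key _ (j - 1) (by omega)).2, (key _ (k - 1) (by omega)).1, (key _ (k - 1) (by omega)).2]
  omega

theorem addr_lt {n c k j x : ℕ} (hc : c < 4) (hk : k ∈ Set.Icc 1 n) (hj : j ∈ Set.Icc 1 n)
    (hx : x ∈ Set.Icc 1 n) : addr n c k j x < 16 + 4 * n ^ 3 := by
  obtain ⟨hk1, hk2⟩ := hk
  obtain ⟨hj1, hj2⟩ := hj
  obtain ⟨hx1, hx2⟩ := hx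
  unfold addr
  have h1 : c * n + (k - 1) + 1 ≤ 4 * n := by nlinarith [Nat.sub_add_cancel hk1]
  have h2 : (c * n + (k - 1)) * n + (j - 1) + 1 ≤ 4 * n * n := by
    have := Nat.mul_le_mul_right n h1
    rw [add_mul] at this; omega
  have h3 : ((c * n + (k - 1)) * n + (j - 1)) * n + (x - 1) + 1 ≤ 4 * n * n * n := by
    have := Nat.mul_le_mul_right n h2
    rw [add_mul] at this; omega
  have : 4 * n * n * n = 4 * n ^ 3 := by ring
  omega

namespace HState

theorem conc_mem_reg (n : ℕ) (s : HState) {i : ℕ} (hi : i < 16) : (s.conc n).mem i = s.r i := by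
  simp [conc, hi]

theorem conc_mem_addr {n c k j x : ℕ} (s : HState) (hk : k ∈ Set.Icc 1 n)
    (hj : j ∈ Set.Icc 1 n) (hx : x ∈ Set.Icc 1 n) :
    (s.conc n).mem (addr n c k j x) = s.a c k j x := by
  obtain ⟨h1, h2, h3, h4⟩ := addr_decode (c := c) hk hj hx
  have : ¬ addr n c k j x < 16 := by unfold addr; omega
  simp [conc, this, h1, h2, h3, h4]

theorem conc_setR (n : ℕ) (s : HState) {i : ℕ} (v : ℕ) (hi : i < 16) :
    (s.setR i v).conc n = ⟨Function.update (s.conc n).mem i v, s.inp⟩ := by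
  simp only [conc, setR, State.mk.injEq, and_true]
  funext a
  by_cases h : a = i
  · subst h; simp [hi]
  · simp [Function.update_of_ne h]

theorem conc_setA {n c k j x : ℕ} (s : HState) (v : ℕ) (hk : k ∈ Set.Icc 1 n)
    (hj : j ∈ Set.Icc 1 n) (hx : x ∈ Set.Icc 1 n) :
    (s.setA c k j x v).conc n = ⟨Function.update (s.conc n).mem (addr n c k j x) v, s.inp⟩ := by
  simp only [conc, setA, State.mk.injEq, and_true]
  funext a
  obtain ⟨h1, h2, h3, h4⟩ := addr_decode (c := c) hk hj hx
  have h16 : ¬ addr n c k j x < 16 := by unfold addr; omega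
  by_cases h : a = addr n c k j x
  · subst h; simp [h16, h1, h2, h3, h4]
  · rw [Function.update_of_ne h]
    by_cases ha : a < 16
    · simp [ha]
    · simp only [ha, if_false]
      rw [if_neg]
      rintro ⟨e1, e2, e3, e4⟩
      apply h
      have hn : 0 < n := lt_of_lt_of_le (by obtain ⟨q, _⟩ := hk; omega) hk.2
      -- An address is determined by its four digits in base n, so equal digits would make it the
      -- updated address.
      have d1 := Nat.div_add_mod (a - 16) n
      have d2 := Nat.div_add_mod ((a - 16) / n) n
      have d3 := Nat.div_add_mod ((a - 16) / n / n) n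
      have e2' : (a - 16) / n / n % n = k - 1 := by omega
      have e3' : (a - 16) / n % n = j - 1 := by omega
      have e4' : (a - 16) % n = x - 1 := by omega
      rw [e1, e2'] at d3
      rw [← d3, e3'] at d2
      rw [← d2, e4'] at d1
      unfold addr
      rw [mul_comm c n, mul_comm _ n, mul_comm _ n]
      omega

end HState

namespace HE

/-- The value of an expression. -/
def eval (s : HState) : HE → ℕ
  | const c => c
  | reg r => s.r r
  | arr c k j x => s.a c (k.eval s) (j.eval s) (x.eval s)
  | add a b => a.eval s + b.eval s
  | sub a b => a.eval s - b.eval s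
  | mul a b => a.eval s * b.eval s

/-- All registers and array cells that occur in the expression exist. -/
def Ok (n : ℕ) (s : HState) : HE → Prop
  | const _ => True
  | reg r => r < 16
  | arr c k j x => s.r 0 = n ∧ c < 4 ∧ (k.Ok n s ∧ k.eval s ∈ Set.Icc 1 n) ∧
      (j.Ok n s ∧ j.eval s ∈ Set.Icc 1 n) ∧ x.Ok n s ∧ x.eval s ∈ Set.Icc 1 n
  | add a b => a.Ok n s ∧ b.Ok n s
  | sub a b => a.Ok n s ∧ b.Ok n s
  | mul a b => a.Ok n s ∧ b.Ok n s

end HE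

/-! ### Translation of expressions, with bounds for their values -/

/-- The machine expression for the address of an array cell. -/
def addrExpr (c : ℕ) (k j x : Expr) : Expr :=
  .add (.const 16) (.add (.mul (.add (.mul (.add (.mul (.const c) (.load (.const 0)))
    (.sub k (.const 1))) (.load (.const 0))) (.sub j (.const 1))) (.load (.const 0)))
    (.sub x (.const 1)))

/-- The machine expression for an expression. -/
def HE.comp : HE → Expr
  | const c => .const c
  | reg r => .load (.const r)
  | arr c k j x => .load (addrExpr c k.comp j.comp x.comp)
  | add a b => .add a.comp b.comp
  | sub a b => .sub a.comp b.comp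
  | mul a b => .mul a.comp b.comp

/-- An exponent such that the value of the expression and of its parts is smaller than this power
of `n + 1` if the memory holds numbers up to `n + 1`. -/
def Expr.deg : Expr → ℕ
  | .const c => c + 1
  | .load a => a.deg + 2
  | .add a b => a.deg + b.deg + 1
  | .sub a b => a.deg + b.deg
  | .mul a b => a.deg + b.deg

theorem pow_lt_pow_mono_exp {n d d' W : ℕ} (hn : 1 ≤ n) (hd : d ≤ d') (h : (n + 1) ^ d' ≤ W) :
    (n + 1) ^ d ≤ W := (Nat.pow_le_pow_right (by omega) hd).trans h

/-- Exponents add up under multiplication; a sum needs one more factor n + 1 ≥ 2, and a truncated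
difference is at most its first term. The bounds are proved together with the evaluations because
enclosing expressions need them. -/
theorem Expr.Val.of_le {n S W : ℕ} {M : ℕ → ℕ} {a b : Expr} {x y : ℕ} (hn : 1 ≤ n)
    (ha : a.Val S W M x) (hb : b.Val S W M y) (hx : x < (n + 1) ^ a.deg)
    (hy : y < (n + 1) ^ b.deg) :
    ((n + 1) ^ (Expr.add a b).deg ≤ W →
      (Expr.add a b).Val S W M (x + y) ∧ x + y < (n + 1) ^ (Expr.add a b).deg) ∧
    ((n + 1) ^ (Expr.mul a b).deg ≤ W →
      (Expr.mul a b).Val S W M (x * y) ∧ x * y < (n + 1) ^ (Expr.mul a b).deg) ∧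
    ((Expr.sub a b).Val S W M (x - y) ∧ x - y < (n + 1) ^ (Expr.sub a b).deg) := by
  have h1 : x + y < (n + 1) ^ (Expr.add a b).deg := by
    have pa : (n + 1) ^ a.deg ≤ (n + 1) ^ (a.deg + b.deg) :=
      Nat.pow_le_pow_right (by omega) (by omega)
    have pb : (n + 1) ^ b.deg ≤ (n + 1) ^ (a.deg + b.deg) :=
      Nat.pow_le_pow_right (by omega) (by omega)
    have : (n + 1) ^ (Expr.add a b).deg = (n + 1) ^ (a.deg + b.deg) * (n + 1) := by
      simp [Expr.deg, pow_succ]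
    nlinarith
  have h2 : x * y < (n + 1) ^ (Expr.mul a b).deg := by
    simp only [Expr.deg, pow_add]
    exact Nat.mul_lt_mul'' hx hy
  have h3 : x - y < (n + 1) ^ (Expr.sub a b).deg :=
    lt_of_le_of_lt (Nat.sub_le _ _)
      (lt_of_lt_of_le hx (Nat.pow_le_pow_right (by omega) (by simp [Expr.deg])))
  exact ⟨fun hW => ⟨.add ha hb (h1.trans_le hW), h1⟩, fun hW => ⟨.mul ha hb (h2.trans_le hW), h2⟩,
    .sub ha hb, h3⟩

theorem Expr.Val.const_of_le {n S W : ℕ} {M : ℕ → ℕ} (hn : 1 ≤ n) (c : ℕ)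
    (hW : (n + 1) ^ (Expr.const c).deg ≤ W) :
    (Expr.const c).Val S W M c ∧ c < (n + 1) ^ (Expr.const c).deg := by
  have : c < (n + 1) ^ (c + 1) :=
    (Nat.lt_pow_self (by omega : 1 < n + 1)).trans (Nat.pow_lt_pow_right (by omega) (by omega))
  exact ⟨.const (lt_of_lt_of_le this hW), this⟩

theorem Expr.Val.load_of_le {n S W : ℕ} {M : ℕ → ℕ} (hn : 1 ≤ n) {a : Expr} {i : ℕ}
    (ha : a.Val S W M i) (hi : i < S) (hM : M i ≤ n + 1)
    (hW : (n + 1) ^ (Expr.load a).deg ≤ W) :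
    (Expr.load a).Val S W M (M i) ∧ M i < (n + 1) ^ (Expr.load a).deg := by
  have : M i < (n + 1) ^ (a.deg + 2) := by
    -- A cell holds at most n + 1, which is smaller than (n + 1)² as n ≥ 1; hence the 2 in the
    -- exponent of a load.
    have h : (n + 1) ^ 2 ≤ (n + 1) ^ (a.deg + 2) := Nat.pow_le_pow_right (by omega) (by omega)
    nlinarith
  exact ⟨.load ha hi (lt_of_lt_of_le this hW), this⟩

theorem addrExpr_val {n S W : ℕ} {M : ℕ → ℕ} (hn : 1 ≤ n) (hS : 16 + 4 * n ^ 3 ≤ S)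
    (hM0 : M 0 = n) {c k j x : ℕ} {ek ej ex : Expr}
    (hk : ek.Val S W M k) (hj : ej.Val S W M j) (hx : ex.Val S W M x)
    (hk' : k < (n + 1) ^ ek.deg) (hj' : j < (n + 1) ^ ej.deg) (hx' : x < (n + 1) ^ ex.deg)
    (hW : (n + 1) ^ (addrExpr c ek ej ex).deg ≤ W) :
    (addrExpr c ek ej ex).Val S W M (addr n c k j x) := by
  have le : ∀ d, d ≤ (addrExpr c ek ej ex).deg → (n + 1) ^ d ≤ W :=
    fun d hd => pow_lt_pow_mono_exp hn hd hW
  have h1 := Expr.Val.const_of_le (S := S) (W := W) (M := M) hn 1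
    (le _ (by simp only [addrExpr, Expr.deg]; omega))
  have hN := Expr.Val.load_of_le (S := S) (W := W) (M := M) hn
    (Expr.Val.const_of_le hn 0 (le _ (by simp only [addrExpr, Expr.deg]; omega))).1
    (by omega) (by omega) (le _ (by simp only [addrExpr, Expr.deg]; omega))
  have hc := Expr.Val.const_of_le (S := S) (W := W) (M := M) hn c
    (le _ (by simp only [addrExpr, Expr.deg]; omega))
  have h16 := Expr.Val.const_of_le (S := S) (W := W) (M := M) hn 16
    (le _ (by simp only [addrExpr, Expr.deg]; omega))
  rw [hM0] at hN
  have sk := (Expr.Val.of_le hn hk h1.1 hk' h1.2).2.2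
  have sj := (Expr.Val.of_le hn hj h1.1 hj' h1.2).2.2
  have sx := (Expr.Val.of_le hn hx h1.1 hx' h1.2).2.2
  have a1 := (Expr.Val.of_le hn hc.1 hN.1 hc.2 hN.2).2.1
    (le _ (by simp only [addrExpr, Expr.deg]; omega))
  have a2 := (Expr.Val.of_le hn a1.1 sk.1 a1.2 sk.2).1
    (le _ (by simp only [addrExpr, Expr.deg]; omega))
  have a3 := (Expr.Val.of_le hn a2.1 hN.1 a2.2 hN.2).2.1
    (le _ (by simp only [addrExpr, Expr.deg]; omega))
  have a4 := (Expr.Val.of_le hn a3.1 sj.1 a3.2 sj.2).1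
    (le _ (by simp only [addrExpr, Expr.deg]; omega))
  have a5 := (Expr.Val.of_le hn a4.1 hN.1 a4.2 hN.2).2.1
    (le _ (by simp only [addrExpr, Expr.deg]; omega))
  have a6 := (Expr.Val.of_le hn a5.1 sx.1 a5.2 sx.2).1
    (le _ (by simp only [addrExpr, Expr.deg]; omega))
  exact ((Expr.Val.of_le hn h16.1 a6.1 h16.2 a6.2).1 hW).1

theorem HE.comp_val {n S W : ℕ} (hn : 1 ≤ n) (hS : 16 + 4 * n ^ 3 ≤ S) {s : HState}
    (hs : s.Bdd n) (e : HE) (he : e.Ok n s) (hW : (n + 1) ^ e.comp.deg ≤ W) :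
    e.comp.Val S W (s.conc n).mem (e.eval s) ∧ e.eval s < (n + 1) ^ e.comp.deg := by
  induction e with
  | const c => exact Expr.Val.const_of_le hn c hW
  | reg r =>
    have hr : r < 16 := he
    have := Expr.Val.load_of_le (M := (s.conc n).mem) hn (Expr.Val.const_of_le (S := S) hn r
      (pow_lt_pow_mono_exp hn (by simp [HE.comp, Expr.deg]) hW)).1 (by omega)
      (by rw [s.conc_mem_reg n hr]; exact hs.1 r) hW
    rw [s.conc_mem_reg n hr] at this
    exact this
  | arr c k j x ihk ihj ihx =>
    obtain ⟨h0, hc, ⟨hk, hk'⟩, ⟨hj, hj'⟩, hx, hx'⟩ := he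
    have le : ∀ d, d ≤ (addrExpr c k.comp j.comp x.comp).deg → (n + 1) ^ d ≤ W :=
      fun d hd => pow_lt_pow_mono_exp hn (by simp only [HE.comp, Expr.deg] at hd ⊢; omega) hW
    have Hk := ihk hk (le _ (by simp only [addrExpr, Expr.deg]; omega))
    have Hj := ihj hj (le _ (by simp only [addrExpr, Expr.deg]; omega))
    have Hx := ihx hx (le _ (by simp only [addrExpr, Expr.deg]; omega))
    have := addrExpr_val (c := c) hn hS (by rw [s.conc_mem_reg n (by omega), h0])
      Hk.1 Hj.1 Hx.1 Hk.2 Hj.2 Hx.2 (le _ le_rfl)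
    have h := Expr.Val.load_of_le hn this
      ((addr_lt hc hk' hj' hx').trans_le hS)
      (by rw [s.conc_mem_addr hk' hj' hx']; exact hs.2 _ _ _ _) hW
    rw [s.conc_mem_addr hk' hj' hx'] at h
    exact h
  | add a b iha ihb =>
    have Ha := iha he.1 (pow_lt_pow_mono_exp hn (by simp only [HE.comp, Expr.deg]; omega) hW)
    have Hb := ihb he.2 (pow_lt_pow_mono_exp hn (by simp only [HE.comp, Expr.deg]; omega) hW)
    exact (Expr.Val.of_le hn Ha.1 Hb.1 Ha.2 Hb.2).1 hW
  | sub a b iha ihb =>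
    have Ha := iha he.1 (pow_lt_pow_mono_exp hn (by simp only [HE.comp, Expr.deg]; omega) hW)
    have Hb := ihb he.2 (pow_lt_pow_mono_exp hn (by simp only [HE.comp, Expr.deg]; omega) hW)
    exact (Expr.Val.of_le hn Ha.1 Hb.1 Ha.2 Hb.2).2.2
  | mul a b iha ihb =>
    have Ha := iha he.1 (pow_lt_pow_mono_exp hn (by simp only [HE.comp, Expr.deg]; omega) hW)
    have Hb := ihb he.2 (pow_lt_pow_mono_exp hn (by simp only [HE.comp, Expr.deg]; omega) hW)
    exact (Expr.Val.of_le hn Ha.1 Hb.1 Ha.2 Hb.2).2.1 hW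

/-! ### Translation of programs -/

/-- Programs over registers and arrays. -/
inductive HP where
  | skip
  | set (r : ℕ) (e : HE)
  | seta (c : ℕ) (k j x e : HE)
  | readr (r : ℕ)
  | seq (p q : HP)
  | cond (e : HE) (p q : HP)
  | loop (e : HE) (p : HP)

/-- The machine program for a program. -/
def HP.comp : HP → Prog
  | skip => .skip
  | set r e => .store (.const r) e.comp
  | seta c k j x e => .store (addrExpr c k.comp j.comp x.comp) e.comp
  | readr r => .read (.const r)
  | seq p q => .seq p.comp q.comp
  | cond e p q => .cond e.comp p.comp q.comp
  | loop e p => .loop e.comp p.comp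

/-- A bound for the exponents of all expressions in a program. -/
def Prog.deg : Prog → ℕ
  | .skip => 0
  | .store a e => a.deg + e.deg
  | .read a => a.deg + 2
  | .seq p q => p.deg + q.deg
  | .cond e p q => e.deg + p.deg + q.deg
  | .loop e p => e.deg + p.deg

/-- Execution of programs over registers and arrays. -/
inductive HRuns (n : ℕ) : HP → HState → HState → ℕ → Prop
  | skip (s : HState) : HRuns n .skip s s 1
  | set {r : ℕ} {e : HE} {s : HState} (hr : r < 16) (he : e.Ok n s) (hv : e.eval s ≤ n + 1) :
      HRuns n (.set r e) s (s.setR r (e.eval s)) (e.comp.cost + 2)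
  | seta {c : ℕ} {k j x e : HE} {s : HState} (ha : (HE.arr c k j x).Ok n s) (he : e.Ok n s)
      (hv : e.eval s ≤ n + 1) :
      HRuns n (.seta c k j x e) s (s.setA c (k.eval s) (j.eval s) (x.eval s) (e.eval s))
        ((addrExpr c k.comp j.comp x.comp).cost + e.comp.cost + 1)
  | readr {r : ℕ} {s : HState} {v : ℕ} {l : List ℕ} (hr : r < 16) (hl : s.inp = v :: l)
      (hv : v ≤ n + 1) : HRuns n (.readr r) s { s.setR r v with inp := l } 2
  | seq {p q : HP} {s s₁ s₂ : HState} {t₁ t₂ : ℕ} (hp : HRuns n p s s₁ t₁)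
      (hq : HRuns n q s₁ s₂ t₂) : HRuns n (.seq p q) s s₂ (t₁ + t₂)
  | condTrue {e : HE} {p q : HP} {s s₁ : HState} {t : ℕ} (he : e.Ok n s)
      (hv : e.eval s ≠ 0) (hp : HRuns n p s s₁ t) :
      HRuns n (.cond e p q) s s₁ (e.comp.cost + 1 + t)
  | condFalse {e : HE} {p q : HP} {s s₁ : HState} {t : ℕ} (he : e.Ok n s)
      (hv : e.eval s = 0) (hq : HRuns n q s s₁ t) :
      HRuns n (.cond e p q) s s₁ (e.comp.cost + 1 + t)
  | loopTrue {e : HE} {p : HP} {s s₁ s₂ : HState} {t₁ t₂ : ℕ} (he : e.Ok n s)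
      (hv : e.eval s ≠ 0) (hp : HRuns n p s s₁ t₁) (hr : HRuns n (.loop e p) s₁ s₂ t₂) :
      HRuns n (.loop e p) s s₂ (e.comp.cost + 1 + t₁ + t₂)
  | loopFalse {e : HE} {p : HP} {s : HState} (he : e.Ok n s) (hv : e.eval s = 0) :
      HRuns n (.loop e p) s s (e.comp.cost + 1)

theorem HState.Bdd.setR {n : ℕ} {s : HState} (hs : s.Bdd n) {r v : ℕ} (hv : v ≤ n + 1) :
    (s.setR r v).Bdd n := by
  refine ⟨fun i => ?_, hs.2⟩
  by_cases h : i = r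
  · subst h; simpa using hv
  · rw [HState.setR_r_of_ne _ _ h]; exact hs.1 i

/-- The number of steps is preserved exactly. The exponent of the word bound depends only on the
program text, so one power of n + 1 serves all inputs. `Bdd` is carried along because it bounds the
results of loads; it allows n + 1, the final value of an upward loop counter. -/
theorem HRuns.runs {n S W : ℕ} (hn : 1 ≤ n) (hS : 16 + 4 * n ^ 3 ≤ S) {p : HP} {s s' : HState}
    {t : ℕ} (h : HRuns n p s s' t) (hs : s.Bdd n) (hW : (n + 1) ^ p.comp.deg ≤ W) :
    Runs S W p.comp (s.conc n) (s'.conc n) t ∧ s'.Bdd n := by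
  induction h with
  | skip s => exact ⟨.skip _, hs⟩
  | @set r e s hr he hv =>
    have h1 := Expr.Val.const_of_le (S := S) (W := W) (M := (s.conc n).mem) hn r
      (pow_lt_pow_mono_exp hn (by simp only [HP.comp, Prog.deg]; omega) hW)
    have h2 := HE.comp_val hn hS hs e he
      (pow_lt_pow_mono_exp hn (by simp only [HP.comp, Prog.deg]; omega) hW)
    refine ⟨?_, hs.setR hv⟩
    rw [HState.conc_setR _ _ _ hr]
    have := Runs.store h1.1 (by omega) h2.1
    rwa [show (Expr.const r).cost + e.comp.cost + 1 = e.comp.cost + 2 by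
      simp only [Expr.cost]; omega] at this
  | @seta c k j x e s ha he hv =>
    obtain ⟨h0, hc, ⟨hk, hk'⟩, ⟨hj, hj'⟩, hx, hx'⟩ := ha
    have le : ∀ d, d ≤ (addrExpr c k.comp j.comp x.comp).deg → (n + 1) ^ d ≤ W :=
      fun d hd => pow_lt_pow_mono_exp hn (by simp only [HP.comp, Prog.deg]; omega) hW
    have Hk := HE.comp_val (W := W) hn hS hs k hk (le _ (by simp only [addrExpr, Expr.deg]; omega))
    have Hj := HE.comp_val (W := W) hn hS hs j hj (le _ (by simp only [addrExpr, Expr.deg]; omega))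
    have Hx := HE.comp_val (W := W) hn hS hs x hx (le _ (by simp only [addrExpr, Expr.deg]; omega))
    have h1 := addrExpr_val (c := c) hn hS (by rw [s.conc_mem_reg n (by omega), h0])
      Hk.1 Hj.1 Hx.1 Hk.2 Hj.2 Hx.2 (le _ le_rfl)
    have h2 := HE.comp_val hn hS hs e he
      (pow_lt_pow_mono_exp hn (by simp only [HP.comp, Prog.deg]; omega) hW)
    refine ⟨?_, hs.1, fun c' k' j' x' => ?_⟩
    · rw [HState.conc_setA _ _ hk' hj' hx']
      exact Runs.store h1 ((addr_lt hc hk' hj' hx').trans_le hS) h2.1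
    · simp only [HState.setA]
      split_ifs
      · exact hv
      · exact hs.2 _ _ _ _
  | @readr r s v l hr hl hv =>
    have h1 := Expr.Val.const_of_le (S := S) (W := W) (M := (s.conc n).mem) hn r
      (pow_lt_pow_mono_exp hn (by simp only [HP.comp, Prog.deg]; omega) hW)
    have h2 : v < W := by
      have := pow_lt_pow_mono_exp (d := 2) hn (by simp only [HP.comp, Prog.deg]; omega) hW
      nlinarith
    refine ⟨?_, hs.setR hv⟩
    have e : (({ s.setR r v with inp := l } : HState).conc n) =
        ⟨Function.update (s.conc n).mem r v, l⟩ := by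
      have := s.conc_setR n v hr
      simp only [HState.conc, State.mk.injEq] at this ⊢
      exact ⟨this.1, trivial⟩
    rw [e]
    exact Runs.read h1.1 (by omega) hl h2
  | seq hp hq ihp ihq =>
    have h1 := ihp hs (pow_lt_pow_mono_exp hn (by simp only [HP.comp, Prog.deg]; omega) hW)
    have h2 := ihq h1.2 (pow_lt_pow_mono_exp hn (by simp only [HP.comp, Prog.deg]; omega) hW)
    exact ⟨.seq h1.1 h2.1, h2.2⟩
  | @condTrue e p q s s₁ t he hv hp ihp =>
    have h1 := ihp hs (pow_lt_pow_mono_exp hn (by simp only [HP.comp, Prog.deg]; omega) hW)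
    have h2 := HE.comp_val (W := W) hn hS hs e he
      (pow_lt_pow_mono_exp hn (by simp only [HP.comp, Prog.deg]; omega) hW)
    exact ⟨.condTrue h2.1 hv h1.1, h1.2⟩
  | @condFalse e p q s s₁ t he hv hp ihp =>
    have h1 := ihp hs (pow_lt_pow_mono_exp hn (by simp only [HP.comp, Prog.deg]; omega) hW)
    have h2 := HE.comp_val (W := W) hn hS hs e he
      (pow_lt_pow_mono_exp hn (by simp only [HP.comp, Prog.deg]; omega) hW)
    rw [hv] at h2
    exact ⟨.condFalse h2.1 h1.1, h1.2⟩
  | @loopTrue e p s s₁ s₂ t₁ t₂ he hv hp hr ihp ihr =>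
    have h1 := ihp hs (pow_lt_pow_mono_exp hn (by simp only [HP.comp, Prog.deg]; omega) hW)
    have h2 := HE.comp_val (W := W) hn hS hs e he
      (pow_lt_pow_mono_exp hn (by simp only [HP.comp, Prog.deg]; omega) hW)
    have h3 := ihr h1.2 hW
    exact ⟨.loopTrue h2.1 hv h1.1 h3.1, h3.2⟩
  | @loopFalse e p s he hv =>
    have h2 := HE.comp_val (W := W) hn hS hs e he
      (pow_lt_pow_mono_exp hn (by simp only [HP.comp, Prog.deg]; omega) hW)
    rw [hv] at h2
    exact ⟨.loopFalse h2.1, hs⟩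

/-! ## Rules for loops -/

/-- The registers `0` and `lo, lo + 1, …` and the input are the same. -/
def Keep (lo : ℕ) (s s' : HState) : Prop :=
  (∀ i, i = 0 ∨ lo ≤ i → s'.r i = s.r i) ∧ s'.inp = s.inp

theorem Keep.refl (lo : ℕ) (s : HState) : Keep lo s s := ⟨fun _ _ => rfl, rfl⟩

theorem Keep.trans {lo : ℕ} {s s' s'' : HState} (h : Keep lo s s') (h' : Keep lo s' s'') :
    Keep lo s s'' := ⟨fun i hi => (h'.1 i hi).trans (h.1 i hi), h'.2.trans h.2⟩

/-- Outer loops use registers with larger numbers than inner ones, so what an inner loop keeps is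
also kept in the sense of the outer body. -/
theorem Keep.mono {lo lo' : ℕ} {s s' : HState} (h : Keep lo s s') (hl : lo ≤ lo') :
    Keep lo' s s' := ⟨fun i hi => h.1 i (by omega), h.2⟩

theorem Keep.setR {lo : ℕ} {s s' : HState} (h : Keep lo s s') {i : ℕ} (hi : i ≠ 0) (hl : i < lo)
    (v : ℕ) : Keep lo s (s'.setR i v) :=
  ⟨fun i' hi' => by rw [HState.setR_r_of_ne _ _ (by omega)]; exact h.1 i' hi', h.2⟩

/-- `for r = e, …, n do p`, where the register `0` contains `n`. -/
def HP.for (r : ℕ) (e : HE) (p : HP) : HP :=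
  .seq (.set r e) (.loop (.sub (.add (.reg 0) (.const 1)) (.reg r))
    (.seq p (.set r (.add (.reg r) (.const 1)))))

/-- `for r = …, 1 do p`, downwards from the content of `r`. -/
def HP.down (r : ℕ) (p : HP) : HP :=
  .loop (.reg r) (.seq p (.set r (.sub (.reg r) (.const 1))))

/-- A rule for upward loops.  The second argument of the invariant is the potential. -/
theorem HRuns.for_loop {n : ℕ} {r : ℕ} {p : HP} (hr : r < 16) (hr0 : r ≠ 0) (e : HE) (c x₀ : ℕ)
    (I : ℕ → ℕ → HState → Prop) (s : HState) (φ : ℕ) (h0 : s.r 0 = n) (he : e.Ok n s)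
    (hx₀ : e.eval s = x₀) (hen : x₀ ≤ n + 1) (hI : I x₀ φ (s.setR r x₀))
    (hbody : ∀ x φ s, x₀ ≤ x → x ≤ n → s.r r = x → s.r 0 = n → I x φ s →
      ∃ s' t φ', HRuns n p s s' t ∧ s'.r r = x ∧ s'.r 0 = n ∧ I (x + 1) φ' (s'.setR r (x + 1)) ∧
        t + φ' ≤ c + φ) :
    ∃ s' t φ', HRuns n (HP.for r e p) s s' t ∧ s'.r 0 = n ∧ I (n + 1) φ' s' ∧
      t + φ' ≤ (n + 1 - x₀) * (c + 14) + (e.comp.cost + 10) + φ := by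
  -- Here d counts the remaining rounds. Apart from its body a round costs 14 steps, 8 for the test
  -- and 6 for the increment; the last, failing test costs another 8.
  have key : ∀ d x φ s, x + d = n + 1 → x₀ ≤ x → s.r r = x → s.r 0 = n → I x φ s →
      ∃ s' t φ', HRuns n (.loop (.sub (.add (.reg 0) (.const 1)) (.reg r))
        (.seq p (.set r (.add (.reg r) (.const 1))))) s s' t ∧ s'.r 0 = n ∧ I (n + 1) φ' s' ∧
        t + φ' ≤ d * (c + 14) + 8 + φ := by
    intro d
    induction d with
    | zero =>
      intro x φ s hx hx₀ hsr hs0 hI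
      refine ⟨s, _, φ, .loopFalse ⟨⟨by simp [HE.Ok], trivial⟩, hr⟩ ?_, hs0, ?_, ?_⟩
      · simp only [HE.eval]; omega
      · obtain rfl : x = n + 1 := by omega
        exact hI
      · simp [HE.comp, Expr.cost]
    | succ d ih =>
      intro x φ s hx hx₀ hsr hs0 hI
      obtain ⟨s₁, t₁, φ₁, hrun, hr₁, hn₁, hI₁, ht₁⟩ :=
        hbody x φ s hx₀ (by omega) hsr hs0 hI
      obtain ⟨s₂, t₂, φ₂, hrun₂, hn₂, hI₂, ht₂⟩ := ih (x + 1) φ₁ (s₁.setR r (x + 1)) (by omega)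
        (by omega) (by simp) (by rw [HState.setR_r_of_ne _ _ (Ne.symm hr0), hn₁]) hI₁
      have hset : HRuns n (.set r (.add (.reg r) (.const 1))) s₁ (s₁.setR r (x + 1))
          ((HE.add (.reg r) (.const 1)).comp.cost + 2) := by
        have := HRuns.set (n := n) (e := .add (.reg r) (.const 1)) (s := s₁) hr ⟨hr, trivial⟩
          (by simp only [HE.eval]; omega)
        simpa only [HE.eval, hr₁] using this
      refine ⟨s₂, _, φ₂, .loopTrue ⟨⟨by simp [HE.Ok], trivial⟩, hr⟩ ?_ (.seq hrun hset) hrun₂,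
        hn₂, hI₂, ?_⟩
      · simp only [HE.eval]; omega
      · simp only [HE.comp, Expr.cost]
        rw [Nat.succ_mul]
        omega
  obtain ⟨s', t, φ', hrun, h0', hI', ht⟩ := key (n + 1 - x₀) x₀ φ (s.setR r x₀) (by omega) le_rfl
    (by simp) (by rw [HState.setR_r_of_ne _ _ (Ne.symm hr0), h0]) hI
  have hset := HRuns.set (n := n) (r := r) (e := e) (s := s) hr he (by omega)
  rw [hx₀] at hset
  exact ⟨s', _, φ', .seq hset hrun, h0', hI', by omega⟩

/-- A rule for upward loops whose bodies keep the registers from the loop counter on. -/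
theorem HRuns.for_keep {n : ℕ} {r : ℕ} {p : HP} (hr : r < 16) (hr0 : r ≠ 0) (e : HE) (c x₀ : ℕ)
    (I : ℕ → ℕ → (ℕ → ℕ → ℕ → ℕ → ℕ) → Prop) (s : HState) (φ : ℕ) (h0 : s.r 0 = n)
    (he : e.Ok n s) (hx₀ : e.eval s = x₀) (hen : x₀ ≤ n + 1) (hI : I x₀ φ s.a)
    (hbody : ∀ x φ s₁, x₀ ≤ x → x ≤ n → s₁.r r = x → Keep (r + 1) s s₁ → I x φ s₁.a →
      ∃ s' t φ', HRuns n p s₁ s' t ∧ Keep r s₁ s' ∧ I (x + 1) φ' s'.a ∧ t + φ' ≤ c + φ) :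
    ∃ s' t φ', HRuns n (HP.for r e p) s s' t ∧ Keep (r + 1) s s' ∧ I (n + 1) φ' s'.a ∧
      t + φ' ≤ (n + 1 - x₀) * (c + 14) + (e.comp.cost + 10) + φ := by
  obtain ⟨s', t, φ', h1, -, h2, h3⟩ := HRuns.for_loop hr hr0 e c x₀
    (fun x φ s₁ => Keep (r + 1) s s₁ ∧ I x φ s₁.a) s φ h0 he hx₀ hen
    ⟨(Keep.refl _ s).setR hr0 (by omega) _, hI⟩ (by
      rintro x φ s₁ hx hxn hsr hs0 ⟨hk, hI⟩
      obtain ⟨s', t, φ', h1, h2, h3, h4⟩ := hbody x φ s₁ hx hxn hsr hk hI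
      exact ⟨s', t, φ', h1, by rw [h2.1 r (by omega), hsr], by rw [h2.1 0 (by omega), hs0],
        ⟨(hk.trans (h2.mono (by omega))).setR hr0 (by omega) _, h3⟩, h4⟩)
  exact ⟨s', t, φ', h1, h2.1, h2.2, h3⟩

/-- A rule for downward loops whose bodies keep the registers from the loop counter on. -/
theorem HRuns.down_keep {n : ℕ} {r : ℕ} {p : HP} (hr : r < 16) (hr0 : r ≠ 0) (c x₀ : ℕ)
    (I : ℕ → ℕ → (ℕ → ℕ → ℕ → ℕ → ℕ) → Prop) (s : HState) (φ : ℕ)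
    (hx₀ : s.r r = x₀) (hen : x₀ ≤ n) (hI : I x₀ φ s.a)
    (hbody : ∀ x φ s₁, x + 1 ≤ x₀ → s₁.r r = x + 1 → Keep (r + 1) s s₁ → I (x + 1) φ s₁.a →
      ∃ s' t φ', HRuns n p s₁ s' t ∧ Keep r s₁ s' ∧ I x φ' s'.a ∧ t + φ' ≤ c + φ) :
    ∃ s' t φ', HRuns n (HP.down r p) s s' t ∧ Keep (r + 1) s s' ∧ I 0 φ' s'.a ∧
      t + φ' ≤ x₀ * (c + 14) + 8 + φ := by
  have key : ∀ x φ s₁, x ≤ x₀ → s₁.r r = x → Keep (r + 1) s s₁ → I x φ s₁.a →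
      ∃ s' t φ', HRuns n (HP.down r p) s₁ s' t ∧ Keep (r + 1) s s' ∧ I 0 φ' s'.a ∧
      t + φ' ≤ x * (c + 14) + 8 + φ := by
    intro x
    induction x with
    | zero =>
      intro φ s₁ _ hsr hk hI
      exact ⟨s₁, _, φ, .loopFalse hr (by simp only [HE.eval, hsr]), hk, hI, by
        simp [HE.comp, Expr.cost]⟩
    | succ x ih =>
      intro φ s₁ hx hsr hk hI
      obtain ⟨s₂, t₁, φ₁, hrun, hk₁, hI₁, ht₁⟩ := hbody x φ s₁ hx hsr hk hI
      obtain ⟨s₃, t₂, φ₂, hrun₂, hk₂, hI₂, ht₂⟩ := ih φ₁ (s₂.setR r x) (by omega)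
        (by simp) ((hk.trans (hk₁.mono (by omega))).setR hr0 (by omega) _) hI₁
      have hr₁ : s₂.r r = x + 1 := by rw [hk₁.1 r (by omega), hsr]
      have hset : HRuns n (.set r (.sub (.reg r) (.const 1))) s₂ (s₂.setR r x)
          ((HE.sub (.reg r) (.const 1)).comp.cost + 2) := by
        have := HRuns.set (n := n) (e := .sub (.reg r) (.const 1)) (s := s₂) hr ⟨hr, trivial⟩
          (by simp only [HE.eval]; omega)
        simpa only [HE.eval, hr₁, Nat.add_sub_cancel] using this
      refine ⟨s₃, _, φ₂, .loopTrue hr (by simp only [HE.eval]; omega) (.seq hrun hset) hrun₂,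
        hk₂, hI₂, ?_⟩
      simp only [HE.comp, Expr.cost]
      rw [Nat.succ_mul]
      omega
  exact key x₀ φ s le_rfl hx₀ (Keep.refl _ s) hI

/-! ## Loops over the cells of a row -/

/-- `for w = 1, …, n do a c k j e₁ := e₂`, where the expressions may depend on `w`, which is kept
in the register `1`. -/
def HP.assign (c : ℕ) (k j e₁ e₂ : HE) : HP :=
  HP.for 1 (.const 1) (.seta c k j e₁ e₂)

/-- A time bound, per cell, for loops over the cells of a row. -/
def HP.assignCost (c : ℕ) (k j e₁ e₂ : HE) : ℕ :=
  (addrExpr c k.comp j.comp e₁.comp).cost + e₂.comp.cost + 26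

/-- The expressions need to have the right values only in states that differ from the initial one in
cells already written. So with f₁ = id a row can be updated in place, and with f₁ a permutation an
inverse is written without any search: the value for w goes to the cell of the image of w. -/
theorem HRuns.assign {n : ℕ} {c : ℕ} {k j e₁ e₂ : HE} {s : HState} {kv jv : ℕ} (hc : c < 4)
    (hn : 1 ≤ n)
    (h0 : s.r 0 = n) (hkv : kv ∈ Set.Icc 1 n) (hjv : jv ∈ Set.Icc 1 n) (f₁ f₂ : ℕ → ℕ)
    (hf₁ : ∀ w ∈ Set.Icc 1 n, f₁ w ∈ Set.Icc 1 n) (hf₂ : ∀ w ∈ Set.Icc 1 n, f₂ w ≤ n)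
    (hinj : ∀ w ∈ Set.Icc 1 n, ∀ w' ∈ Set.Icc 1 n, f₁ w = f₁ w' → w = w')
    (h : ∀ s₁ : HState, ∀ w ∈ Set.Icc 1 n, Keep 2 s s₁ → s₁.r 1 = w →
      (∀ c' k' j' x', (c' = c → k' = kv → j' = jv → ∀ w' ∈ Set.Icc 1 n, w' < w → x' ≠ f₁ w') →
        s₁.a c' k' j' x' = s.a c' k' j' x') →
      (k.Ok n s₁ ∧ k.eval s₁ = kv) ∧ (j.Ok n s₁ ∧ j.eval s₁ = jv) ∧
      (e₁.Ok n s₁ ∧ e₁.eval s₁ = f₁ w) ∧ e₂.Ok n s₁ ∧ e₂.eval s₁ = f₂ w) :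
    ∃ s' t, HRuns n (HP.assign c k j e₁ e₂) s s' t ∧ Keep 2 s s' ∧
      (∀ c' k' j' x', (c' = c → k' = kv → j' = jv → x' ∉ Set.Icc 1 n) →
        s'.a c' k' j' x' = s.a c' k' j' x') ∧
      (∀ w ∈ Set.Icc 1 n, s'.a c kv jv (f₁ w) = f₂ w) ∧
      t ≤ HP.assignCost c k j e₁ e₂ * n := by
  obtain ⟨s', t, φ', h1, h2, h3, h4⟩ := HRuns.for_keep (n := n) (r := 1)
    (p := .seta c k j e₁ e₂) (by omega) (by omega) (.const 1)
    ((addrExpr c k.comp j.comp e₁.comp).cost + e₂.comp.cost + 1) 1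
    (fun x _ a => (∀ c' k' j' x', (c' = c → k' = kv → j' = jv → ∀ w' ∈ Set.Icc 1 n, w' < x →
        x' ≠ f₁ w') → a c' k' j' x' = s.a c' k' j' x') ∧
      ∀ w ∈ Set.Icc 1 n, w < x → a c kv jv (f₁ w) = f₂ w) s 0 h0 trivial rfl (by omega)
    ⟨fun _ _ _ _ _ => rfl, fun w hw hw' => absurd hw.1 (by omega)⟩ (by
      rintro x φ s₁ hx hxn hs1 hk ⟨ha, hb⟩
      obtain ⟨⟨hk1, hk2⟩, ⟨hj1, hj2⟩, ⟨he1, he1'⟩, he2, he2'⟩ := h s₁ x ⟨hx, hxn⟩ hk hs1 ha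
      have h0' : s₁.r 0 = n := by rw [hk.1 0 (by omega), h0]
      have hrun := HRuns.seta (n := n) (c := c) (k := k) (j := j) (x := e₁) (e := e₂) (s := s₁)
        ⟨h0', hc, ⟨hk1, hk2 ▸ hkv⟩, ⟨hj1, hj2 ▸ hjv⟩, he1, he1' ▸ hf₁ x ⟨hx, hxn⟩⟩ he2
        (by have := hf₂ x ⟨hx, hxn⟩; omega)
      rw [hk2, hj2, he1', he2'] at hrun
      refine ⟨_, _, 0, hrun, ⟨fun _ _ => rfl, rfl⟩, ⟨?_, ?_⟩, by omega⟩
      · intro c' k' j' x' hne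
        simp only [HState.setA]
        rw [if_neg, ha]
        · exact fun e1 e2 e3 w' hw' hlt => hne e1 e2 e3 w' hw' (by omega)
        · rintro ⟨e1, e2, e3, e4⟩
          exact hne e1 e2 e3 x ⟨hx, hxn⟩ (by omega) e4
      · intro w hw hlt
        simp only [HState.setA, true_and]
        by_cases hwx : w = x
        · subst hwx; simp
        · rw [if_neg, hb w hw (by omega)]
          exact fun e => hwx (hinj w hw x ⟨hx, hxn⟩ e))
  refine ⟨s', t, h1, h2, fun c' k' j' x' hne => h3.1 c' k' j' x' fun e1 e2 e3 w' hw' _ e => ?_,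
    fun w hw => h3.2 w hw (by have := hw.2; omega), ?_⟩
  · exact hne e1 e2 e3 (e ▸ hf₁ w' hw')
  · have e : (HE.const 1).comp.cost = 1 := rfl
    rw [e, Nat.add_sub_cancel] at h4
    unfold HP.assignCost
    nlinarith

/-! ## Perms that fix all points greater than `k` -/

/-- `Π(k)` as a subgroup. -/
def permsSub (k : ℕ) : Subgroup (Equiv.Perm ℕ) where
  carrier := perms k
  mul_mem' {a b} ha hb i hi := by rw [Equiv.Perm.mul_apply, hb i hi, ha i hi]
  one_mem' _ _ := rfl
  inv_mem' {a} ha i hi := by rw [Equiv.Perm.inv_eq_iff_eq, ha i hi]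

theorem perms_mono {k k' : ℕ} (h : k ≤ k') : perms k ⊆ perms k' :=
  fun _ hs i hi => hs i fun hi' => hi ⟨hi'.1, hi'.2.trans h⟩

theorem perms_apply_mem {k n x : ℕ} {s : Equiv.Perm ℕ} (hs : s ∈ perms k) (h : k ≤ n)
    (hx : x ∈ Set.Icc 1 n) : s x ∈ Set.Icc 1 n := by
  by_contra hc
  exact hc ((s.injective (perms_mono h hs _ hc)).symm ▸ hx)

theorem eq_one_of_mem_perms_zero {s : Equiv.Perm ℕ} (hs : s ∈ perms 0) : s = 1 :=
  Equiv.ext fun i => hs i (by simp)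

theorem mem_perms_pred {i : ℕ} {s : Equiv.Perm ℕ} (hs : s ∈ perms (i + 1))
    (h : s (i + 1) = i + 1) : s ∈ perms i := by
  intro x hx
  by_cases hx' : x = i + 1
  · rw [hx', h]
  · exact hs x fun h' => hx ⟨h'.1, by have := h'.2; omega⟩

/-! ## Generators and labels -/

/-- The group generated by the entries in `Π(k)` and by `z`, if `z` is in `Π(k)`. -/
def genWith (E : Table) (z : Equiv.Perm ℕ) (k : ℕ) : Subgroup (Equiv.Perm ℕ) :=
  Subgroup.closure {s | s ∈ perms k ∧ (s = z ∨ ∃ i j, E i j = some s)}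

/-- The group generated by the entries in `Π(k)`. -/
def gen (E : Table) (k : ℕ) : Subgroup (Equiv.Perm ℕ) :=
  Subgroup.closure {s | s ∈ perms k ∧ ∃ i j, E i j = some s}

theorem gen_le_genWith (E : Table) (z : Equiv.Perm ℕ) (k : ℕ) : gen E k ≤ genWith E z k :=
  Subgroup.closure_mono fun _ hs => ⟨hs.1, .inr hs.2⟩

theorem genWith_one (E : Table) (k : ℕ) : genWith E 1 k = gen E k := by
  refine le_antisymm ((Subgroup.closure_le _).2 ?_) (gen_le_genWith _ _ _)
  rintro s ⟨hs, rfl | h⟩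
  · exact one_mem _
  · exact Subgroup.subset_closure ⟨hs, h⟩

theorem genWith_le_permsSub (E : Table) (z : Equiv.Perm ℕ) (k : ℕ) :
    genWith E z k ≤ permsSub k := (Subgroup.closure_le _).2 fun _ hs => hs.1

theorem gen_le_permsSub (E : Table) (k : ℕ) : gen E k ≤ permsSub k :=
  (Subgroup.closure_le _).2 fun _ hs => hs.1

theorem gen_mono {E E' : Table} {k k' : ℕ} (hk : k ≤ k')
    (h : ∀ i j s, E i j = some s → E' i j = some s) : gen E k ≤ gen E' k' :=
  Subgroup.closure_mono fun _ ⟨hs, i, j, hij⟩ => ⟨perms_mono hk hs, i, j, h i j _ hij⟩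

theorem self_mem_genWith (E : Table) {z : Equiv.Perm ℕ} {k : ℕ} (h : z ∈ perms k) :
    z ∈ genWith E z k := Subgroup.subset_closure ⟨h, .inl rfl⟩

theorem mem_gen {E : Table} {s : Equiv.Perm ℕ} {i j k : ℕ} (h : E i j = some s)
    (hs : s ∈ perms k) : s ∈ gen E k := Subgroup.subset_closure ⟨hs, i, j, h⟩

theorem gen_le_of_forall {E : Table} {G : Subgroup (Equiv.Perm ℕ)}
    (h : ∀ i j s, E i j = some s → s ∈ G) (k : ℕ) : gen E k ≤ G :=
  (Subgroup.closure_le _).2 fun s ⟨_, i, j, hij⟩ => h i j s hij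

/-- Labels: `P k v` takes `v` to the representative of its orbit under the group of level `k`. -/
abbrev Labels := ℕ → ℕ → Equiv.Perm ℕ

/-- The representative of the class of `v`. -/
def Labels.root (P : Labels) (k v : ℕ) : ℕ := P k v v

/-- `s` preserves the classes of level `k`. -/
def Compat (n : ℕ) (P : Labels) (k : ℕ) (s : Equiv.Perm ℕ) : Prop :=
  ∀ x ∈ Set.Icc 1 n, P.root k (s x) = P.root k x

theorem Compat.mul {n k : ℕ} {P : Labels} {s s' : Equiv.Perm ℕ} (h : Compat n P k s)
    (h' : Compat n P k s') (hs' : s' ∈ perms n) : Compat n P k (s * s') := fun x hx => by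
  rw [Equiv.Perm.mul_apply, h _ (perms_apply_mem hs' le_rfl hx), h' x hx]

/-- The conditions for the entries and labels that do not refer to the generated groups. -/
structure Core (n : ℕ) (E : Table) (P : Labels) : Prop where
  wf : ∀ i j s, E i j = some s → 1 ≤ j ∧ j < i ∧ i ≤ n ∧ s ∈ perms i ∧ s i = j
  diag : ∀ k ∈ Set.Icc 1 n, P k k = 1
  compat : ∀ k ∈ Set.Icc 1 n, ∀ i j s, E i j = some s → s ∈ perms k → Compat n P k s

theorem Core.root_diag {n : ℕ} {E : Table} {P : Labels} (h : Core n E P) {k : ℕ}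
    (hk : k ∈ Set.Icc 1 n) : P.root k k = k := by simp [Labels.root, h.diag k hk]

/-- Preservation of the classes passes to products and inverses, hence from the entries to their
group: each class is a union of orbits. Labels in the group, as in `Inv.lab`, give the converse. -/
theorem Core.compat_of_mem {n : ℕ} {E : Table} {P : Labels} (h : Core n E P) {k : ℕ}
    (hk : k ∈ Set.Icc 1 n) {s : Equiv.Perm ℕ} (hs : s ∈ gen E k) : Compat n P k s := by
  induction hs using Subgroup.closure_induction with
  | mem s hs => obtain ⟨h1, i, j, hij⟩ := hs; exact h.compat k hk i j s hij h1
  | one => intro x _; rfl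
  | mul s s' _ hs' ih ih' =>
    exact ih.mul ih' (perms_mono hk.2 (gen_le_permsSub E k hs'))
  | inv s hs ih =>
    intro x hx
    have := ih (s⁻¹ x)
      (perms_apply_mem (permsSub k |>.inv_mem (gen_le_permsSub E k hs)) hk.2 hx)
    simpa using this.symm

/-- The invariant between insertions. -/
structure Inv (n : ℕ) (G : Subgroup (Equiv.Perm ℕ)) (E : Table) (P : Labels) : Prop
    extends Core n E P where
  lab : ∀ k ∈ Set.Icc 1 n, ∀ v ∈ Set.Icc 1 n, P k v ∈ gen E k
  inG : ∀ i j s, E i j = some s → s ∈ G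

/-! ## Potentials -/

/-- The number of pairs of a level and a point that is not in the orbit of this level. -/
def unc (n : ℕ) (P : Labels) : ℕ :=
  ((Finset.Icc 1 n ×ˢ Finset.Icc 1 n).filter fun p => P.root p.1 p.2 ≠ p.1).card

/-- The number of classes on all levels. -/
def imc (n : ℕ) (P : Labels) : ℕ :=
  ∑ k ∈ Finset.Icc 1 n, ((Finset.Icc 1 n).image (P.root k)).card

/-- The set of nonempty entries. -/
def ent (n : ℕ) (E : Table) : Finset (ℕ × ℕ) :=
  (Finset.Icc 1 n ×ˢ Finset.Icc 1 n).filter fun p => (E p.1 p.2).isSome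

theorem mem_ent {n : ℕ} {E : Table} {p : ℕ × ℕ} :
    p ∈ ent n E ↔ (p.1 ∈ Set.Icc 1 n ∧ p.2 ∈ Set.Icc 1 n) ∧ (E p.1 p.2).isSome := by
  simp [ent, Set.mem_Icc]

theorem ent_mono {n : ℕ} {E E' : Table} (h : ∀ i j s, E i j = some s → E' i j = some s) :
    ent n E ⊆ ent n E' := by
  intro p hp
  rw [mem_ent] at hp ⊢
  obtain ⟨s, hs⟩ := Option.isSome_iff_exists.1 hp.2
  exact ⟨hp.1, by rw [h _ _ s hs]; rfl⟩

theorem unc_le (n : ℕ) (P : Labels) : unc n P ≤ n ^ 2 := by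
  refine (Finset.card_filter_le _ _).trans ?_
  simp [sq]

theorem ent_card_le (n : ℕ) (E : Table) : (ent n E).card ≤ n ^ 2 := by
  refine (Finset.card_filter_le _ _).trans ?_
  simp [sq]

theorem imc_le (n : ℕ) (P : Labels) : imc n P ≤ n ^ 2 := by
  refine (Finset.sum_le_card_nsmul _ _ n fun k _ => ?_).trans ?_
  · exact Finset.card_image_le.trans (by simp)
  · simp [sq]

theorem unc_lt {n : ℕ} {P P' : Labels} (h : ∀ k v, P.root k v = k → P'.root k v = k) {i j : ℕ}
    (hi : i ∈ Set.Icc 1 n) (hj : j ∈ Set.Icc 1 n) (h1 : P.root i j ≠ i) (h2 : P'.root i j = i) :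
    unc n P' < unc n P := by
  refine Finset.card_lt_card (Finset.ssubset_iff_of_subset ?_ |>.2 ⟨(i, j), ?_, ?_⟩)
  · intro p hp
    rw [Finset.mem_filter] at hp ⊢
    exact ⟨hp.1, fun e => hp.2 (h _ _ e)⟩
  · simpa using ⟨⟨hi, hj⟩, h1⟩
  · simp [h2]

/-- The table with one entry replaced. -/
def Table.put (E : Table) (i j : ℕ) (o : Option (Equiv.Perm ℕ)) : Table :=
  fun i' j' => if i' = i ∧ j' = j then o else E i' j'

theorem ent_put_some {n : ℕ} {E : Table} {i j : ℕ} (s : Equiv.Perm ℕ) (hi : i ∈ Set.Icc 1 n)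
    (hj : j ∈ Set.Icc 1 n) (h : E i j = none) :
    (ent n (E.put i j (some s))).card = (ent n E).card + 1 := by
  have : ent n (E.put i j (some s)) = insert (i, j) (ent n E) := by
    ext p
    rw [Finset.mem_insert, mem_ent, mem_ent]
    by_cases hp : p = (i, j)
    · subst hp; simpa [Table.put] using ⟨hi, hj⟩
    · have : ¬ (p.1 = i ∧ p.2 = j) := fun h => hp (Prod.ext h.1 h.2)
      simp [Table.put, this, hp]
  rw [this, Finset.card_insert_of_notMem]
  rw [mem_ent]; simp [h]

theorem ent_put_none {n : ℕ} {E : Table} {i j : ℕ} {s : Equiv.Perm ℕ} (hi : i ∈ Set.Icc 1 n)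
    (hj : j ∈ Set.Icc 1 n) (h : E i j = some s) :
    (ent n (E.put i j none)).card + 1 = (ent n E).card := by
  have : ent n (E.put i j none) = (ent n E).erase (i, j) := by
    ext p
    rw [Finset.mem_erase, mem_ent, mem_ent]
    by_cases hp : p = (i, j)
    · subst hp; simp [Table.put]
    · have : ¬ (p.1 = i ∧ p.2 = j) := fun h => hp (Prod.ext h.1 h.2)
      simp [Table.put, this, hp]
  rw [this, Finset.card_erase_add_one]
  rw [mem_ent]; exact ⟨⟨hi, hj⟩, by simp [h]⟩

/-! ## Merging of classes -/

/-- The labels after the class with representative `b` has been merged into another one. -/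
def Labels.merge (P : Labels) (k₀ b : ℕ) (q : Equiv.Perm ℕ) : Labels :=
  fun k v => if k = k₀ ∧ P.root k v = b then q * P k v else P k v

theorem Labels.merge_root (P : Labels) (k₀ b : ℕ) (q : Equiv.Perm ℕ) (k v : ℕ) :
    (P.merge k₀ b q).root k v = if k = k₀ ∧ P.root k v = b then q b else P.root k v := by
  unfold Labels.merge
  by_cases h : k = k₀ ∧ P.root k v = b
  · obtain ⟨rfl, rfl⟩ := h
    simp [Labels.root]
  · simp only [Labels.root] at h ⊢
    simp [h]

theorem Labels.merge_of_ne (P : Labels) {k₀ k : ℕ} (b : ℕ) (q : Equiv.Perm ℕ) (h : k ≠ k₀) :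
    P.merge k₀ b q k = P k := by
  funext v; simp [Labels.merge, h]

theorem Compat.merge {n k : ℕ} {P : Labels} {s : Equiv.Perm ℕ} (h : Compat n P k s) (k₀ b : ℕ)
    (q : Equiv.Perm ℕ) : Compat n (P.merge k₀ b q) k s := fun x hx => by
  rw [Labels.merge_root, Labels.merge_root, h x hx]

/-- The representative b disappears on level k₀, and its replacement `q b` is the representative of
x, so no new one arises. Other levels do not change. -/
theorem imc_merge_lt {n : ℕ} {P : Labels} {k₀ b x y : ℕ} {q : Equiv.Perm ℕ}
    (hk : k₀ ∈ Set.Icc 1 n) (hx : x ∈ Set.Icc 1 n) (hy : y ∈ Set.Icc 1 n) (hb : P.root k₀ y = b)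
    (hq : q b = P.root k₀ x) (hne : P.root k₀ x ≠ b) :
    imc n (P.merge k₀ b q) < imc n P := by
  refine Finset.sum_lt_sum (fun k _ => ?_) ⟨k₀, by simpa using hk, ?_⟩
  · by_cases h : k = k₀
    · subst h
      refine Finset.card_le_card fun c hc => ?_
      obtain ⟨v, hv, rfl⟩ := Finset.mem_image.1 hc
      rw [Labels.merge_root]
      split_ifs
      · rw [hq]; exact Finset.mem_image_of_mem _ (by simpa using hx)
      · exact Finset.mem_image_of_mem _ hv
    · unfold Labels.root
      rw [Labels.merge_of_ne _ _ _ h]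
  · refine Finset.card_lt_card (Finset.ssubset_iff_of_subset ?_ |>.2 ⟨b, ?_, ?_⟩)
    · intro c hc
      obtain ⟨v, hv, rfl⟩ := Finset.mem_image.1 hc
      rw [Labels.merge_root]
      split_ifs
      · rw [hq]; exact Finset.mem_image_of_mem _ (by simpa using hx)
      · exact Finset.mem_image_of_mem _ hv
    · exact Finset.mem_image.2 ⟨y, by simpa using hy, hb⟩
    · intro hc
      obtain ⟨v, hv, hv'⟩ := Finset.mem_image.1 hc
      rw [Labels.merge_root] at hv'
      split_ifs at hv' with h
      · exact hne (hq ▸ hv')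
      · exact h ⟨rfl, hv'⟩

/-! ## Making labels compatible with a new entry -/

/-- The state of the labels `P₁` while the labels `P` are made compatible with `z`: the levels
before `k₀` and, on the level `k₀`, the points before `x₀` have been treated. -/
structure Absorb (n : ℕ) (E : Table) (P : Labels) (i : ℕ) (z : Equiv.Perm ℕ) (k₀ x₀ : ℕ)
    (P₁ : Labels) : Prop where
  diag : ∀ k ∈ Set.Icc 1 n, P₁ k k = 1
  compat : ∀ k ∈ Set.Icc 1 n, ∀ i j s, E i j = some s → s ∈ perms k → Compat n P₁ k s
  lab : ∀ k ∈ Set.Icc 1 n, ∀ v ∈ Set.Icc 1 n, P₁ k v ∈ genWith E z k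
  low : ∀ k, k < i → P₁ k = P k
  same : ∀ k, Compat n P k z → P₁ k = P k
  before : ∀ k ∈ Set.Icc 1 n, i ≤ k → k < k₀ → Compat n P₁ k z
  cur : ∀ x ∈ Set.Icc 1 n, x < x₀ → P₁.root k₀ (z x) = P₁.root k₀ x ∨ P₁.root k₀ (z x) = k₀
  coarse : ∀ k v, P.root k v = k → P₁.root k v = k

/-- The class of k₀ must keep its representative, so it is never merged into another one, and a
point x with z x in this class is skipped. No harm results: after all points have been treated, z
maps the class of k₀ into itself, hence onto itself by finiteness, so a skipped x was in this class,
too. -/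
theorem Absorb.next_level {n : ℕ} {E : Table} {P : Labels} {i : ℕ} {z : Equiv.Perm ℕ}
    {k₀ : ℕ} {P₁ : Labels} (hz : z ∈ perms n) (h : Absorb n E P i z k₀ (n + 1) P₁) :
    Absorb n E P i z (k₀ + 1) 1 P₁ := by
  refine { h with before := fun k hk hik hlt => ?_, cur := fun x hx hlt => absurd hx.1 (by omega) }
  by_cases hk₀ : k < k₀
  · exact h.before k hk hik hk₀
  obtain rfl : k = k₀ := by omega
  have hcur : ∀ x ∈ Set.Icc 1 n, P₁.root k (z x) = P₁.root k x ∨ P₁.root k (z x) = k :=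
    fun x hx => h.cur x hx (by have := hx.2; omega)
  let A := (Finset.Icc 1 n).filter fun x => P₁.root k x = k
  let B := (Finset.Icc 1 n).filter fun x => P₁.root k (z x) = k
  have hAB : A = B := by
    refine Finset.eq_of_subset_of_card_le (fun x hx => ?_) ?_
    · rw [Finset.mem_filter] at hx ⊢
      rcases hcur x (by simpa using hx.1) with h | h
      · exact ⟨hx.1, h.trans hx.2⟩
      · exact ⟨hx.1, h⟩
    · refine Finset.card_le_card_of_injOn z (fun x hx => ?_) z.injective.injOn
      rw [Finset.mem_coe, Finset.mem_filter] at hx ⊢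
      have := perms_apply_mem hz le_rfl (by simpa using hx.1 : x ∈ Set.Icc 1 n)
      -- The injection z maps B into A; with A ⊆ B this forces A = B.
      exact ⟨by simpa using this, hx.2⟩
  intro x hx
  rcases hcur x hx with h | h
  · exact h
  · have : x ∈ A := hAB ▸ Finset.mem_filter.2 ⟨by simpa using hx, h⟩
    rw [h, (Finset.mem_filter.1 this).2]

theorem Absorb.skip {n : ℕ} {E : Table} {P : Labels} {i : ℕ} {z : Equiv.Perm ℕ}
    {k₀ x₀ : ℕ} {P₁ : Labels} (h : Absorb n E P i z k₀ x₀ P₁)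
    (hx : P₁.root k₀ (z x₀) = k₀ ∨ P₁.root k₀ x₀ = P₁.root k₀ (z x₀)) :
    Absorb n E P i z k₀ (x₀ + 1) P₁ := by
  refine { h with cur := fun x hx' hlt => ?_ }
  by_cases hlt' : x < x₀
  · exact h.cur x hx' hlt'
  · obtain rfl : x = x₀ := by omega
    rcases hx with h | h
    · exact .inr h
    · exact .inl h.symm

/-- The perm that takes the representative of the class of `z x` to that of `x`. -/
def Labels.link (P : Labels) (k : ℕ) (z : Equiv.Perm ℕ) (x : ℕ) : Equiv.Perm ℕ :=
  P k x * (P k (z x) * z)⁻¹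

theorem Labels.link_apply (P : Labels) (k : ℕ) (z : Equiv.Perm ℕ) (x : ℕ) :
    P.link k z x (P.root k (z x)) = P.root k x := by
  simp [Labels.link, Labels.root]

/-- The linking permutation is a product of labels, z and inverses, so the new labels stay in the
generated group. The new representative of a point is a function of the old one, so compatibilities
obtained earlier survive. -/
theorem Absorb.merge {n : ℕ} {E : Table} {P : Labels} {i : ℕ} {z : Equiv.Perm ℕ}
    {k₀ x₀ : ℕ} {P₁ : Labels} (h : Absorb n E P i z k₀ x₀ P₁) (hz : z ∈ perms i)
    (hik : i ≤ k₀) (hk : k₀ ∈ Set.Icc 1 n) (hx₀ : x₀ ∈ Set.Icc 1 n)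
    (h1 : P₁.root k₀ (z x₀) ≠ k₀) (h2 : P₁.root k₀ x₀ ≠ P₁.root k₀ (z x₀)) :
    Absorb n E P i z k₀ (x₀ + 1) (P₁.merge k₀ (P₁.root k₀ (z x₀)) (P₁.link k₀ z x₀)) ∧
    imc n (P₁.merge k₀ (P₁.root k₀ (z x₀)) (P₁.link k₀ z x₀)) < imc n P₁ := by
  have hzk : z ∈ perms k₀ := perms_mono hik hz
  have hzx : z x₀ ∈ Set.Icc 1 n := perms_apply_mem hzk hk.2 hx₀
  have hq : P₁.link k₀ z x₀ ∈ genWith E z k₀ :=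
    mul_mem (h.lab k₀ hk x₀ hx₀)
      (inv_mem (mul_mem (h.lab k₀ hk _ hzx) (self_mem_genWith E hzk)))
  have hroot := fun k v => Labels.merge_root P₁ k₀ (P₁.root k₀ (z x₀)) (P₁.link k₀ z x₀) k v
  rw [Labels.link_apply] at hroot
  refine ⟨⟨?_, ?_, ?_, ?_, ?_, ?_, ?_, ?_⟩,
    imc_merge_lt hk hx₀ hzx rfl (Labels.link_apply _ _ _ _) h2⟩
  · intro k hk'
    unfold Labels.merge
    rw [if_neg, h.diag k hk']
    rintro ⟨rfl, e⟩
    exact h1 (by rw [← e]; simp [Labels.root, h.diag k hk'])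
  · exact fun k hk' i j s hij hs => (h.compat k hk' i j s hij hs).merge _ _ _
  · intro k hk' v hv
    unfold Labels.merge
    split_ifs with hc
    · rw [hc.1]; exact mul_mem hq (h.lab k₀ hk v hv)
    · exact h.lab k hk' v hv
  · intro k hki
    rw [Labels.merge_of_ne _ _ _ (by omega), h.low k hki]
  · intro k hc
    by_cases hkk : k = k₀
    -- If z was compatible with this level from the start, its labels are still the original ones,
    -- so x₀ and z x₀ are in one class and no merge takes place.
    · subst hkk
      refine absurd ?_ h2
      have := hc x₀ hx₀
      unfold Labels.root at this ⊢
      rw [h.same k hc, this]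
    · rw [Labels.merge_of_ne _ _ _ hkk, h.same k hc]
  · exact fun k hk' hik' hlt => (h.before k hk' hik' hlt).merge _ _ _
  · intro x hx hlt
    rw [hroot, hroot]
    by_cases hlt' : x < x₀
    · rcases h.cur x hx hlt' with e | e
      · left; rw [e]
      · right; rw [e, if_neg fun e' => h1 e'.2.symm]
    · obtain rfl : x = x₀ := by omega
      left; simp
  · intro k v e
    rw [hroot, if_neg, h.coarse k v e]
    rintro ⟨rfl, e'⟩
    exact h1 (by rw [← e', h.coarse _ _ e])

/-! ## Sifting -/

/-- The state `E`, `P`, `z` of an insertion that started with `E₀`, `P₀`, `z₀` on level `i₀` and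
has arrived at level `i`. -/
structure Sift (n : ℕ) (G : Subgroup (Equiv.Perm ℕ)) (E₀ : Table) (P₀ : Labels)
    (z₀ : Equiv.Perm ℕ) (i₀ i : ℕ) (E : Table) (P : Labels) (z : Equiv.Perm ℕ) : Prop
    extends Core n E P where
  z_mem : z ∈ perms i
  lab : ∀ k ∈ Set.Icc 1 n, ∀ v ∈ Set.Icc 1 n, P k v ∈ genWith E z k
  lab_low : ∀ k ∈ Set.Icc 1 n, k ≤ i → ∀ v ∈ Set.Icc 1 n, P k v ∈ gen E k
  inc : ∀ i j s, E₀ i j = some s → E i j = some s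
  start_mem : z₀ ∈ genWith E z i₀
  inG : ∀ i j s, E i j = some s → s ∈ G
  z_inG : z ∈ G
  same : ∀ k ∈ Set.Icc 1 n, i₀ ≤ k → Compat n P₀ k z₀ → P k = P₀ k ∧ Compat n P k z

/-- The label takes z (i+1) back to i+1, so the product fixes i+1. As the label is generated by
entries in Π(i+1), on all levels above i the old and the new z generate the same group together with
the entries. -/
theorem Sift.step {n : ℕ} {G : Subgroup (Equiv.Perm ℕ)} {E₀ : Table} {P₀ : Labels}
    {z₀ : Equiv.Perm ℕ} {i₀ i : ℕ} {E : Table} {P : Labels} {z : Equiv.Perm ℕ}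
    (h : Sift n G E₀ P₀ z₀ i₀ (i + 1) E P z) (hi : i + 1 ≤ i₀) (hi₀ : i₀ ≤ n)
    (hr : P.root (i + 1) (z (i + 1)) = i + 1) :
    Sift n G E₀ P₀ z₀ i₀ i E P (P (i + 1) (z (i + 1)) * z) := by
  have hin : i + 1 ∈ Set.Icc 1 n := ⟨by omega, by omega⟩
  have hzn := perms_apply_mem h.z_mem hin.2 hin
  have hP : P (i + 1) (z (i + 1)) ∈ gen E (i + 1) := h.lab_low _ hin le_rfl _ hzn
  have hPk : ∀ k, i + 1 ≤ k → P (i + 1) (z (i + 1)) ∈ gen E k :=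
    fun k hk => gen_mono hk (fun _ _ _ h => h) hP
  have hz' : P (i + 1) (z (i + 1)) * z ∈ perms (i + 1) :=
    (permsSub (i + 1)).mul_mem (gen_le_permsSub _ _ hP) h.z_mem
  have hle : ∀ k, i + 1 ≤ k → genWith E z k ≤ genWith E (P (i + 1) (z (i + 1)) * z) k := by
    intro k hk
    refine (Subgroup.closure_le _).2 ?_
    rintro s ⟨hs, rfl | hs'⟩
    · have h1 := inv_mem (gen_le_genWith E (P (i + 1) (s (i + 1)) * s) k (hPk k hk))
      have := mul_mem h1 (self_mem_genWith E (perms_mono hk hz'))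
      simpa using this
    · exact Subgroup.subset_closure ⟨hs, .inr hs'⟩
  refine { h.toCore with
    z_mem := mem_perms_pred hz' hr, lab := fun k hk v hv => ?_,
    lab_low := fun k hk hki => h.lab_low k hk (by omega), inc := h.inc,
    start_mem := hle i₀ hi h.start_mem, inG := h.inG,
    z_inG := mul_mem (gen_le_of_forall h.inG _ hP) h.z_inG, same := fun k hk hik hc => ?_ }
  -- The new z may be in Π(k) or not on low levels; there the labels do not need it.
  · by_cases hki : k ≤ i
    · exact gen_le_genWith _ _ _ (h.lab_low k hk (by omega) v hv)
    · exact hle k (by omega) (h.lab k hk v hv)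
  · obtain ⟨h1, h2⟩ := h.same k hk hik hc
    exact ⟨h1, (h.compat_of_mem hk (hPk k (by omega))).mul h2 (perms_mono hin.2 h.z_mem)⟩

theorem Sift.absorb_start {n : ℕ} {G : Subgroup (Equiv.Perm ℕ)} {E₀ : Table} {P₀ : Labels}
    {z₀ : Equiv.Perm ℕ} {i₀ i : ℕ} {E : Table} {P : Labels} {z : Equiv.Perm ℕ}
    (h : Sift n G E₀ P₀ z₀ i₀ i E P z) : Absorb n E P i z i 1 P where
  diag := h.diag
  compat := h.compat
  lab := h.lab
  low _ _ := rfl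
  same _ _ := rfl
  before k hk hik hlt := absurd hlt (by omega)
  cur x hx hlt := absurd hx.1 (by omega)
  coarse _ _ h := h

theorem genWith_le_gen_put {E : Table} {i : ℕ}
    {z : Equiv.Perm ℕ} (h : E i (z i) = none) (k : ℕ) :
    genWith E z k ≤ gen (E.put i (z i) (some z)) k := by
  refine Subgroup.closure_mono ?_
  rintro s ⟨hs, rfl | ⟨a, b, hab⟩⟩
  · exact ⟨hs, i, s i, by simp [Table.put]⟩
  · refine ⟨hs, a, b, ?_⟩
    unfold Table.put
    rw [if_neg, hab]
    rintro ⟨rfl, rfl⟩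
    simp [h] at hab

/-- An entry in this place would take i to z i and preserve the classes, so z i would already be in
the orbit of i. Thus storing never overwrites a generator. -/
theorem Sift.entry_none {n : ℕ} {G : Subgroup (Equiv.Perm ℕ)} {E₀ : Table} {P₀ : Labels}
    {z₀ : Equiv.Perm ℕ} {i₀ i : ℕ} {E : Table} {P : Labels} {z : Equiv.Perm ℕ}
    (h : Sift n G E₀ P₀ z₀ i₀ i E P z) (hi : i ∈ Set.Icc 1 n)
    (hr : P.root i (z i) ≠ i) : E i (z i) = none := by
  by_contra hne
  obtain ⟨s, hs⟩ := Option.ne_none_iff_exists'.1 hne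
  obtain ⟨_, _, _, hsi, hsj⟩ := h.wf i (z i) s hs
  have := h.compat i hi i (z i) s hs hsi i hi
  rw [hsj, h.root_diag hi] at this
  exact hr this

/-- Once z is an entry, the labels that use z lie in the group of the entries. The permutation z
nevertheless stays in hand: z i has joined the orbit of i, so sifting continues as in the other
case. -/
theorem Sift.store {n : ℕ} {G : Subgroup (Equiv.Perm ℕ)} {E₀ : Table} {P₀ : Labels}
    {z₀ : Equiv.Perm ℕ} {i₀ i : ℕ} {E : Table} {P : Labels} {z : Equiv.Perm ℕ}
    (h : Sift n G E₀ P₀ z₀ i₀ i E P z) (hi : i ∈ Set.Icc 1 n) (hi₀ : i ≤ i₀)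
    (hr : P.root i (z i) ≠ i) {P₁ : Labels} (ha : Absorb n E P i z (n + 1) 1 P₁) :
    Sift n G E₀ P₀ z₀ i₀ i (E.put i (z i) (some z)) P₁ z ∧ P₁.root i (z i) = i := by
  have hnone := h.entry_none hi hr
  have hput : ∀ a b s, (E.put i (z i) (some z)) a b = some s →
      E a b = some s ∨ (a = i ∧ b = z i ∧ s = z) := by
    intro a b s hs
    unfold Table.put at hs
    split_ifs at hs with hc
    · exact .inr ⟨hc.1, hc.2, by simpa using hs.symm⟩
    · exact .inl hs
  have hinc : ∀ a b s, E a b = some s → (E.put i (z i) (some z)) a b = some s := by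
    intro a b s hs
    unfold Table.put
    rw [if_neg, hs]
    rintro ⟨rfl, rfl⟩
    simp [hnone] at hs
  have hzi : z i ∈ Set.Icc 1 i := perms_apply_mem h.z_mem le_rfl ⟨hi.1, le_rfl⟩
  have hzne : z i ≠ i := fun e => hr (by rw [e, h.root_diag hi])
  have hmono := fun k => genWith_le_gen_put hnone k
  have hcore : Core n (E.put i (z i) (some z)) P₁ := by
    refine ⟨fun a b s hs => ?_, ha.diag, fun k hk a b s hs hsk => ?_⟩
    · rcases hput a b s hs with hs | ⟨rfl, rfl, rfl⟩
      · exact h.wf a b s hs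
      · exact ⟨hzi.1, lt_of_le_of_ne hzi.2 hzne, hi.2, h.z_mem, rfl⟩
    · rcases hput a b s hs with hs | ⟨rfl, rfl, rfl⟩
      · exact ha.compat k hk a b s hs hsk
      -- Since z moves i, it can be in Π(k) only if i ≤ k, and these are the levels that have been
      -- treated.
      · refine ha.before k hk ?_ (by have := hk.2; omega)
        by_contra hlt
        exact hzne (hsk a fun h' => by have := h'.2; omega)
  refine ⟨{ hcore with
    z_mem := h.z_mem, lab := fun k hk v hv => gen_le_genWith _ _ _ (hmono k (ha.lab k hk v hv)),
    lab_low := fun k hk _ v hv => hmono k (ha.lab k hk v hv),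
    inc := fun a b s hs => hinc a b s (h.inc a b s hs),
    start_mem := gen_le_genWith _ _ _ (hmono _ h.start_mem), inG := fun a b s hs => ?_,
    z_inG := h.z_inG, same := fun k hk hik hc => ?_ }, ?_⟩
  · rcases hput a b s hs with hs | ⟨rfl, rfl, rfl⟩
    · exact h.inG a b s hs
    · exact h.z_inG
  · obtain ⟨h1, h2⟩ := h.same k hk hik hc
    have := ha.same k h2
    exact ⟨this.trans h1, fun x hx => by
      have h3 := h2 x hx
      unfold Labels.root at h3 ⊢
      rw [this]; exact h3⟩
  · have := ha.before i hi le_rfl (by have := hi.2; omega) i hi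
    rw [this, hcore.root_diag hi]

/-- The state after an insertion. -/
structure Inserted (n : ℕ) (G : Subgroup (Equiv.Perm ℕ)) (E₀ : Table) (P₀ : Labels)
    (z₀ : Equiv.Perm ℕ) (i₀ : ℕ) (E : Table) (P : Labels) : Prop
    extends Inv n G E P where
  inc : ∀ i j s, E₀ i j = some s → E i j = some s
  start_mem : z₀ ∈ gen E i₀
  same : ∀ k ∈ Set.Icc 1 n, i₀ ≤ k → Compat n P₀ k z₀ → P k = P₀ k

theorem Sift.inserted {n : ℕ} {G : Subgroup (Equiv.Perm ℕ)} {E₀ : Table} {P₀ : Labels}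
    {z₀ : Equiv.Perm ℕ} {i₀ : ℕ} {E : Table} {P : Labels} {z : Equiv.Perm ℕ}
    (h : Sift n G E₀ P₀ z₀ i₀ 0 E P z) : Inserted n G E₀ P₀ z₀ i₀ E P := by
  have hz := eq_one_of_mem_perms_zero h.z_mem
  subst hz
  exact { h.toCore with
    lab := fun k hk v hv => genWith_one E k ▸ h.lab k hk v hv
    inG := h.inG
    inc := h.inc
    start_mem := genWith_one E i₀ ▸ h.start_mem
    same := fun k hk hik hc => (h.same k hk hik hc).1 }

theorem Inv.sift {n : ℕ} {G : Subgroup (Equiv.Perm ℕ)} {E : Table} {P : Labels}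
    (h : Inv n G E P) {z : Equiv.Perm ℕ} {i : ℕ} (hz : z ∈ perms i) (hG : z ∈ G) :
    Sift n G E P z i i E P z :=
  { h.toCore with
    z_mem := hz
    lab := fun k hk v hv => gen_le_genWith _ _ _ (h.lab k hk v hv)
    lab_low := fun k hk _ => h.lab k hk
    inc := fun _ _ _ h => h
    start_mem := self_mem_genWith E hz
    inG := h.inG
    z_inG := hG
    same := fun _ _ _ hc => ⟨rfl, hc⟩ }

/-! ## Removal of redundant entries -/

/-- The perm that replaces `f'` if `f` and `f'` take `i + 1` to points in the same class of
level `i`. -/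
def Labels.diff (P : Labels) (i j j' : ℕ) (f f' : Equiv.Perm ℕ) : Equiv.Perm ℕ :=
  (P i j * f)⁻¹ * (P i j' * f')

/-- After multiplication by labels of level i, both f and f' take i+1 to the same point, so their
quotient is in Π(i). From the quotient, f and the labels, f' can be recovered. The second part is
stated for every later table E' because the quotient is in general not itself stored, but only
generated after its insertion. -/
theorem Inv.remove {n : ℕ} {G : Subgroup (Equiv.Perm ℕ)} {E : Table} {P : Labels}
    (h : Inv n G E P) {i j j' : ℕ} {f f' : Equiv.Perm ℕ} (hi : 1 ≤ i) (hf : E (i + 1) j = some f)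
    (hf' : E (i + 1) j' = some f') (hne : j ≠ j') (hr : P.root i j = P.root i j') :
    Sift n G (E.put (i + 1) j' none) P (P.diff i j j' f f') i i (E.put (i + 1) j' none) P
        (P.diff i j j' f f') ∧
      ∀ E', (∀ a b s, (E.put (i + 1) j' none) a b = some s → E' a b = some s) →
        P.diff i j j' f f' ∈ gen E' i → ∀ k, gen E k ≤ gen E' k := by
  obtain ⟨hj1, hj2, hin, hfi, hfj⟩ := h.wf _ _ _ hf
  obtain ⟨hj1', hj2', -, hfi', hfj'⟩ := h.wf _ _ _ hf'
  have hiI : i ∈ Set.Icc 1 n := ⟨hi, by omega⟩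
  have hput : ∀ a b s, (E.put (i + 1) j' none) a b = some s → E a b = some s := by
    intro a b s hs
    unfold Table.put at hs
    split_ifs at hs
    exact hs
  have hput' : ∀ a b s, E a b = some s → (E.put (i + 1) j' none) a b = some s ∨ s = f' := by
    intro a b s hs
    unfold Table.put
    split_ifs with hc
    · rw [hc.1, hc.2, hf'] at hs
      exact .inr (by simpa using hs.symm)
    · exact .inl hs
  -- Since f' moves i+1, removing it does not affect the groups of the levels up to i, which contain
  -- the labels used for the recovery.
  have hf'i : ∀ k, f' ∈ perms k → i + 1 ≤ k := by
    intro k hk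
    by_contra hlt
    have := hk (i + 1) fun h' => hlt h'.2
    omega
  have hflow : (E.put (i + 1) j' none) (i + 1) j = some f := by
    simp [Table.put, hne, hf]
  have hlow : ∀ k ≤ i, gen E k ≤ gen (E.put (i + 1) j' none) k := by
    intro k hk
    refine Subgroup.closure_mono ?_
    rintro s ⟨hs, a, b, hab⟩
    rcases hput' a b s hab with hab | rfl
    · exact ⟨hs, a, b, hab⟩
    · have := hf'i k hs; omega
  have hPj := h.lab i hiI j ⟨hj1, by omega⟩
  have hPj' := h.lab i hiI j' ⟨hj1', by omega⟩
  have hup := perms_mono (Nat.le_succ i)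
  have hz1 : P.diff i j j' f f' ∈ perms (i + 1) :=
    (permsSub (i + 1)).mul_mem ((permsSub (i + 1)).inv_mem ((permsSub (i + 1)).mul_mem
      (hup (gen_le_permsSub _ _ hPj)) hfi))
      ((permsSub (i + 1)).mul_mem (hup (gen_le_permsSub _ _ hPj')) hfi')
  have hz : P.diff i j j' f f' ∈ perms i := by
    refine mem_perms_pred hz1 ?_
    unfold Labels.root at hr
    rw [Labels.diff, Equiv.Perm.mul_apply, Equiv.Perm.inv_eq_iff_eq, Equiv.Perm.mul_apply,
      Equiv.Perm.mul_apply, hfj, hfj', hr]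
  have hrec : f' = (P i j')⁻¹ * (P i j * f * P.diff i j j' f f') := by
    simp [Labels.diff, mul_assoc]
  have hrecov : ∀ E', (∀ a b s, (E.put (i + 1) j' none) a b = some s → E' a b = some s) →
      ∀ (K : Subgroup (Equiv.Perm ℕ)) k, i + 1 ≤ k → gen E' k ≤ K →
      P.diff i j j' f f' ∈ K → gen E k ≤ K := by
    intro E' hE' K k hk hK hd
    have hPK : ∀ g ∈ gen E i, g ∈ K := fun g hg =>
      hK (gen_mono (by omega) hE' (hlow i le_rfl hg))
    refine (Subgroup.closure_le _).2 ?_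
    rintro s ⟨hs, a, b, hab⟩
    rcases hput' a b s hab with hab | rfl
    · exact hK (mem_gen (hE' _ _ _ hab) hs)
    · have h1 : f ∈ K := hK (mem_gen (hE' _ _ _ hflow) (perms_mono hk hfi))
      have := mul_mem (inv_mem (hPK _ hPj')) (mul_mem (mul_mem (hPK _ hPj) h1) hd)
      rw [← hrec] at this
      exact this
  refine ⟨?_, ?_⟩
  · exact
    { wf := fun a b s hs => h.wf a b s (hput a b s hs)
      diag := h.diag
      compat := fun k hk a b s hs => h.compat k hk a b s (hput a b s hs)
      z_mem := hz
      -- Labels above level i may depend on f'. Until the quotient has been inserted, they are only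
      -- known to be generated with its help.
      lab := fun k hk v hv => by
        by_cases hki : k ≤ i
        · exact gen_le_genWith _ _ _ (hlow k hki (h.lab k hk v hv))
        · exact hrecov _ (fun _ _ _ h => h) _ k (by omega) (gen_le_genWith _ _ _)
            (self_mem_genWith _ (perms_mono (by omega) hz)) (h.lab k hk v hv)
      lab_low := fun k hk hki v hv => hlow k hki (h.lab k hk v hv)
      inc := fun _ _ _ h => h
      start_mem := self_mem_genWith _ hz
      inG := fun a b s hs => h.inG a b s (hput a b s hs)
      z_inG := mul_mem (inv_mem (mul_mem (gen_le_of_forall h.inG _ hPj) (h.inG _ _ _ hf)))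
        (mul_mem (gen_le_of_forall h.inG _ hPj') (h.inG _ _ _ hf'))
      same := fun _ _ _ hc => ⟨rfl, hc⟩ }
  · intro E' hE' hd k
    by_cases hki : k ≤ i
    · exact (hlow k hki).trans (gen_mono le_rfl hE')
    · exact hrecov E' hE' _ k (by omega) le_rfl (gen_mono (by omega) (fun _ _ _ h => h) hd)

/-! ### At most n entries in an irredundant table -/

/-- The entries of each row take their points to different classes of the level below. -/
def Irredundant (n : ℕ) (E : Table) (P : Labels) : Prop :=
  ∀ i, 1 ≤ i → i + 1 ≤ n → ∀ j ∈ Set.Icc 1 n, ∀ j' ∈ Set.Icc 1 n, (E (i + 1) j).isSome →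
    (E (i + 1) j').isSome → P.root i j = P.root i j' → j = j'

/-- A label of level k is in the group of every higher level, whose classes it therefore preserves.
-/
theorem Inv.root_root {n : ℕ} {G : Subgroup (Equiv.Perm ℕ)} {E : Table} {P : Labels}
    (h : Inv n G E P) {k k' v : ℕ} (hk : 1 ≤ k) (hk' : k' ∈ Set.Icc 1 n) (hkk : k ≤ k')
    (hv : v ∈ Set.Icc 1 n) : P.root k' (P.root k v) = P.root k' v :=
  h.compat_of_mem hk' (gen_mono hkk (fun _ _ _ h => h)
    (h.lab k ⟨hk, hkk.trans hk'.2⟩ v hv)) v hv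

/-- From level i to level i+1, each entry of row i+1 joins a class to that of i+1. By irredundancy
these classes are distinct, and none of them is the class of i+1, so at least as many classes vanish
as the row has entries. -/
theorem Inv.row_card {n : ℕ} {G : Subgroup (Equiv.Perm ℕ)} {E : Table} {P : Labels}
    (h : Inv n G E P) (hi : Irredundant n E P) {i : ℕ} (h1 : 1 ≤ i) (h2 : i + 1 ≤ n) :
    ((Finset.Icc 1 n).image (P.root (i + 1))).card +
      ((Finset.Icc 1 n).filter fun j => (E (i + 1) j).isSome).card ≤
      ((Finset.Icc 1 n).image (P.root i)).card := by
  set A := (Finset.Icc 1 n).image (P.root i)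
  set J := (Finset.Icc 1 n).filter fun j => (E (i + 1) j).isSome
  have hiI : i ∈ Set.Icc 1 n := ⟨h1, by omega⟩
  have hiI' : i + 1 ∈ Set.Icc 1 n := ⟨by omega, h2⟩
  have hJA : J.image (P.root i) ⊆ A := Finset.image_subset_image (Finset.filter_subset _ _)
  have hcard : (J.image (P.root i)).card = J.card := by
    refine Finset.card_image_of_injOn fun j hj j' hj' e => ?_
    rw [Finset.mem_coe, Finset.mem_filter] at hj hj'
    exact hi i h1 h2 j (by simpa using hj.1) j' (by simpa using hj'.1) hj.2 hj'.2 e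
  -- Every class of level i+1 contains a class of level i into which no entry of the row leads. For
  -- the orbit of i+1 this is the class of i+1 on level i: Π(i) fixes i+1, and the row leads to
  -- points up to i.
  have hsub : (Finset.Icc 1 n).image (P.root (i + 1)) ⊆
      (A \ J.image (P.root i)).image (P.root (i + 1)) := by
    intro c hc
    obtain ⟨v, hv, rfl⟩ := Finset.mem_image.1 hc
    have hvI : v ∈ Set.Icc 1 n := by simpa using hv
    by_cases hmem : P.root i v ∈ J.image (P.root i)
    · obtain ⟨j, hj, hje⟩ := Finset.mem_image.1 hmem
      rw [Finset.mem_filter] at hj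
      obtain ⟨s, hs⟩ := Option.isSome_iff_exists.1 hj.2
      obtain ⟨-, -, -, hs1, hs2⟩ := h.wf _ _ _ hs
      have e1 : P.root (i + 1) j = i + 1 := by
        rw [← hs2, h.compat _ hiI' _ _ _ hs hs1 _ hiI', h.root_diag hiI']
      have e2 : P.root (i + 1) v = i + 1 := by
        rw [← h.root_root h1 hiI' (by omega) hvI, ← hje,
          h.root_root h1 hiI' (by omega) (by simpa using hj.1), e1]
      have e3 : P.root i (i + 1) = i + 1 :=
        gen_le_permsSub E i (h.lab i hiI _ hiI') (i + 1) (by simp)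
      refine Finset.mem_image.2 ⟨i + 1, Finset.mem_sdiff.2 ⟨Finset.mem_image.2
        ⟨i + 1, by simpa using hiI', e3⟩, ?_⟩, by rw [e2, h.root_diag hiI']⟩
      intro hc
      obtain ⟨j', hj', hje'⟩ := Finset.mem_image.1 hc
      rw [Finset.mem_filter] at hj'
      obtain ⟨s', hs'⟩ := Option.isSome_iff_exists.1 hj'.2
      have hlt := (h.wf _ _ _ hs').2.1
      have := (perms_apply_mem (gen_le_permsSub E i (h.lab i hiI j' (by simpa using hj'.1)))
        le_rfl ⟨(h.wf _ _ _ hs').1, by omega⟩).2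
      have : P.root i j' ≤ i := this
      omega
    · exact Finset.mem_image.2 ⟨P.root i v, Finset.mem_sdiff.2
        ⟨Finset.mem_image_of_mem _ hv, hmem⟩, h.root_root h1 hiI' (by omega) hvI⟩
  have := (Finset.card_le_card hsub).trans Finset.card_image_le
  rw [Finset.card_sdiff_of_subset hJA, hcard] at this
  have h3 := Finset.card_le_card hJA
  rw [hcard] at h3
  omega

/-- The inequalities of `Inv.row_card` telescope, starting from at most n classes on level 1, where
the row is empty because entries satisfy j < i. -/
theorem Inv.ent_card {n : ℕ} {G : Subgroup (Equiv.Perm ℕ)} {E : Table} {P : Labels}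
    (h : Inv n G E P) (hi : Irredundant n E P) : (ent n E).card ≤ n := by
  set row := fun i => ((Finset.Icc 1 n).filter fun j => (E i j).isSome).card with hrow
  have h1 : (ent n E).card = ∑ i ∈ Finset.Icc 1 n, row i := by
    unfold ent
    rw [Finset.card_filter, Finset.sum_product]
    exact Finset.sum_congr rfl fun i _ => (Finset.card_filter _ _).symm
  have key : ∀ m, 1 ≤ m → m ≤ n → (∑ i ∈ Finset.Icc 1 m, row i) +
      ((Finset.Icc 1 n).image (P.root m)).card ≤ n := by
    intro m hm
    induction m, hm using Nat.le_induction with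
    | base =>
      intro _
      have e : row 1 = 0 := by
        rw [hrow, Finset.card_eq_zero, Finset.filter_eq_empty_iff]
        intro j _ hs
        obtain ⟨s, hs⟩ := Option.isSome_iff_exists.1 hs
        have := h.wf _ _ _ hs
        omega
      simpa [e] using Finset.card_image_le (s := Finset.Icc 1 n) (f := P.root 1)
    | succ m hm ih =>
      intro hmn
      have h2 := h.row_card hi hm hmn
      have h3 := ih (by omega)
      rw [Finset.sum_Icc_succ_top (by omega)]
      have : row (m + 1) = ((Finset.Icc 1 n).filter fun j => (E (m + 1) j).isSome).card := rfl
      omega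
  rw [h1]
  rcases Nat.eq_zero_or_pos n with rfl | hn
  · simp
  · have := key n hn le_rfl; omega

/-! ## Schreier generators -/

/-- The Schreier generator of `s` and `v`. -/
def Labels.schreier (P : Labels) (k : ℕ) (s : Equiv.Perm ℕ) (v : ℕ) : Equiv.Perm ℕ :=
  P k (s v) * s * (P k v)⁻¹

theorem Inv.schreier_mem {n : ℕ} {G : Subgroup (Equiv.Perm ℕ)} {E : Table} {P : Labels}
    (h : Inv n G E P) {k v : ℕ} {s : Equiv.Perm ℕ} (hk : k + 1 ∈ Set.Icc 1 n)
    (hs : s ∈ gen E (k + 1)) (hv : v ∈ Set.Icc 1 n) (hr : P.root (k + 1) v = k + 1) :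
    P.schreier (k + 1) s v ∈ gen E (k + 1) ∧ P.schreier (k + 1) s v ∈ perms k := by
  have hsv := perms_apply_mem (gen_le_permsSub _ _ hs) hk.2 hv
  have h1 : P.schreier (k + 1) s v ∈ gen E (k + 1) :=
    mul_mem (mul_mem (h.lab _ hk _ hsv) hs) (inv_mem (h.lab _ hk _ hv))
  refine ⟨h1, mem_perms_pred (gen_le_permsSub _ _ h1) ?_⟩
  have h2 : (P (k + 1) v)⁻¹ (k + 1) = v := by
    rw [Equiv.Perm.inv_eq_iff_eq]; exact hr.symm
  have h3 := h.compat_of_mem hk hs v hv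
  rw [hr] at h3
  simp only [Labels.schreier, Equiv.Perm.mul_apply, h2]
  exact h3

/-- If a subgroup contains the Schreier generators of level `k`, it contains the stabilizer of
`k`. -/
theorem Inv.stabilizer_mem {n : ℕ} {G : Subgroup (Equiv.Perm ℕ)} {E E₀ : Table} {P : Labels}
    (h : Inv n G E P) {k : ℕ} (hk : k ∈ Set.Icc 1 n) {K : Subgroup (Equiv.Perm ℕ)}
    (hE : gen E k ≤ gen E₀ k)
    (hK : ∀ i j s, E₀ i j = some s → s ∈ perms k → s ∈ gen E k → ∀ v ∈ Set.Icc 1 n,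
      P.root k v = k → P.schreier k s v ∈ K)
    (hE₀ : gen E₀ k ≤ gen E k)
    {g : Equiv.Perm ℕ} (hg : g ∈ gen E k) (hgk : g k = k) : g ∈ K := by
  -- The cocycle identity: the Schreier generator of s * s' at v is that of s at s' v times that of
  -- s' at v, and similarly for inverses. So the property passes from the entries of `E₀`, which may
  -- be an older table than `E`, to the whole group.
  have key : ∀ g ∈ gen E₀ k, ∀ v ∈ Set.Icc 1 n, P.root k v = k → P.schreier k g v ∈ K := by
    intro g hg
    induction hg using Subgroup.closure_induction with
    | mem s hs =>
      obtain ⟨h1, i, j, hij⟩ := hs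
      exact hK i j s hij h1 (hE₀ (mem_gen hij h1))
    | one => intro v _ _; simp [Labels.schreier]
    | mul s s' hs hs' ih ih' =>
      intro v hv hr
      have hs'k := hE₀ hs'
      have hv' := perms_apply_mem (gen_le_permsSub _ _ hs'k) hk.2 hv
      have := mul_mem (ih (s' v) hv' (by rw [h.compat_of_mem hk hs'k v hv, hr])) (ih' v hv hr)
      convert this using 1
      simp [Labels.schreier, mul_assoc]
    | inv s hs ih =>
      intro v hv hr
      have hsk := inv_mem (hE₀ hs)
      have hv' := perms_apply_mem (gen_le_permsSub _ _ hsk) hk.2 hv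
      have := inv_mem (ih (s⁻¹ v) hv' (by rw [h.compat_of_mem hk hsk v hv, hr]))
      convert this using 1
      simp [Labels.schreier, mul_assoc]
  -- At v = k the label is trivial, and g fixes k, so the Schreier generator is g itself.
  have := key g (hE hg) k hk (h.root_diag hk)
  simpa [Labels.schreier, hgk, h.diag k hk] using this

/-! ## The transversal system -/

/-- The table of inverse labels of the orbits. -/
noncomputable def Labels.table (P : Labels) : Table :=
  fun k j => if P.root k j = k then some (P k j)⁻¹ else none

/-- For g in G ∩ Π(k+1), completeness puts g (k+1) into the orbit of k+1. The label of this point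
times g is in G ∩ Π(k), and the inverse label is the factor from Σ(k+1). -/
theorem Inv.products_eq {n : ℕ} {G : Subgroup (Equiv.Perm ℕ)} {E : Table} {P : Labels}
    (h : Inv n G E P) (hG : ∀ k ∈ Set.Icc 1 n, G ⊓ permsSub k ≤ gen E k) {k : ℕ} (hk : k ≤ n) :
    P.table.products k = (G ⊓ permsSub k : Subgroup (Equiv.Perm ℕ)) := by
  induction k with
  | zero =>
    ext g
    constructor
    · rintro rfl; exact one_mem _
    · rintro ⟨-, hg⟩; exact eq_one_of_mem_perms_zero hg
  | succ k ih =>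
    have hkI : k + 1 ∈ Set.Icc 1 n := ⟨by omega, hk⟩
    have hlab : ∀ j ∈ Set.Icc 1 (k + 1), P (k + 1) j ∈ G ⊓ permsSub (k + 1) := fun j hj =>
      ⟨gen_le_of_forall h.inG _ (h.lab _ hkI j ⟨hj.1, hj.2.trans hk⟩),
        gen_le_permsSub _ _ (h.lab _ hkI j ⟨hj.1, hj.2.trans hk⟩)⟩
    ext g
    constructor
    · rintro ⟨γ, hγ, τ, ⟨j, hj, hτ⟩, rfl⟩
      rw [ih (by omega)] at hγ
      unfold Labels.table at hτ
      split_ifs at hτ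
      simp only [Option.some.injEq] at hτ
      rw [← hτ]
      exact mul_mem (inv_mem (hlab j hj)) ⟨hγ.1, perms_mono (Nat.le_succ k) hγ.2⟩
    · intro hg
      have hj : g (k + 1) ∈ Set.Icc 1 (k + 1) := perms_apply_mem hg.2 le_rfl ⟨by omega, le_rfl⟩
      have hr : P.root (k + 1) (g (k + 1)) = k + 1 := by
        rw [h.compat_of_mem hkI (hG _ hkI hg) _ hkI, h.root_diag hkI]
      have hmem := mul_mem (hlab _ hj) hg
      refine ⟨P (k + 1) (g (k + 1)) * g, ?_, (P (k + 1) (g (k + 1)))⁻¹, ⟨_, hj, ?_⟩, by simp⟩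
      · rw [ih (by omega)]
        exact ⟨hmem.1, mem_perms_pred hmem.2 hr⟩
      · simp [Labels.table, hr]

theorem Inv.isTransversalSystem {n : ℕ} {G : Subgroup (Equiv.Perm ℕ)} {E : Table} {P : Labels}
    (h : Inv n G E P) (hG : ∀ k ∈ Set.Icc 1 n, G ⊓ permsSub k ≤ gen E k) (hGn : G ≤ permsSub n) :
    IsTransversalSystem n P.table G := by
  have hp := fun k hk => h.products_eq hG (k := k) hk
  -- As Γ(k) is a group, it can itself serve as T(k).
  refine ⟨⟨fun k => P.table.products k, ?_⟩, ?_⟩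
  · refine ⟨⟨?_, ?_, ?_, ?_, ?_⟩, ?_, ?_⟩
    · intro k hk j hj π hπ
      unfold Labels.table at hπ
      split_ifs at hπ
      simp only [Option.some.injEq] at hπ
      rw [← hπ]
      exact (permsSub k).inv_mem (gen_le_permsSub _ _ (h.lab k hk j ⟨hj.1, hj.2.trans hk.2⟩))
    · intro k hk j hj π hπ
      unfold Labels.table at hπ
      split_ifs at hπ with hr
      simp only [Option.some.injEq] at hπ
      rw [← hπ, Equiv.Perm.inv_eq_iff_eq]
      exact hr.symm
    · intro k hk
      simp [Labels.table, h.root_diag hk, h.diag k hk]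
    · intro k hk g hg
      rw [hp k hk.2] at hg
      exact hg.2
    · intro k _
      exact Subgroup.subset_closure
    · intro k _
      exact subset_rfl
    · intro k hk α hα β hβ
      rw [hp k hk.2] at hα hβ ⊢
      exact mul_mem hα hβ
  · rw [hp n le_rfl, inf_eq_left.2 hGn]

/-! ## Arrays that hold the data -/

/-- The arrays `0` and `1` hold the labels and the entries; the cell `i` of the row of an empty
entry of level `i` is `0`. -/
structure Rel (n : ℕ) (a : ℕ → ℕ → ℕ → ℕ → ℕ) (E : Table) (P : Labels) : Prop where
  lab : ∀ k ∈ Set.Icc 1 n, ∀ v ∈ Set.Icc 1 n, ∀ x ∈ Set.Icc 1 n, a 0 k v x = P k v x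
  some : ∀ i ∈ Set.Icc 1 n, ∀ j ∈ Set.Icc 1 n, ∀ s, E i j = some s →
    ∀ x ∈ Set.Icc 1 n, a 1 i j x = s x
  none : ∀ i ∈ Set.Icc 1 n, ∀ j ∈ Set.Icc 1 n, E i j = none → a 1 i j i = 0

/-- The first row of the array `2` holds `z`. -/
def Hand (n : ℕ) (a : ℕ → ℕ → ℕ → ℕ → ℕ) (z : Equiv.Perm ℕ) : Prop :=
  ∀ x ∈ Set.Icc 1 n, a 2 1 1 x = z x

theorem perm_inv_mem {n x : ℕ} {s : Equiv.Perm ℕ} (hs : s ∈ perms n) (hx : x ∈ Set.Icc 1 n) :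
    s⁻¹ x ∈ Set.Icc 1 n := perms_apply_mem ((permsSub n).inv_mem hs) le_rfl hx

namespace HE

/-- The absolute value of the difference. -/
def dist (a b : HE) : HE := .add (.sub a b) (.sub b a)

theorem eval_dist (s : HState) (a b : HE) : (dist a b).eval s = 0 ↔ a.eval s = b.eval s := by
  simp only [dist, eval]; omega

/-- A test for equality. -/
def eq (a b : HE) : HE := .sub (.const 1) (dist a b)

theorem eval_eq (s : HState) (a b : HE) : (eq a b).eval s ≠ 0 ↔ a.eval s = b.eval s := by
  rw [← eval_dist]; simp only [eq, eval]; omega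

theorem ok_dist {n : ℕ} {s : HState} {a b : HE} (ha : a.Ok n s) (hb : b.Ok n s) :
    (dist a b).Ok n s := ⟨⟨ha, hb⟩, hb, ha⟩

theorem ok_eq {n : ℕ} {s : HState} {a b : HE} (ha : a.Ok n s) (hb : b.Ok n s) :
    (eq a b).Ok n s := ⟨trivial, ok_dist ha hb⟩

theorem ok_arr {n : ℕ} {s : HState} {c : ℕ} {k j x : HE} (h0 : s.r 0 = n) (hc : c < 4)
    (hk : k.Ok n s) (hk' : k.eval s ∈ Set.Icc 1 n) (hj : j.Ok n s) (hj' : j.eval s ∈ Set.Icc 1 n)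
    (hx : x.Ok n s) (hx' : x.eval s ∈ Set.Icc 1 n) : (arr c k j x).Ok n s :=
  ⟨h0, hc, ⟨hk, hk'⟩, ⟨hj, hj'⟩, hx, hx'⟩

theorem ok_reg {n : ℕ} {s : HState} {r : ℕ} (h : r < 16) : (reg r).Ok n s := h

/-- A cell of the first row of an array. -/
def row (c : ℕ) (x : HE) : HE := .arr c (.const 1) (.const 1) x

theorem ok_row {n : ℕ} {s : HState} {c : ℕ} {x : HE} (h0 : s.r 0 = n) (hc : c < 4) (hn : 1 ≤ n)
    (hx : x.Ok n s) (hx' : x.eval s ∈ Set.Icc 1 n) : (row c x).Ok n s :=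
  ok_arr h0 hc trivial ⟨le_rfl, hn⟩ trivial ⟨le_rfl, hn⟩ hx hx'

end HE

/-! ## Merging -/

open HE in
/-- The program that computes the linking perm in the first row of the array `3`. -/
def HP.link : HP :=
  HP.assign 3 (const 1) (const 1) (arr 0 (reg 5) (row 2 (reg 4)) (row 2 (reg 1)))
    (arr 0 (reg 5) (reg 4) (reg 1))

open HE in
/-- The program that multiplies the label of the point in the register `2`. -/
def HP.relabel : HP :=
  HP.assign 0 (reg 5) (reg 2) (reg 1) (row 3 (arr 0 (reg 5) (reg 2) (reg 1)))

open HE in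
/-- The program that merges the class with representative in the register `3` into that of the
point in the register `4`, on the level in the register `5`. -/
def HP.merge : HP :=
  .seq HP.link
    (HP.for 2 (const 1) (.cond (HE.eq (arr 0 (reg 5) (reg 2) (reg 2)) (reg 3)) HP.relabel .skip))

theorem HRuns.merge : ∃ c, ∀ (n : ℕ) (s : HState) (P : Labels) (z : Equiv.Perm ℕ) (k₀ x₀ b : ℕ),
    1 ≤ n → s.r 0 = n → s.r 5 = k₀ → s.r 4 = x₀ → s.r 3 = b → k₀ ∈ Set.Icc 1 n →
    x₀ ∈ Set.Icc 1 n → z ∈ perms n → (∀ k ∈ Set.Icc 1 n, ∀ v ∈ Set.Icc 1 n, P k v ∈ perms n) →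
    (∀ k ∈ Set.Icc 1 n, ∀ v ∈ Set.Icc 1 n, ∀ x ∈ Set.Icc 1 n, s.a 0 k v x = P k v x) →
    Hand n s.a z →
    ∃ s' t, HRuns n HP.merge s s' t ∧ Keep 3 s s' ∧
      (∀ k ∈ Set.Icc 1 n, ∀ v ∈ Set.Icc 1 n, ∀ x ∈ Set.Icc 1 n,
        s'.a 0 k v x = P.merge k₀ b (P.link k₀ z x₀) k v x) ∧
      s'.a 1 = s.a 1 ∧ s'.a 2 = s.a 2 ∧ t ≤ c * n ^ 2 := by
  -- The costs of fixed program pieces do not depend on n; naming them keeps them opaque in the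
  -- arithmetic.
  obtain ⟨d, hd⟩ : ∃ d, d = HP.assignCost 3 (.const 1) (.const 1)
      (.arr 0 (.reg 5) (.row 2 (.reg 4)) (.row 2 (.reg 1))) (.arr 0 (.reg 5) (.reg 4) (.reg 1)) :=
    ⟨_, rfl⟩
  obtain ⟨d', hd'⟩ : ∃ d, d = HP.assignCost 0 (.reg 5) (.reg 2) (.reg 1)
      (.row 3 (.arr 0 (.reg 5) (.reg 2) (.reg 1))) := ⟨_, rfl⟩
  obtain ⟨d'', hd''⟩ : ∃ d, d = (HE.eq (.arr 0 (.reg 5) (.reg 2) (.reg 2)) (.reg 3)).comp.cost :=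
    ⟨_, rfl⟩
  refine ⟨d + d' + d'' + 30, ?_⟩
  intro n s P z k₀ x₀ b hn h0 h5 h4 h3 hk₀ hx₀ hz hP hlab hhand
  have hy := perms_apply_mem hz le_rfl hx₀
  have hyz : P k₀ (z x₀) * z ∈ perms n := (permsSub n).mul_mem (hP _ hk₀ _ hy) hz
  have hlink : P.link k₀ z x₀ ∈ perms n :=
    (permsSub n).mul_mem (hP _ hk₀ _ hx₀) ((permsSub n).inv_mem hyz)
  have h1I : 1 ∈ Set.Icc 1 n := ⟨le_rfl, hn⟩
  obtain ⟨s₁, t₁, hr₁, hk₁, hs₁, hq, ht₁⟩ := HRuns.assign (n := n) (s := s) (c := 3)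
    (k := .const 1) (j := .const 1)
    (e₁ := .arr 0 (.reg 5) (.row 2 (.reg 4)) (.row 2 (.reg 1)))
    (e₂ := .arr 0 (.reg 5) (.reg 4) (.reg 1)) (kv := 1) (jv := 1) (by omega) hn h0 h1I h1I
    (fun w => (P k₀ (z x₀) * z) w) (fun w => P k₀ x₀ w)
    (fun w hw => perms_apply_mem hyz le_rfl hw)
    (fun w hw => (perms_apply_mem (hP _ hk₀ _ hx₀) le_rfl hw).2)
    (fun w _ w' _ h => (P k₀ (z x₀) * z).injective h) (by
      intro s₁ w hw hk h1 ha
      have e0 : s₁.r 0 = n := by rw [hk.1 0 (by omega), h0]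
      have e4 : s₁.r 4 = x₀ := by rw [hk.1 4 (by omega), h4]
      have e5 : s₁.r 5 = k₀ := by rw [hk.1 5 (by omega), h5]
      have ea : ∀ c' ≠ 3, ∀ k' j' x', s₁.a c' k' j' x' = s.a c' k' j' x' :=
        fun c' hc' k' j' x' => ha c' k' j' x' fun h => absurd h hc'
      have ey : (HE.row 2 (.reg 4)).eval s₁ = z x₀ := by
        simp only [HE.row, HE.eval, e4]; rw [ea 2 (by omega), hhand _ hx₀]
      have ew : (HE.row 2 (.reg 1)).eval s₁ = z w := by
        simp only [HE.row, HE.eval, h1]; rw [ea 2 (by omega), hhand _ hw]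
      have hzw := perms_apply_mem hz le_rfl hw
      refine ⟨⟨trivial, rfl⟩, ⟨trivial, rfl⟩, ⟨?_, ?_⟩, ?_, ?_⟩
      · exact HE.ok_arr e0 (by omega) (HE.ok_reg (by omega)) (by rw [HE.eval, e5]; exact hk₀)
          (HE.ok_row e0 (by omega) hn (HE.ok_reg (by omega)) (by rw [HE.eval, e4]; exact hx₀))
          (by rw [ey]; exact hy)
          (HE.ok_row e0 (by omega) hn (HE.ok_reg (by omega)) (by rw [HE.eval, h1]; exact hw))
          (by rw [ew]; exact hzw)
      · rw [HE.eval, ey, ew, HE.eval, e5, ea 0 (by omega), hlab _ hk₀ _ hy _ hzw]; rfl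
      · exact HE.ok_arr e0 (by omega) (HE.ok_reg (by omega)) (by rw [HE.eval, e5]; exact hk₀)
          (HE.ok_reg (by omega)) (by rw [HE.eval, e4]; exact hx₀)
          (HE.ok_reg (by omega)) (by rw [HE.eval, h1]; exact hw)
      · simp only [HE.eval, e5, e4, h1]; rw [ea 0 (by omega), hlab _ hk₀ _ hx₀ _ hw])
  -- The loop has put `P k₀ x₀ w` into the cell of the image of w under `P k₀ (z x₀) * z`; read by
  -- cells, this is a product with the inverse.
  have hq' : ∀ u ∈ Set.Icc 1 n, s₁.a 3 1 1 u = P.link k₀ z x₀ u := by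
    intro u hu
    have := hq _ (perm_inv_mem hyz hu)
    rw [show (P k₀ (z x₀) * z) ((P k₀ (z x₀) * z)⁻¹ u) = u from
      Equiv.apply_symm_apply _ u] at this
    rw [this]; rfl
  have hs₁' : ∀ c' ≠ 3, ∀ k' j' x', s₁.a c' k' j' x' = s.a c' k' j' x' :=
    fun c' hc' k' j' x' => hs₁ c' k' j' x' fun h => absurd h hc'
  obtain ⟨s', t, φ', hr', hk', ⟨hI, hI'⟩, ht⟩ := HRuns.for_keep (n := n) (r := 2)
    (p := .cond (HE.eq (.arr 0 (.reg 5) (.reg 2) (.reg 2)) (.reg 3)) HP.relabel .skip)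
    (by omega) (by omega) (.const 1) (d'' + 2 + d' * n) 1
    (fun x _ a => (∀ k ∈ Set.Icc 1 n, ∀ v ∈ Set.Icc 1 n, ∀ w ∈ Set.Icc 1 n, a 0 k v w =
      if v < x then P.merge k₀ b (P.link k₀ z x₀) k v w else P k v w) ∧
      ∀ c' ≠ 0, ∀ k' j' x', a c' k' j' x' = s₁.a c' k' j' x') s₁ 0
    (by rw [hk₁.1 0 (by omega), h0]) trivial rfl (by omega)
    ⟨fun k hk v hv w hw => by
      rw [if_neg (by have := hv.1; omega), hs₁' 0 (by omega), hlab k hk v hv w hw],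
      fun _ _ _ _ _ => rfl⟩ (by
    rintro v φ s₂ hv1 hvn e2 hk₂ ⟨hI, hI'⟩
    have hv : v ∈ Set.Icc 1 n := ⟨hv1, hvn⟩
    have e0 : s₂.r 0 = n := by rw [hk₂.1 0 (by omega), hk₁.1 0 (by omega), h0]
    have e3 : s₂.r 3 = b := by rw [hk₂.1 3 (by omega), hk₁.1 3 (by omega), h3]
    have e5 : s₂.r 5 = k₀ := by rw [hk₂.1 5 (by omega), hk₁.1 5 (by omega), h5]
    have hrow : ∀ w ∈ Set.Icc 1 n, s₂.a 0 k₀ v w = P k₀ v w := fun w hw => by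
      rw [hI k₀ hk₀ v hv w hw, if_neg (by omega)]
    have hok : (HE.eq (.arr 0 (.reg 5) (.reg 2) (.reg 2)) (.reg 3)).Ok n s₂ :=
      HE.ok_eq (HE.ok_arr e0 (by omega) (HE.ok_reg (by omega)) (by rw [HE.eval, e5]; exact hk₀)
        (HE.ok_reg (by omega)) (by rw [HE.eval, e2]; exact hv)
        (HE.ok_reg (by omega)) (by rw [HE.eval, e2]; exact hv)) (HE.ok_reg (by omega))
    have hev : (HE.eq (.arr 0 (.reg 5) (.reg 2) (.reg 2)) (.reg 3)).eval s₂ ≠ 0 ↔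
        P.root k₀ v = b := by
      rw [HE.eval_eq]
      simp only [HE.eval, e5, e2, e3]
      rw [hrow v hv]; rfl
    by_cases hroot : P.root k₀ v = b
    · have hPv := hP k₀ hk₀ v hv
      obtain ⟨s₃, t₃, hr₃, hk₃, hs₃, hq₃, ht₃⟩ := HRuns.assign (n := n) (s := s₂) (c := 0)
        (k := .reg 5) (j := .reg 2) (e₁ := .reg 1)
        (e₂ := .row 3 (.arr 0 (.reg 5) (.reg 2) (.reg 1))) (kv := k₀) (jv := v) (by omega) hn e0
        hk₀ hv id (fun w => P.link k₀ z x₀ (P k₀ v w)) (fun w hw => hw)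
        (fun w hw => (perms_apply_mem hlink le_rfl (perms_apply_mem hPv le_rfl hw)).2)
        (fun w _ w' _ h => h) (by
          intro s₃ w hw hk h1 ha
          have e0' : s₃.r 0 = n := by rw [hk.1 0 (by omega), e0]
          have e2' : s₃.r 2 = v := by rw [hk.1 2 (by omega), e2]
          have e5' : s₃.r 5 = k₀ := by rw [hk.1 5 (by omega), e5]
          have hPvw := perms_apply_mem hPv le_rfl hw
          have ew : (HE.arr 0 (.reg 5) (.reg 2) (.reg 1)).eval s₃ = P k₀ v w := by
            simp only [HE.eval, e5', e2', h1]
            rw [ha, hrow w hw]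
            rintro - - - w' - hlt rfl
            exact absurd hlt (lt_irrefl _)
          refine ⟨⟨HE.ok_reg (by omega), e5'⟩, ⟨HE.ok_reg (by omega), e2'⟩,
            ⟨HE.ok_reg (by omega), h1⟩, ?_, ?_⟩
          · exact HE.ok_row e0' (by omega) hn (HE.ok_arr e0' (by omega) (HE.ok_reg (by omega))
              (by rw [HE.eval, e5']; exact hk₀) (HE.ok_reg (by omega))
              (by rw [HE.eval, e2']; exact hv) (HE.ok_reg (by omega))
              (by rw [HE.eval, h1]; exact hw)) (by rw [ew]; exact hPvw)
          · unfold HE.row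
            rw [HE.eval, ew]
            simp only [HE.eval]
            rw [ha 3 1 1 _ (fun h => absurd h (by omega)), hI' 3 (by omega), hq' _ hPvw])
      refine ⟨s₃, _, 0, .condTrue hok (hev.2 hroot) hr₃, hk₃, ⟨?_, ?_⟩, ?_⟩
      · intro k hk v' hv' w hw
        by_cases hkv : k = k₀ ∧ v' = v
        · obtain ⟨rfl, rfl⟩ := hkv
          rw [if_pos (by omega), show w = id w from rfl, hq₃ w hw]
          simp [Labels.merge, hroot]
        · rw [hs₃, hI k hk v' hv' w hw]
          · by_cases hlt : v' < v
            · rw [if_pos hlt, if_pos (by omega)]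
            · rw [if_neg hlt]
              split_ifs with hlt'
              · obtain rfl : v' = v := by omega
                rw [Labels.merge_of_ne]
                exact fun e => hkv ⟨e, rfl⟩
              · rfl
          · exact fun _ e1 e2 => absurd ⟨e1, e2⟩ hkv
      · intro c' hc' k' j' x'
        rw [hs₃ c' k' j' x' (fun h => absurd h hc'), hI' c' hc']
      · rw [← hd'', hd']; omega
    · refine ⟨s₂, _, 0, .condFalse hok (not_not.1 (mt hev.1 hroot)) (.skip _), Keep.refl _ _,
        ⟨?_, hI'⟩, ?_⟩
      · intro k hk v' hv' w hw
        rw [hI k hk v' hv' w hw]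
        by_cases hlt : v' < v
        · rw [if_pos hlt, if_pos (by omega)]
        · rw [if_neg hlt]
          split_ifs with hlt'
          · obtain rfl : v' = v := by omega
            unfold Labels.merge
            rw [if_neg]
            rintro ⟨rfl, e⟩
            exact hroot e
          · rfl
      · rw [← hd'']; omega)
  refine ⟨s', t₁ + t, .seq hr₁ hr', (hk₁.mono (by omega)).trans hk', ?_, ?_, ?_, ?_⟩
  · intro k hk v hv x hx
    rw [hI k hk v hv x hx, if_pos (by have := hv.2; omega)]
  · funext k j x; rw [hI' 1 (by omega), hs₁' 1 (by omega)]
  · funext k j x; rw [hI' 2 (by omega), hs₁' 2 (by omega)]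
  · rw [← hd] at ht₁
    have e : (HE.const 1).comp.cost = 1 := rfl
    rw [e, Nat.add_sub_cancel] at ht
    have hsq : n ≤ n ^ 2 := Nat.le_self_pow (by omega) n
    have h1 := Nat.mul_le_mul_left d hsq
    have h2 := Nat.mul_le_mul_left d'' hsq
    nlinarith

/-! ## Storing a new entry -/

open HE in
/-- The representative of the point `y` on the level in the register `5`. -/
def HE.rootCur (y : HE) : HE := arr 0 (reg 5) y y

open HE in
/-- The program that merges the classes of the point in the register `4` and of its image. -/
def HP.mergeStep : HP :=
  .seq (.set 3 (rootCur (row 2 (reg 4))))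
    (.cond (.mul (.sub (reg 5) (reg 3)) (HE.dist (rootCur (reg 4)) (reg 3))) HP.merge .skip)

open HE in
/-- The program that stores the perm in hand as a new entry and updates the labels. -/
def HP.absorb : HP :=
  .seq (HP.assign 1 (reg 7) (reg 6) (reg 1) (row 2 (reg 1)))
    (HP.for 5 (reg 7) (HP.for 4 (const 1) HP.mergeStep))

/-- A merge takes O(n²) ≤ w steps and lowers `imc`, so it pays for itself and only a constant cost
remains. The array may hold a table E' that already contains z, while the labels are still compared
with the old E. -/
theorem HRuns.mergeStep : ∃ c, ∀ (n w : ℕ) (s : HState) (E E' : Table) (P P₁ : Labels)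
    (z : Equiv.Perm ℕ) (i k₀ x₀ : ℕ),
    1 ≤ n → c * n ^ 2 ≤ w → s.r 0 = n → s.r 5 = k₀ → s.r 4 = x₀ → k₀ ∈ Set.Icc 1 n →
    x₀ ∈ Set.Icc 1 n → i ≤ k₀ → z ∈ perms i → Absorb n E P i z k₀ x₀ P₁ → Rel n s.a E' P₁ →
    Hand n s.a z →
    ∃ s' t P₂, HRuns n HP.mergeStep s s' t ∧ Keep 4 s s' ∧ Absorb n E P i z k₀ (x₀ + 1) P₂ ∧
      Rel n s'.a E' P₂ ∧ Hand n s'.a z ∧ t + w * imc n P₂ ≤ c + w * imc n P₁ := by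
  obtain ⟨c, hc⟩ := HRuns.merge
  obtain ⟨d, hd⟩ : ∃ d, d = (HE.rootCur (.row 2 (.reg 4))).comp.cost + 2 := ⟨_, rfl⟩
  obtain ⟨d', hd'⟩ : ∃ d, d = (HE.mul (.sub (.reg 5) (.reg 3))
    (HE.dist (.rootCur (.reg 4)) (.reg 3))).comp.cost + 1 := ⟨_, rfl⟩
  refine ⟨c + d + d' + 1, ?_⟩
  intro n w s E E' P P₁ z i k₀ x₀ hn hw h0 h5 h4 hk₀ hx₀ hi hz ha hrel hhand
  have hzk := perms_mono hi hz
  have hzn := perms_mono hk₀.2 hzk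
  have hy := perms_apply_mem hzn le_rfl hx₀
  have hP : ∀ k ∈ Set.Icc 1 n, ∀ v ∈ Set.Icc 1 n, P₁ k v ∈ perms n := fun k hk v hv =>
    perms_mono hk.2 (genWith_le_permsSub E z k (ha.lab k hk v hv))
  have ey : (HE.row 2 (.reg 4)).eval s = z x₀ := by
    simp only [HE.row, HE.eval, h4]; exact hhand _ hx₀
  have oky : (HE.row 2 (.reg 4)).Ok n s := HE.ok_row h0 (by omega) hn (HE.ok_reg (by omega))
    (by rw [HE.eval, h4]; exact hx₀)
  have er : (HE.rootCur (.row 2 (.reg 4))).eval s = P₁.root k₀ (z x₀) := by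
    rw [HE.rootCur, HE.eval, ey, HE.eval, h5, hrel.lab _ hk₀ _ hy _ hy]; rfl
  have hset := HRuns.set (n := n) (r := 3) (e := .rootCur (.row 2 (.reg 4))) (s := s) (by omega)
    (HE.ok_arr h0 (by omega) (HE.ok_reg (by omega)) (by rw [HE.eval, h5]; exact hk₀) oky
      (by rw [ey]; exact hy) oky (by rw [ey]; exact hy))
    (by rw [er]; have := (perms_apply_mem (hP _ hk₀ _ hy) le_rfl hy).2
        simp only [Labels.root]; omega)
  rw [er, ← hd] at hset
  set b := P₁.root k₀ (z x₀) with hb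
  -- The program tests b ≠ k₀ by the truncated difference k₀ - b. This misses b > k₀, but then z
  -- fixes x₀ and there is nothing to merge.
  have hbk : b ≤ k₀ ∨ P₁.root k₀ x₀ = b := by
    by_cases hzx : z x₀ ∈ Set.Icc 1 k₀
    · exact .inl (perms_apply_mem (genWith_le_permsSub E z k₀ (ha.lab _ hk₀ _ hy)) le_rfl hzx).2
    · right
      exact congrArg _ (z.injective (hzk _ hzx)).symm
  have hk : Keep 4 s (s.setR 3 b) := (Keep.refl _ s).setR (by omega) (by omega) _
  have g0 : (s.setR 3 b).r 0 = n := by rw [hk.1 0 (by omega), h0]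
  have g4 : (s.setR 3 b).r 4 = x₀ := by rw [hk.1 4 (by omega), h4]
  have g5 : (s.setR 3 b).r 5 = k₀ := by rw [hk.1 5 (by omega), h5]
  have g3 : (s.setR 3 b).r 3 = b := by simp
  have hok : (HE.mul (.sub (.reg 5) (.reg 3)) (HE.dist (.rootCur (.reg 4)) (.reg 3))).Ok n
      (s.setR 3 b) := by
    refine ⟨⟨HE.ok_reg (by omega), HE.ok_reg (by omega)⟩, HE.ok_dist ?_ (HE.ok_reg (by omega))⟩
    exact HE.ok_arr g0 (by omega) (HE.ok_reg (by omega)) (by rw [HE.eval, g5]; exact hk₀)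
      (HE.ok_reg (by omega)) (by rw [HE.eval, g4]; exact hx₀) (HE.ok_reg (by omega))
      (by rw [HE.eval, g4]; exact hx₀)
  have hev : (HE.mul (.sub (.reg 5) (.reg 3)) (HE.dist (.rootCur (.reg 4)) (.reg 3))).eval
      (s.setR 3 b) ≠ 0 ↔ b ≠ k₀ ∧ P₁.root k₀ x₀ ≠ b := by
    rw [HE.eval, mul_ne_zero_iff, Ne, Ne, HE.eval_dist]
    simp only [HE.rootCur, HE.eval, g5, g3, g4, HState.setR_a]
    rw [hrel.lab _ hk₀ _ hx₀ _ hx₀]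
    change _ ∧ ¬ P₁.root k₀ x₀ = b ↔ _
    constructor
    · rintro ⟨h1, h2⟩; exact ⟨by omega, h2⟩
    · rintro ⟨h1, h2⟩
      exact ⟨by rcases hbk with h | h; · omega
                · exact absurd h h2, h2⟩
  by_cases hm : b ≠ k₀ ∧ P₁.root k₀ x₀ ≠ b
  · obtain ⟨s', t, hr, hk', hl, h1, h2, ht⟩ := hc n (s.setR 3 b) P₁ z k₀ x₀ b hn g0 g5 g4 g3 hk₀
      hx₀ hzn hP hrel.lab hhand
    obtain ⟨ha', him⟩ := ha.merge hz hi hk₀ hx₀ hm.1 hm.2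
    rw [← hb] at him
    refine ⟨s', _, P₁.merge k₀ b (P₁.link k₀ z x₀), .seq hset (.condTrue hok (hev.2 hm) hr), hk.trans (hk'.mono (by omega)), ha',
      ⟨hl, by rw [h1]; exact hrel.some, by rw [h1]; exact hrel.none⟩,
      by intro x hx; rw [h2]; exact hhand x hx, ?_⟩
    rw [← hd']
    have h3 : w * imc n (P₁.merge k₀ b (P₁.link k₀ z x₀)) + w ≤ w * imc n P₁ := by
      have := Nat.mul_le_mul_left w (Nat.succ_le_of_lt him)
      rwa [Nat.mul_succ] at this
    have h4 : c * n ^ 2 ≤ w := le_trans (Nat.mul_le_mul_right _ (by omega)) hw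
    omega
  · refine ⟨s.setR 3 b, _, P₁, .seq hset (.condFalse hok (not_not.1 (mt hev.1 hm)) (.skip _)), hk,
      ha.skip ?_, hrel, hhand, ?_⟩
    · by_contra hcon
      push Not at hcon
      exact hm ⟨hcon.1, hcon.2⟩
    · rw [← hd']; omega

/-- Scanning all points on all levels from i on takes O(n²) steps; the merges are covered by the
decrease of `imc`. -/
theorem HRuns.absorb : ∃ c, ∀ (n w : ℕ) (s : HState) (G : Subgroup (Equiv.Perm ℕ)) (E₀ E : Table)
    (P₀ P : Labels) (z₀ z : Equiv.Perm ℕ) (i₀ i : ℕ),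
    1 ≤ n → c * n ^ 2 ≤ w → s.r 0 = n → s.r 7 = i → s.r 6 = z i → i ∈ Set.Icc 1 n →
    Sift n G E₀ P₀ z₀ i₀ i E P z → P.root i (z i) ≠ i → Rel n s.a E P → Hand n s.a z →
    ∃ s' t P₁, HRuns n HP.absorb s s' t ∧ Keep 6 s s' ∧ Absorb n E P i z (n + 1) 1 P₁ ∧
      Rel n s'.a (E.put i (z i) (some z)) P₁ ∧ Hand n s'.a z ∧
      t + w * imc n P₁ ≤ c * n ^ 2 + w * imc n P := by
  obtain ⟨c, hc⟩ := HRuns.mergeStep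
  obtain ⟨d, hd⟩ : ∃ d, d = HP.assignCost 1 (.reg 7) (.reg 6) (.reg 1) (.row 2 (.reg 1)) :=
    ⟨_, rfl⟩
  refine ⟨c + d + 60, ?_⟩
  intro n w s G E₀ E P₀ P z₀ z i₀ i hn hw h0 h7 h6 hi hs hroot hrel hhand
  have hzi : z i ∈ Set.Icc 1 n := perms_apply_mem hs.z_mem hi.2 hi
  have hzn := perms_mono hi.2 hs.z_mem
  have hnone := hs.entry_none hi hroot
  obtain ⟨s₁, t₁, hr₁, hk₁, hs₁, hq, ht₁⟩ := HRuns.assign (n := n) (s := s) (c := 1)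
    (k := .reg 7) (j := .reg 6) (e₁ := .reg 1) (e₂ := .row 2 (.reg 1)) (kv := i) (jv := z i)
    (by omega) hn h0 hi hzi id (fun w => z w) (fun w hw => hw)
    (fun w hw => (perms_apply_mem hzn le_rfl hw).2) (fun w _ w' _ h => h) (by
      intro s₁ w hw hk h1 ha
      have e0 : s₁.r 0 = n := by rw [hk.1 0 (by omega), h0]
      refine ⟨⟨HE.ok_reg (by omega), by rw [HE.eval, hk.1 7 (by omega), h7]⟩,
        ⟨HE.ok_reg (by omega), by rw [HE.eval, hk.1 6 (by omega), h6]⟩,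
        ⟨HE.ok_reg (by omega), h1⟩, HE.ok_row e0 (by omega) hn (HE.ok_reg (by omega))
          (by rw [HE.eval, h1]; exact hw), ?_⟩
      simp only [HE.row, HE.eval, h1]
      rw [ha 2 1 1 _ (fun h => absurd h (by omega)), hhand w hw])
  have hrel₁ : Rel n s₁.a (E.put i (z i) (some z)) P := by
    refine ⟨fun k hk v hv x hx => ?_, fun a ha b hb g hg x hx => ?_, fun a ha b hb hg => ?_⟩
    · rw [hs₁ 0 k v x (fun h => absurd h (by omega)), hrel.lab k hk v hv x hx]
    · unfold Table.put at hg
      split_ifs at hg with hab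
      · obtain ⟨rfl, rfl⟩ := hab
        rw [show x = id x from rfl, hq x hx]
        simp only [Option.some.injEq] at hg
        rw [hg]; rfl
      · rw [hs₁ 1 a b x (fun _ e1 e2 => absurd ⟨e1, e2⟩ hab), hrel.some a ha b hb g hg x hx]
    · unfold Table.put at hg
      split_ifs at hg with hab
      rw [hs₁ 1 a b a (fun _ e1 e2 => absurd ⟨e1, e2⟩ hab), hrel.none a ha b hb hg]
  have hhand₁ : Hand n s₁.a z := fun x hx => by
    rw [hs₁ 2 1 1 x (fun h => absurd h (by omega)), hhand x hx]
  have h0' : s₁.r 0 = n := by rw [hk₁.1 0 (by omega), h0]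
  have h7' : s₁.r 7 = i := by rw [hk₁.1 7 (by omega), h7]
  obtain ⟨s', t, φ', hr', hk', ⟨P₁, hI1, hI2, hI3, rfl⟩, ht⟩ := HRuns.for_keep (n := n) (r := 5)
    (p := HP.for 4 (.const 1) HP.mergeStep) (by omega) (by omega) (.reg 7)
    (n * (c + 14) + 11) i
    (fun k φ a => ∃ P₁, Absorb n E P i z k 1 P₁ ∧ Rel n a (E.put i (z i) (some z)) P₁ ∧
      Hand n a z ∧ φ = w * imc n P₁) s₁ (w * imc n P) h0' (HE.ok_reg (by omega))
    (by rw [HE.eval, h7']) (by have := hi.2; omega) ⟨P, hs.absorb_start, hrel₁, hhand₁, rfl⟩ (by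
      rintro k φ s₂ hik hkn e5 hk₂ ⟨P₁, hI1, hI2, hI3, rfl⟩
      have e0 : s₂.r 0 = n := by rw [hk₂.1 0 (by omega), h0']
      have hkI : k ∈ Set.Icc 1 n := ⟨hi.1.trans hik, hkn⟩
      obtain ⟨s', t, φ', hr', hk', ⟨P₂, hI1, hI2, hI3, rfl⟩, ht⟩ := HRuns.for_keep (n := n)
        (r := 4) (p := HP.mergeStep) (by omega) (by omega) (.const 1) c 1
        (fun x φ a => ∃ P₁, Absorb n E P i z k x P₁ ∧ Rel n a (E.put i (z i) (some z)) P₁ ∧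
          Hand n a z ∧ φ = w * imc n P₁) s₂ (w * imc n P₁) e0 trivial rfl (by omega)
        ⟨P₁, hI1, hI2, hI3, rfl⟩ (by
          rintro x φ s₃ hx1 hxn e4 hk₃ ⟨P₂, hJ1, hJ2, hJ3, rfl⟩
          obtain ⟨s', t, P₃, hr, hk, hJ1', hJ2', hJ3', ht⟩ := hc n w s₃ E
            (E.put i (z i) (some z)) P P₂ z i k x hn
            (le_trans (Nat.mul_le_mul_right _ (by omega)) hw) (by rw [hk₃.1 0 (by omega), e0])
            (by rw [hk₃.1 5 (by omega), e5]) e4 hkI ⟨hx1, hxn⟩ hik hs.z_mem hJ1 hJ2 hJ3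
          exact ⟨s', t, _, hr, hk, ⟨P₃, hJ1', hJ2', hJ3', rfl⟩, ht⟩)
      refine ⟨s', t, _, hr', hk', ⟨P₂, hI1.next_level hzn, hI2, hI3, rfl⟩, ?_⟩
      have e : (HE.const 1).comp.cost = 1 := rfl
      rw [e, Nat.add_sub_cancel] at ht
      omega)
  refine ⟨s', _, P₁, .seq hr₁ hr', (hk₁.mono (by omega)).trans hk', hI1, hI2, hI3, ?_⟩
  have e : (HE.reg 7).comp.cost = 2 := rfl
  rw [e] at ht
  rw [← hd] at ht₁
  have hsq : n ≤ n ^ 2 := Nat.le_self_pow (by omega) n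
  have h1 : (n + 1 - i) * (n * (c + 14) + 11 + 14) ≤ n * (n * (c + 14) + 11 + 14) :=
    Nat.mul_le_mul_right _ (by have := hi.1; omega)
  have h2 := Nat.mul_le_mul_left d hsq
  nlinarith

/-! ## Insertion -/

open HE in
/-- The program for one level of an insertion. -/
def HP.siftStep : HP :=
  .seq (.set 6 (row 2 (reg 7)))
    (.seq (.cond (.sub (reg 7) (arr 0 (reg 7) (reg 6) (reg 6))) HP.absorb .skip)
      (HP.assign 2 (const 1) (const 1) (reg 1) (arr 0 (reg 7) (reg 6) (row 2 (reg 1)))))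

/-- The program that inserts the perm in hand, from the level in the register `7` on. -/
def HP.insert : HP := HP.down 7 HP.siftStep

/-- The potential for the analysis of the running time. -/
def pot (n : ℕ) (E : Table) (P : Labels) : ℕ := 3 * unc n P + imc n P + 2 * (ent n E).card

/-- The numbers of pairs of a level and a point outside of its orbit, and of these pairs together
with the entries, have not increased. -/
def CountLe (n : ℕ) (E : Table) (P : Labels) (E' : Table) (P' : Labels) : Prop :=
  unc n P' ≤ unc n P ∧ unc n P' + (ent n E').card ≤ unc n P + (ent n E).card

theorem CountLe.refl (n : ℕ) (E : Table) (P : Labels) : CountLe n E P E P := ⟨le_rfl, le_rfl⟩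

theorem CountLe.trans {n : ℕ} {E E' E'' : Table} {P P' P'' : Labels} (h : CountLe n E P E' P')
    (h' : CountLe n E' P' E'' P'') : CountLe n E P E'' P'' := ⟨h'.1.trans h.1, h'.2.trans h.2⟩

/-- Storing an entry brings z i into the orbit of i: `unc` falls by at least 1, while there is one
more entry. With the coefficients 3 and 2 this releases at least w ≥ c n² for the scan, and the
merges use `imc`. What is left is the multiplication by a label, in O(n) steps. -/
theorem HRuns.siftStep : ∃ c, ∀ (n w : ℕ) (s : HState) (G : Subgroup (Equiv.Perm ℕ))
    (E₀ E : Table) (P₀ P : Labels) (z₀ z : Equiv.Perm ℕ) (i₀ i : ℕ),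
    c * n ^ 2 ≤ w → s.r 0 = n → s.r 7 = i + 1 → i + 1 ≤ i₀ → i₀ ≤ n →
    Sift n G E₀ P₀ z₀ i₀ (i + 1) E P z → Rel n s.a E P → Hand n s.a z →
    ∃ s' t E' P' z', HRuns n HP.siftStep s s' t ∧ Keep 7 s s' ∧ Sift n G E₀ P₀ z₀ i₀ i E' P' z' ∧
      Rel n s'.a E' P' ∧ Hand n s'.a z' ∧ CountLe n E P E' P' ∧
      t + w * pot n E' P' ≤ c * n + w * pot n E P := by
  obtain ⟨c, hc⟩ := HRuns.absorb
  obtain ⟨d, hd⟩ : ∃ d, d = (HE.row 2 (.reg 7)).comp.cost + 2 := ⟨_, rfl⟩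
  obtain ⟨d', hd'⟩ : ∃ d, d = (HE.sub (.reg 7) (.arr 0 (.reg 7) (.reg 6) (.reg 6))).comp.cost + 1 :=
    ⟨_, rfl⟩
  obtain ⟨e, he⟩ : ∃ d, d = HP.assignCost 2 (.const 1) (.const 1) (.reg 1)
    (.arr 0 (.reg 7) (.reg 6) (.row 2 (.reg 1))) := ⟨_, rfl⟩
  refine ⟨c + d + d' + e + 1, ?_⟩
  intro n w s G E₀ E P₀ P z₀ z i₀ i hw h0 h7 hi hi₀ hs hrel hhand
  have hin : i + 1 ∈ Set.Icc 1 n := ⟨by omega, by omega⟩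
  have hn : 1 ≤ n := hin.1.trans hin.2
  have hz : z ∈ perms n := perms_mono hin.2 hs.z_mem
  have hj := perms_apply_mem hz le_rfl hin
  have hcw : c * n ^ 2 ≤ w := le_trans (Nat.mul_le_mul_right _ (by omega)) hw
  have ej : (HE.row 2 (.reg 7)).eval s = z (i + 1) := by
    simp only [HE.row, HE.eval, h7]; exact hhand _ hin
  have hset := HRuns.set (n := n) (r := 6) (e := .row 2 (.reg 7)) (s := s) (by omega)
    (HE.ok_row h0 (by omega) hn (HE.ok_reg (by omega)) (by rw [HE.eval, h7]; exact hin))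
    (by rw [ej]; have := hj.2; omega)
  rw [ej, ← hd] at hset
  have hk : Keep 7 s (s.setR 6 (z (i + 1))) := (Keep.refl _ s).setR (by omega) (by omega) _
  have g0 : (s.setR 6 (z (i + 1))).r 0 = n := by rw [hk.1 0 (by omega), h0]
  have g7 : (s.setR 6 (z (i + 1))).r 7 = i + 1 := by rw [hk.1 7 (by omega), h7]
  have g6 : (s.setR 6 (z (i + 1))).r 6 = z (i + 1) := by simp
  have hPn : P (i + 1) (z (i + 1)) ∈ perms (i + 1) :=
    gen_le_permsSub _ _ (hs.lab_low _ hin le_rfl _ hj)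
  -- This bound makes the truncated difference in the test vanish only in case of equality.
  have hle : P.root (i + 1) (z (i + 1)) ≤ i + 1 := by
    refine (perms_apply_mem hPn le_rfl ?_).2
    exact perms_apply_mem hs.z_mem le_rfl ⟨by omega, le_rfl⟩
  have hok : (HE.sub (.reg 7) (.arr 0 (.reg 7) (.reg 6) (.reg 6))).Ok n
      (s.setR 6 (z (i + 1))) :=
    ⟨HE.ok_reg (by omega), HE.ok_arr g0 (by omega) (HE.ok_reg (by omega))
      (by rw [HE.eval, g7]; exact hin) (HE.ok_reg (by omega)) (by rw [HE.eval, g6]; exact hj)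
      (HE.ok_reg (by omega)) (by rw [HE.eval, g6]; exact hj)⟩
  have hev : (HE.sub (.reg 7) (.arr 0 (.reg 7) (.reg 6) (.reg 6))).eval
      (s.setR 6 (z (i + 1))) = i + 1 - P.root (i + 1) (z (i + 1)) := by
    simp only [HE.eval, g7, g6, HState.setR_a]
    rw [hrel.lab _ hin _ hj _ hj]; rfl
  obtain ⟨s₁, t₁, E₁, P₁, hr₁, hk₁, hs₁, hroot, hrel₁, hhand₁, hcnt, ht₁⟩ : ∃ s₁ t₁ E₁ P₁,
      HRuns n (.cond (.sub (.reg 7) (.arr 0 (.reg 7) (.reg 6) (.reg 6))) HP.absorb .skip)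
        (s.setR 6 (z (i + 1))) s₁ t₁ ∧ Keep 6 (s.setR 6 (z (i + 1))) s₁ ∧
        Sift n G E₀ P₀ z₀ i₀ (i + 1) E₁ P₁ z ∧ P₁.root (i + 1) (z (i + 1)) = i + 1 ∧
        Rel n s₁.a E₁ P₁ ∧ Hand n s₁.a z ∧
        CountLe n E P E₁ P₁ ∧
        t₁ + w * pot n E₁ P₁ ≤ d' + 1 + w * pot n E P := by
    by_cases hroot : P.root (i + 1) (z (i + 1)) = i + 1
    · refine ⟨_, _, E, P, .condFalse hok (by rw [hev]; omega) (.skip _), Keep.refl _ _, hs, hroot,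
        hrel, hhand, .refl _ _ _, ?_⟩
      rw [← hd']
    · obtain ⟨s₁, t₁, P₁, hr, hk, ha, hrel₁, hhand₁, ht⟩ := hc n w (s.setR 6 (z (i + 1))) G E₀ E
        P₀ P z₀ z i₀ (i + 1) hn hcw g0 g7 g6 hin hs hroot hrel hhand
      obtain ⟨h1, h2⟩ := hs.store hin hi hroot ha
      have h3 : unc n P₁ < unc n P := unc_lt ha.coarse hin hj hroot h2
      have h4 := ent_put_some z hin hj (hs.entry_none hin hroot)
      refine ⟨s₁, _, _, P₁, .condTrue hok (by rw [hev]; omega) hr, hk, h1, h2, hrel₁, hhand₁,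
        ⟨by omega, by omega⟩, ?_⟩
      rw [← hd']
      unfold pot
      rw [h4]
      have h5 : w * (3 * unc n P₁ + imc n P₁ + 2 * ((ent n E).card + 1)) + w ≤
          w * imc n P₁ + w * (3 * unc n P + 2 * (ent n E).card) := by
        rw [← mul_add_one, ← mul_add]
        exact Nat.mul_le_mul_left _ (by omega)
      have h6 : w * (3 * unc n P + imc n P + 2 * (ent n E).card) =
          w * imc n P + w * (3 * unc n P + 2 * (ent n E).card) := by ring
      omega
  have f0 : s₁.r 0 = n := by rw [hk₁.1 0 (by omega), g0]
  have f6 : s₁.r 6 = z (i + 1) := by rw [hk₁.1 6 (by omega), g6]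
  have f7 : s₁.r 7 = i + 1 := by rw [hk₁.1 7 (by omega), g7]
  have hP₁ : P₁ (i + 1) (z (i + 1)) ∈ perms n :=
    perms_mono hin.2 (gen_le_permsSub _ _ (hs₁.lab_low _ hin le_rfl _ hj))
  have h1I : 1 ∈ Set.Icc 1 n := ⟨le_rfl, hn⟩
  obtain ⟨s₂, t₂, hr₂, hk₂, hs₂, hq, ht₂⟩ := HRuns.assign (n := n) (s := s₁) (c := 2)
    (k := .const 1) (j := .const 1) (e₁ := .reg 1)
    (e₂ := .arr 0 (.reg 7) (.reg 6) (.row 2 (.reg 1))) (kv := 1) (jv := 1)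
    (by omega) hn f0 h1I h1I id (fun w => P₁ (i + 1) (z (i + 1)) (z w)) (fun w hw => hw)
    (fun w hw => (perms_apply_mem hP₁ le_rfl (perms_apply_mem hz le_rfl hw)).2)
    (fun w _ w' _ h => h) (by
      intro s₂ w hw hk h1 ha
      have e0 : s₂.r 0 = n := by rw [hk.1 0 (by omega), f0]
      have e6 : s₂.r 6 = z (i + 1) := by rw [hk.1 6 (by omega), f6]
      have e7 : s₂.r 7 = i + 1 := by rw [hk.1 7 (by omega), f7]
      have ew : (HE.row 2 (.reg 1)).eval s₂ = z w := by
        simp only [HE.row, HE.eval, h1]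
        rw [ha, hhand₁ w hw]
        rintro - - - w' - hlt rfl
        exact absurd hlt (lt_irrefl _)
      have hzw := perms_apply_mem hz le_rfl hw
      refine ⟨⟨trivial, rfl⟩, ⟨trivial, rfl⟩, ⟨HE.ok_reg (by omega), h1⟩,
        HE.ok_arr e0 (by omega) (HE.ok_reg (by omega)) (by rw [HE.eval, e7]; exact hin)
          (HE.ok_reg (by omega)) (by rw [HE.eval, e6]; exact hj)
          (HE.ok_row e0 (by omega) hn (HE.ok_reg (by omega)) (by rw [HE.eval, h1]; exact hw))
          (by rw [ew]; exact hzw), ?_⟩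
      rw [HE.eval, ew]
      simp only [HE.eval, e6, e7]
      rw [ha 0 _ _ _ (fun h => absurd h (by omega)), hrel₁.lab _ hin _ hj _ hzw])
  refine ⟨s₂, _, E₁, P₁, _, .seq hset (.seq hr₁ hr₂),
    hk.trans ((hk₁.mono (by omega)).trans (hk₂.mono (by omega))), hs₁.step hi hi₀ hroot, ?_, ?_,
    hcnt, ?_⟩
  · have h2 : ∀ c' ≠ 2, ∀ k' j' x', s₂.a c' k' j' x' = s₁.a c' k' j' x' :=
      fun c' hc' k' j' x' => hs₂ c' k' j' x' fun h => absurd h hc'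
    refine ⟨fun k hk v hv x hx => ?_, fun a ha b hb g hg x hx => ?_, fun a ha b hb hg => ?_⟩
    · rw [h2 0 (by omega), hrel₁.lab k hk v hv x hx]
    · rw [h2 1 (by omega), hrel₁.some a ha b hb g hg x hx]
    · rw [h2 1 (by omega), hrel₁.none a ha b hb hg]
  · intro x hx
    rw [show x = id x from rfl, hq x hx]; rfl
  · rw [← he] at ht₂
    have h8 : (c + d + d' + e + 1) * n = c * n + (d + d' + 1) * n + e * n := by ring
    have h9 : d + d' + 1 ≤ (d + d' + 1) * n := Nat.le_mul_of_pos_right _ hn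
    rw [h8]
    omega

theorem HRuns.insert : ∃ c, ∀ (n w : ℕ) (s : HState) (G : Subgroup (Equiv.Perm ℕ))
    (E₀ : Table) (P₀ : Labels) (z₀ : Equiv.Perm ℕ) (i₀ : ℕ),
    1 ≤ n → c * n ^ 2 ≤ w → s.r 0 = n → s.r 7 = i₀ → i₀ ≤ n →
    Sift n G E₀ P₀ z₀ i₀ i₀ E₀ P₀ z₀ → Rel n s.a E₀ P₀ → Hand n s.a z₀ →
    ∃ s' t E' P', HRuns n HP.insert s s' t ∧ Keep 8 s s' ∧ Inserted n G E₀ P₀ z₀ i₀ E' P' ∧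
      Rel n s'.a E' P' ∧ CountLe n E₀ P₀ E' P' ∧
      t + w * pot n E' P' ≤ c * n ^ 2 + w * pot n E₀ P₀ := by
  obtain ⟨c, hc⟩ := HRuns.siftStep
  refine ⟨c + 22, ?_⟩
  intro n w s G E₀ P₀ z₀ i₀ hn hw h0 h7 hi₀ hs hrel hhand
  obtain ⟨s', t, φ', hr', hk', ⟨E', P', z', hI1, hI2, -, hI4, rfl⟩, ht⟩ := HRuns.down_keep
    (n := n) (r := 7) (p := HP.siftStep) (by omega) (by omega) (c * n) i₀
    (fun i φ a => ∃ E P z, Sift n G E₀ P₀ z₀ i₀ i E P z ∧ Rel n a E P ∧ Hand n a z ∧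
      CountLe n E₀ P₀ E P ∧ φ = w * pot n E P) s
    (w * pot n E₀ P₀) h7 hi₀ ⟨E₀, P₀, z₀, hs, hrel, hhand, .refl _ _ _, rfl⟩ (by
      rintro i φ s₁ hi e7 hk₁ ⟨E, P, z, hI1, hI2, hI3, hI4, rfl⟩
      obtain ⟨s', t, E', P', z', hr, hk, h1, h2, h3, h4, h5⟩ := hc n w s₁ G E₀ E P₀ P z₀ z i₀ i
        (le_trans (Nat.mul_le_mul_right _ (by omega)) hw) (by rw [hk₁.1 0 (by omega), h0]) e7 hi
        hi₀ hI1 hI2 hI3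
      exact ⟨s', t, _, hr, hk, ⟨E', P', z', h1, h2, h3, hI4.trans h4, rfl⟩, h5⟩)
  refine ⟨s', t, E', P', hr', hk', hI1.inserted, hI2, hI4, ht.trans ?_⟩
  have hsq : n ≤ n ^ 2 := Nat.le_self_pow (by omega) n
  have h1 : i₀ * (c * n + 14) ≤ n * (c * n + 14) := Nat.mul_le_mul_right _ hi₀
  nlinarith

/-! ## Removal of redundant entries -/

/-- The level below the one in the register `11`. -/
def HE.predLevel : HE := .sub (.reg 11) (.const 1)

open HE in
/-- The program that computes the perm that replaces the entry of the register `9`, using the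
entry of the register `10`, and removes the former. -/
def HP.diff : HP :=
  .seq (HP.assign 3 (const 1) (const 1) (arr 0 predLevel (reg 10) (arr 1 (reg 11) (reg 10) (reg 1)))
    (reg 1))
  (.seq (HP.assign 2 (const 1) (const 1) (reg 1)
    (row 3 (arr 0 predLevel (reg 9) (arr 1 (reg 11) (reg 9) (reg 1)))))
  (.seta 1 (reg 11) (reg 9) (reg 11) (const 0)))

/-- The program that replaces an entry and sets a flag. -/
def HP.replace : HP :=
  .seq HP.diff (.seq (.set 7 HE.predLevel) (.seq HP.insert (.set 8 (.const 1))))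

theorem HRuns.diff : ∃ c, ∀ (n : ℕ) (s : HState) (G : Subgroup (Equiv.Perm ℕ)) (E : Table)
    (P : Labels) (i j j' : ℕ) (f f' : Equiv.Perm ℕ), s.r 0 = n → s.r 11 = i + 1 → s.r 10 = j →
    s.r 9 = j' → 1 ≤ i → Inv n G E P → Rel n s.a E P → E (i + 1) j = some f →
    E (i + 1) j' = some f' →
    ∃ s' t, HRuns n HP.diff s s' t ∧ Keep 7 s s' ∧ Rel n s'.a (E.put (i + 1) j' none) P ∧
      Hand n s'.a (P.diff i j j' f f') ∧ t ≤ c * n := by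
  obtain ⟨d, hd⟩ : ∃ d, d = HP.assignCost 3 (.const 1) (.const 1)
      (.arr 0 .predLevel (.reg 10) (.arr 1 (.reg 11) (.reg 10) (.reg 1))) (.reg 1) := ⟨_, rfl⟩
  obtain ⟨d', hd'⟩ : ∃ d, d = HP.assignCost 2 (.const 1) (.const 1) (.reg 1)
    (.row 3 (.arr 0 .predLevel (.reg 9) (.arr 1 (.reg 11) (.reg 9) (.reg 1)))) := ⟨_, rfl⟩
  obtain ⟨d'', hd''⟩ : ∃ d, d = (addrExpr 1 (HE.reg 11).comp (HE.reg 9).comp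
    (HE.reg 11).comp).cost + (HE.const 0).comp.cost + 1 := ⟨_, rfl⟩
  refine ⟨d + d' + d'', ?_⟩
  intro n s G E P i j j' f f' h0 h11 h10 h9 hi hinv hrel hf hf'
  obtain ⟨hj1, hj2, hin, hfi, hfj⟩ := hinv.wf _ _ _ hf
  obtain ⟨hj1', hj2', -, hfi', hfj'⟩ := hinv.wf _ _ _ hf'
  have hiI : i ∈ Set.Icc 1 n := ⟨hi, by omega⟩
  have hiI' : i + 1 ∈ Set.Icc 1 n := ⟨by omega, hin⟩
  have hjI : j ∈ Set.Icc 1 n := ⟨hj1, by omega⟩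
  have hjI' : j' ∈ Set.Icc 1 n := ⟨hj1', by omega⟩
  have hn : 1 ≤ n := hjI.1.trans hjI.2
  have h1I : 1 ∈ Set.Icc 1 n := ⟨le_rfl, hn⟩
  have hPj : P i j ∈ perms n := perms_mono hiI.2 (gen_le_permsSub _ _ (hinv.lab i hiI j hjI))
  have hPj' : P i j' ∈ perms n := perms_mono hiI.2 (gen_le_permsSub _ _ (hinv.lab i hiI j' hjI'))
  have hfn := perms_mono hin hfi
  have hfn' := perms_mono hin hfi'
  have hA : P i j * f ∈ perms n := (permsSub n).mul_mem hPj hfn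
  obtain ⟨s₁, t₁, hr₁, hk₁, hs₁, hq₁, ht₁⟩ := HRuns.assign (n := n) (s := s) (c := 3)
    (k := .const 1) (j := .const 1)
    (e₁ := .arr 0 .predLevel (.reg 10) (.arr 1 (.reg 11) (.reg 10) (.reg 1)))
    (e₂ := .reg 1) (kv := 1) (jv := 1) (by omega) hn h0 h1I h1I
    (fun w => (P i j * f) w) id (fun w hw => perms_apply_mem hA le_rfl hw)
    (fun w hw => hw.2) (fun w _ w' _ h => (P i j * f).injective h) (by
      intro s₁ w hw hk h1 ha
      have e0 : s₁.r 0 = n := by rw [hk.1 0 (by omega), h0]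
      have e10 : s₁.r 10 = j := by rw [hk.1 10 (by omega), h10]
      have e11 : s₁.r 11 = i + 1 := by rw [hk.1 11 (by omega), h11]
      have ea : ∀ c' ≠ 3, ∀ k' j' x', s₁.a c' k' j' x' = s.a c' k' j' x' :=
        fun c' hc' k' j' x' => ha c' k' j' x' fun h => absurd h hc'
      have eb : HE.predLevel.eval s₁ = i := by simp only [HE.predLevel, HE.eval, e11]; omega
      have okb : HE.predLevel.Ok n s₁ := ⟨HE.ok_reg (by omega), trivial⟩
      have ew : (HE.arr 1 (.reg 11) (.reg 10) (.reg 1)).eval s₁ = f w := by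
        simp only [HE.eval, e11, e10, h1]
        rw [ea 1 (by omega), hrel.some _ hiI' _ hjI _ hf _ hw]
      have hfw := perms_apply_mem hfn le_rfl hw
      refine ⟨⟨trivial, rfl⟩, ⟨trivial, rfl⟩, ⟨?_, ?_⟩, HE.ok_reg (by omega), h1⟩
      · exact HE.ok_arr e0 (by omega) okb (by rw [eb]; exact hiI)
          (HE.ok_reg (by omega)) (by rw [HE.eval, e10]; exact hjI)
          (HE.ok_arr e0 (by omega) (HE.ok_reg (by omega)) (by rw [HE.eval, e11]; exact hiI')
            (HE.ok_reg (by omega)) (by rw [HE.eval, e10]; exact hjI)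
            (HE.ok_reg (by omega)) (by rw [HE.eval, h1]; exact hw)) (by rw [ew]; exact hfw)
      · rw [HE.eval, ew, eb, HE.eval, e10, ea 0 (by omega), hrel.lab _ hiI _ hjI _ hfw]; rfl)
  have hs₁' : ∀ c' ≠ 3, ∀ k' j' x', s₁.a c' k' j' x' = s.a c' k' j' x' :=
    fun c' hc' k' j' x' => hs₁ c' k' j' x' fun h => absurd h hc'
  -- Each w has been written into the cell of its image, which tabulates the inverse.
  have hq₁' : ∀ u ∈ Set.Icc 1 n, s₁.a 3 1 1 u = (P i j * f)⁻¹ u := by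
    intro u hu
    have := hq₁ _ (perm_inv_mem hA hu)
    rw [show (P i j * f) ((P i j * f)⁻¹ u) = u from Equiv.apply_symm_apply _ u] at this
    rw [this]; rfl
  have f0 : s₁.r 0 = n := by rw [hk₁.1 0 (by omega), h0]
  have f9 : s₁.r 9 = j' := by rw [hk₁.1 9 (by omega), h9]
  have f11 : s₁.r 11 = i + 1 := by rw [hk₁.1 11 (by omega), h11]
  obtain ⟨s₂, t₂, hr₂, hk₂, hs₂, hq₂, ht₂⟩ := HRuns.assign (n := n) (s := s₁) (c := 2)
    (k := .const 1) (j := .const 1) (e₁ := .reg 1)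
    (e₂ := .row 3 (.arr 0 .predLevel (.reg 9) (.arr 1 (.reg 11) (.reg 9) (.reg 1))))
    (kv := 1) (jv := 1) (by omega) hn f0 h1I h1I
    id (fun w => (P i j * f)⁻¹ (P i j' (f' w))) (fun w hw => hw)
    (fun w hw => (perm_inv_mem hA (perms_apply_mem hPj' le_rfl (perms_apply_mem hfn' le_rfl hw))).2)
    (fun w _ w' _ h => h) (by
      intro s₂ w hw hk h1 ha
      have e0 : s₂.r 0 = n := by rw [hk.1 0 (by omega), f0]
      have e9 : s₂.r 9 = j' := by rw [hk.1 9 (by omega), f9]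
      have e11 : s₂.r 11 = i + 1 := by rw [hk.1 11 (by omega), f11]
      have ea : ∀ c' ≠ 2, ∀ k' j' x', s₂.a c' k' j' x' = s₁.a c' k' j' x' :=
        fun c' hc' k' j' x' => ha c' k' j' x' fun h => absurd h hc'
      have eb : HE.predLevel.eval s₂ = i := by simp only [HE.predLevel, HE.eval, e11]; omega
      have okb : HE.predLevel.Ok n s₂ := ⟨HE.ok_reg (by omega), trivial⟩
      have ew : (HE.arr 1 (.reg 11) (.reg 9) (.reg 1)).eval s₂ = f' w := by
        simp only [HE.eval, e11, e9, h1]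
        rw [ea 1 (by omega), hs₁' 1 (by omega), hrel.some _ hiI' _ hjI' _ hf' _ hw]
      have hfw := perms_apply_mem hfn' le_rfl hw
      have ew' : (HE.arr 0 .predLevel (.reg 9) (.arr 1 (.reg 11) (.reg 9) (.reg 1))).eval s₂ =
          P i j' (f' w) := by
        rw [HE.eval, ew, eb, HE.eval, e9, ea 0 (by omega), hs₁' 0 (by omega),
          hrel.lab _ hiI _ hjI' _ hfw]
      have hPw := perms_apply_mem hPj' le_rfl hfw
      refine ⟨⟨trivial, rfl⟩, ⟨trivial, rfl⟩, ⟨HE.ok_reg (by omega), h1⟩, ?_, ?_⟩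
      · exact HE.ok_row e0 (by omega) hn (HE.ok_arr e0 (by omega) okb (by rw [eb]; exact hiI)
          (HE.ok_reg (by omega)) (by rw [HE.eval, e9]; exact hjI')
          (HE.ok_arr e0 (by omega) (HE.ok_reg (by omega)) (by rw [HE.eval, e11]; exact hiI')
            (HE.ok_reg (by omega)) (by rw [HE.eval, e9]; exact hjI')
            (HE.ok_reg (by omega)) (by rw [HE.eval, h1]; exact hw)) (by rw [ew]; exact hfw))
          (by rw [ew']; exact hPw)
      · rw [HE.row, HE.eval, ew']
        simp only [HE.eval]
        rw [ea 3 (by omega), hq₁' _ hPw])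
  have hs₂' : ∀ c' ≠ 2, c' ≠ 3 → ∀ k' j' x', s₂.a c' k' j' x' = s.a c' k' j' x' :=
    fun c' hc' hc'' k' j' x' => by
      rw [hs₂ c' k' j' x' fun h => absurd h hc', hs₁' c' hc'']
  have g0 : s₂.r 0 = n := by rw [hk₂.1 0 (by omega), f0]
  have g9 : s₂.r 9 = j' := by rw [hk₂.1 9 (by omega), f9]
  have g11 : s₂.r 11 = i + 1 := by rw [hk₂.1 11 (by omega), f11]
  have hseta := HRuns.seta (n := n) (c := 1) (k := .reg 11) (j := .reg 9) (x := .reg 11)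
    (e := .const 0) (s := s₂) (HE.ok_arr g0 (by omega) (HE.ok_reg (by omega))
      (by rw [HE.eval, g11]; exact hiI') (HE.ok_reg (by omega)) (by rw [HE.eval, g9]; exact hjI')
      (HE.ok_reg (by omega)) (by rw [HE.eval, g11]; exact hiI')) trivial (by simp [HE.eval])
  rw [← hd''] at hseta
  simp only [HE.eval, g11, g9] at hseta
  refine ⟨_, _, .seq hr₁ (.seq hr₂ hseta), ?_, ?_, ?_, ?_⟩
  · exact ((hk₁.trans hk₂).mono (by omega)).trans ⟨fun _ _ => rfl, rfl⟩
  · refine ⟨fun k hk v hv x hx => ?_, fun a ha b hb g hg x hx => ?_, fun a ha b hb hg => ?_⟩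
    · simp only [HState.setA]
      rw [if_neg (by omega), hs₂' 0 (by omega) (by omega), hrel.lab k hk v hv x hx]
    · unfold Table.put at hg
      split_ifs at hg with hab
      simp only [HState.setA]
      rw [if_neg (by tauto), hs₂' 1 (by omega) (by omega), hrel.some a ha b hb g hg x hx]
    · unfold Table.put at hg
      simp only [HState.setA]
      split_ifs at hg with hab
      · rw [if_pos ⟨trivial, hab.1, hab.2, hab.1⟩]
      · rw [if_neg (by tauto), hs₂' 1 (by omega) (by omega), hrel.none a ha b hb hg]
  · intro x hx
    simp only [HState.setA]
    rw [if_neg (by omega), show x = id x from rfl, hq₂ x hx]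
    rfl
  · rw [← hd] at ht₁
    rw [← hd'] at ht₂
    have : d'' ≤ d'' * n := Nat.le_mul_of_pos_right _ hn
    have e : (d + d' + d'') * n = d * n + d' * n + d'' * n := by ring
    omega

/-- The data `E`, `P` in the arrays `a` that have evolved from `E₀`, `P₀`. -/
structure Evolved (n : ℕ) (G : Subgroup (Equiv.Perm ℕ)) (E₀ : Table) (P₀ : Labels)
    (a : ℕ → ℕ → ℕ → ℕ → ℕ) (E : Table) (P : Labels) : Prop where
  inv : Inv n G E P
  rel : Rel n a E P
  gen_le : ∀ k, gen E₀ k ≤ gen E k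
  count : CountLe n E₀ P₀ E P

theorem Evolved.trans {n : ℕ} {G : Subgroup (Equiv.Perm ℕ)} {E₀ E E' : Table}
    {P₀ P P' : Labels} {a a' : ℕ → ℕ → ℕ → ℕ → ℕ} (h : Evolved n G E₀ P₀ a E P)
    (h' : Evolved n G E P a' E' P') : Evolved n G E₀ P₀ a' E' P' :=
  ⟨h'.inv, h'.rel, fun k => (h.gen_le k).trans (h'.gen_le k), h.count.trans h'.count⟩

/-- Removing an entry lowers `pot` by 2. One w covers the quotient and its insertion; the other is
left over for the caller, to pay for another pass. -/
theorem HRuns.replace : ∃ c, ∀ (n w : ℕ) (s : HState) (G : Subgroup (Equiv.Perm ℕ)) (E : Table)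
    (P : Labels) (i j j' : ℕ) (f f' : Equiv.Perm ℕ), c * n ^ 2 ≤ w → s.r 0 = n →
    s.r 11 = i + 1 → s.r 10 = j →
    s.r 9 = j' → 1 ≤ i → Inv n G E P → Rel n s.a E P → E (i + 1) j = some f →
    E (i + 1) j' = some f' → j ≠ j' → P.root i j = P.root i j' →
    ∃ s' t E' P', HRuns n HP.replace s s' t ∧ Keep 9 s s' ∧ s'.r 8 = 1 ∧
      Evolved n G E P s'.a E' P' ∧ t + w * pot n E' P' + w ≤ w * pot n E P := by
  obtain ⟨c₁, hc₁⟩ := HRuns.diff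
  obtain ⟨c₂, hc₂⟩ := HRuns.insert
  obtain ⟨d, hd⟩ : ∃ d, d = HE.predLevel.comp.cost + 2 := ⟨_, rfl⟩
  obtain ⟨d', hd'⟩ : ∃ d, d = (HE.const 1).comp.cost + 2 := ⟨_, rfl⟩
  refine ⟨c₁ + c₂ + d + d', ?_⟩
  intro n w s G E P i j j' f f' hw h0 h11 h10 h9 hi hinv hrel hf hf' hne hroot
  have hin := (hinv.wf _ _ _ hf).2.2.1
  have hj' : j' ∈ Set.Icc 1 n := ⟨(hinv.wf _ _ _ hf').1, by have := (hinv.wf _ _ _ hf').2.1; omega⟩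
  obtain ⟨s₁, t₁, hr₁, hk₁, hrel₁, hhand₁, ht₁⟩ :=
    hc₁ n s G E P i j j' f f' h0 h11 h10 h9 hi hinv hrel hf hf'
  obtain ⟨hsift, hrec⟩ := hinv.remove hi hf hf' hne hroot
  have e11 : s₁.r 11 = i + 1 := by rw [hk₁.1 11 (by omega), h11]
  have eb : HE.predLevel.eval s₁ = i := by simp only [HE.predLevel, HE.eval, e11]; omega
  have hset := HRuns.set (n := n) (r := 7) (e := HE.predLevel) (s := s₁) (by omega)
    ⟨HE.ok_reg (by omega), trivial⟩ (by rw [eb]; omega)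
  rw [eb, ← hd] at hset
  have hk₂ : Keep 8 s₁ (s₁.setR 7 i) := (Keep.refl _ s₁).setR (by omega) (by omega) _
  obtain ⟨s₃, t₃, E', P', hr₃, hk₃, hins, hrel₃, hcount, ht₃⟩ := hc₂ n w (s₁.setR 7 i) G
    (E.put (i + 1) j' none) P _ i (by omega) (le_trans (Nat.mul_le_mul_right _ (by omega)) hw)
    (by rw [hk₂.1 0 (by omega), hk₁.1 0 (by omega), h0]) (by simp) (by omega) hsift hrel₁ hhand₁
  have hcard := ent_put_none ⟨by omega, hin⟩ hj' hf'
  have hset' := HRuns.set (n := n) (r := 8) (e := .const 1) (s := s₃) (by omega) trivial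
    (by simp only [HE.eval]; omega)
  rw [← hd'] at hset'
  refine ⟨_, _, E', P', .seq hr₁ (.seq hset (.seq hr₃ hset')), ?_, by simp [HE.eval],
    ⟨hins.toInv, hrel₃, hrec E' hins.inc hins.start_mem, ?_⟩, ?_⟩
  · exact (hk₁.mono (by omega)).trans ((hk₂.mono (by omega)).trans
      ((hk₃.mono (by omega)).setR (by omega) (by omega) _))
  · exact ⟨hcount.1, hcount.2.trans (by omega)⟩
  · have hpot : pot n (E.put (i + 1) j' none) P + 2 = pot n E P := by unfold pot; omega
    rw [← hpot, mul_add]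
    have hsq : n ≤ n ^ 2 := Nat.le_self_pow (by omega) n
    have h1 := Nat.mul_le_mul_left c₁ hsq
    have h2 : d + d' ≤ (d + d') * n ^ 2 := Nat.le_mul_of_pos_right _ (Nat.pow_pos (by omega))
    have h3 : (c₁ + c₂ + d + d') * n ^ 2 = c₁ * n ^ 2 + c₂ * n ^ 2 + (d + d') * n ^ 2 := by ring
    omega

/-! ### Passes over all pairs of entries -/

/-- A rule for upward loops whose bodies keep the registers from the loop counter on, with an
invariant that may depend on the register `8`. -/
theorem HRuns.for_flag {n : ℕ} {r : ℕ} {p : HP} (hr : r < 16) (hr8 : 9 ≤ r) (e : HE) (c x₀ : ℕ)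
    (I : ℕ → ℕ → (ℕ → ℕ → ℕ → ℕ → ℕ) → ℕ → Prop) (s : HState) (φ : ℕ) (h0 : s.r 0 = n)
    (he : e.Ok n s) (hx₀ : e.eval s = x₀) (hen : x₀ ≤ n + 1) (hI : I x₀ φ s.a (s.r 8))
    (hbody : ∀ x φ s₁, x₀ ≤ x → x ≤ n → s₁.r r = x → Keep (r + 1) s s₁ → I x φ s₁.a (s₁.r 8) →
      ∃ s' t φ', HRuns n p s₁ s' t ∧ Keep r s₁ s' ∧ I (x + 1) φ' s'.a (s'.r 8) ∧
        t + φ' ≤ c + φ) :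
    ∃ s' t φ', HRuns n (HP.for r e p) s s' t ∧ Keep (r + 1) s s' ∧ I (n + 1) φ' s'.a (s'.r 8) ∧
      t + φ' ≤ (n + 1 - x₀) * (c + 14) + (e.comp.cost + 10) + φ := by
  obtain ⟨s', t, φ', h1, -, h2, h3⟩ := HRuns.for_loop hr (by omega) e c x₀
    (fun x φ s₁ => Keep (r + 1) s s₁ ∧ I x φ s₁.a (s₁.r 8)) s φ h0 he hx₀ hen
    ⟨(Keep.refl _ s).setR (by omega) (by omega) _, by
      rw [HState.setR_r_of_ne _ _ (by omega)]; exact hI⟩ (by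
      rintro x φ s₁ hx hxn hsr hs0 ⟨hk, hI⟩
      obtain ⟨s', t, φ', h1, h2, h3, h4⟩ := hbody x φ s₁ hx hxn hsr hk hI
      exact ⟨s', t, φ', h1, by rw [h2.1 r (by omega), hsr], by rw [h2.1 0 (by omega), hs0],
        ⟨(hk.trans (h2.mono (by omega))).setR (by omega) (by omega) _, by
          rw [HState.setR_r_of_ne _ _ (by omega)]; exact h3⟩, h4⟩)
  exact ⟨s', t, φ', h1, h2.1, h2.2, h3⟩

open HE in
/-- The test whether two entries of a row are redundant. -/
def HE.redundant : HE :=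
  .mul (.mul (arr 1 (reg 11) (reg 10) (reg 11)) (arr 1 (reg 11) (reg 9) (reg 11)))
    (HE.eq (arr 0 predLevel (reg 10) (reg 10)) (arr 0 predLevel (reg 9) (reg 9)))

open HE in
/-- The program that examines all pairs of entries once; the register `8` indicates whether an
entry has been replaced. -/
def HP.pass : HP :=
  .seq (.set 8 (const 0)) (HP.for 11 (const 2) (HP.for 10 (const 1)
    (HP.for 9 (.add (reg 10) (const 1)) (.cond redundant HP.replace .skip))))

/-- The program that replaces redundant entries as long as there are any. -/
def HP.clean : HP := .seq (.set 8 (.const 1)) (.loop (.reg 8) HP.pass)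

/-- Two entries of the row `i` are redundant. -/
def Redundant (E : Table) (P : Labels) (i j j' : ℕ) : Prop :=
  (E i j).isSome ∧ (E i j').isSome ∧ P.root (i - 1) j = P.root (i - 1) j'

theorem Rel.entry_ne_zero {n : ℕ} {a : ℕ → ℕ → ℕ → ℕ → ℕ} {E : Table} {P : Labels}
    (h : Rel n a E P) (hc : Core n E P) {i j : ℕ} (hi : i ∈ Set.Icc 1 n) (hj : j ∈ Set.Icc 1 n) :
    a 1 i j i ≠ 0 ↔ (E i j).isSome := by
  cases he : E i j with
  | none => simp [h.none i hi j hj he]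
  | some s =>
    rw [h.some i hi j hj s he i hi, (hc.wf i j s he).2.2.2.2]
    have := hj.1
    simp only [Option.isSome_some, iff_true]; omega

/-- The invariant of a pass: `Q` holds for the initial data if nothing has been replaced. -/
def PassInv (n w : ℕ) (G : Subgroup (Equiv.Perm ℕ)) (E₀ : Table) (P₀ : Labels) (Q : Prop)
    (φ : ℕ) (a : ℕ → ℕ → ℕ → ℕ → ℕ) (flag : ℕ) : Prop :=
  ∃ E P, Evolved n G E₀ P₀ a E P ∧ φ = w * pot n E P + (if flag = 0 then 0 else w) ∧
    (flag = 0 → E = E₀ ∧ P = P₀ ∧ Q)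

theorem PassInv.imp {n w : ℕ} {G : Subgroup (Equiv.Perm ℕ)} {E₀ : Table} {P₀ : Labels}
    {Q Q' : Prop} {φ : ℕ} {a : ℕ → ℕ → ℕ → ℕ → ℕ} {flag : ℕ}
    (h : PassInv n w G E₀ P₀ Q φ a flag) (hQ : Q → Q') : PassInv n w G E₀ P₀ Q' φ a flag := by
  obtain ⟨E, P, h1, h2, h3⟩ := h
  exact ⟨E, P, h1, h2, fun h => ⟨(h3 h).1, (h3 h).2.1, hQ (h3 h).2.2⟩⟩

/-- The w released by a replacement is reserved in the potential as long as the flag is set; a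
reserve from an earlier replacement in the same pass is simply dropped. -/
theorem HRuns.pass_step : ∃ c, ∀ (n w : ℕ) (s : HState) (G : Subgroup (Equiv.Perm ℕ)) (E₀ : Table)
    (P₀ : Labels) (Q : Prop) (φ i j j' : ℕ), c * n ^ 2 ≤ w → s.r 0 = n → s.r 11 = i →
    s.r 10 = j → s.r 9 = j' → 2 ≤ i → i ≤ n → 1 ≤ j → j < j' → j' ≤ n →
    PassInv n w G E₀ P₀ Q φ s.a (s.r 8) →
    ∃ s' t φ', HRuns n (.cond HE.redundant HP.replace .skip) s s' t ∧ Keep 9 s s' ∧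
      PassInv n w G E₀ P₀ (Q ∧ ¬ Redundant E₀ P₀ i j j') φ' s'.a (s'.r 8) ∧ t + φ' ≤ c + φ := by
  obtain ⟨c, hc⟩ := HRuns.replace
  obtain ⟨d, hd⟩ : ∃ d, d = HE.redundant.comp.cost + 1 := ⟨_, rfl⟩
  refine ⟨c + d + 1, ?_⟩
  rintro n w s G E₀ P₀ Q φ i j j' hw h0 h11 h10 h9 hi hin hj hjj hjn ⟨E, P, hev, rfl, hQ⟩
  have hiI : i ∈ Set.Icc 1 n := ⟨by omega, hin⟩
  have hiI' : i - 1 ∈ Set.Icc 1 n := ⟨by omega, by omega⟩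
  have hjI : j ∈ Set.Icc 1 n := ⟨hj, by omega⟩
  have hjI' : j' ∈ Set.Icc 1 n := ⟨by omega, hjn⟩
  have eb : HE.predLevel.eval s = i - 1 := by simp only [HE.predLevel, HE.eval, h11]
  have okb : HE.predLevel.Ok n s := ⟨HE.ok_reg (by omega), trivial⟩
  have o11 : (HE.reg 11).Ok n s := HE.ok_reg (by omega)
  have o10 : (HE.reg 10).Ok n s := HE.ok_reg (by omega)
  have o9 : (HE.reg 9).Ok n s := HE.ok_reg (by omega)
  have e11 : (HE.reg 11).eval s ∈ Set.Icc 1 n := by rw [HE.eval, h11]; exact hiI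
  have e10 : (HE.reg 10).eval s ∈ Set.Icc 1 n := by rw [HE.eval, h10]; exact hjI
  have e9 : (HE.reg 9).eval s ∈ Set.Icc 1 n := by rw [HE.eval, h9]; exact hjI'
  have ebI : HE.predLevel.eval s ∈ Set.Icc 1 n := by rw [eb]; exact hiI'
  have hok : HE.redundant.Ok n s :=
    ⟨⟨HE.ok_arr h0 (by omega) o11 e11 o10 e10 o11 e11,
      HE.ok_arr h0 (by omega) o11 e11 o9 e9 o11 e11⟩,
      HE.ok_eq (HE.ok_arr h0 (by omega) okb ebI o10 e10 o10 e10)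
        (HE.ok_arr h0 (by omega) okb ebI o9 e9 o9 e9)⟩
  have hval : HE.redundant.eval s ≠ 0 ↔ Redundant E P i j j' := by
    rw [HE.redundant, HE.eval, mul_ne_zero_iff, HE.eval_eq]
    simp only [HE.eval, mul_ne_zero_iff, eb, h11, h10, h9]
    rw [hev.rel.entry_ne_zero hev.inv.toCore hiI hjI,
      hev.rel.entry_ne_zero hev.inv.toCore hiI hjI', hev.rel.lab _ hiI' _ hjI _ hjI,
      hev.rel.lab _ hiI' _ hjI' _ hjI', and_assoc]
    rfl
  by_cases hred : Redundant E P i j j'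
  · obtain ⟨h1, h2, h3⟩ := id hred
    obtain ⟨f, hf⟩ := Option.isSome_iff_exists.1 h1
    obtain ⟨f', hf'⟩ := Option.isSome_iff_exists.1 h2
    have hi1 : i - 1 + 1 = i := by omega
    obtain ⟨s', t, E', P', hr, hk, h8, hev', ht⟩ := hc n w s G E P (i - 1) j j' f f'
      (le_trans (Nat.mul_le_mul_right _ (by omega)) hw) h0 (by omega) h10 h9 hiI'.1 hev.inv hev.rel
      (by rw [hi1, hf]) (by rw [hi1, hf']) (by omega) h3
    refine ⟨s', _, _, .condTrue hok (hval.2 hred) hr, hk, ⟨E', P', hev.trans hev', rfl, ?_⟩, ?_⟩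
    · intro h; omega
    · rw [← hd, h8, if_neg (by omega)]; omega
  · refine ⟨s, _, _, .condFalse hok (not_not.1 (mt hval.1 hred)) (.skip _), Keep.refl _ _,
      ⟨E, P, hev, rfl, fun h => ?_⟩, ?_⟩
    · obtain ⟨rfl, rfl, hQ'⟩ := hQ h
      exact ⟨rfl, rfl, hQ', hred⟩
    · rw [← hd]; omega

/-- If the flag is still 0 at the end, the data never changed during the pass, so the negative tests
all refer to the same table and show irredundancy. -/
theorem HRuns.pass : ∃ c, ∀ (n w : ℕ) (s : HState) (G : Subgroup (Equiv.Perm ℕ)) (E : Table)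
    (P : Labels), 1 ≤ n → c * n ^ 2 ≤ w → s.r 0 = n → Inv n G E P → Rel n s.a E P →
    ∃ s' t φ', HRuns n HP.pass s s' t ∧ Keep 12 s s' ∧
      PassInv n w G E P (Irredundant n E P) φ' s'.a (s'.r 8) ∧
      t + φ' ≤ c * n ^ 3 + w * pot n E P := by
  obtain ⟨c, hc⟩ := HRuns.pass_step
  refine ⟨c + 100, ?_⟩
  intro n w s G E P hn hw h0 hinv hrel
  have hset := HRuns.set (n := n) (r := 8) (e := .const 0) (s := s) (by omega) trivial
    (by simp [HE.eval])
  have hk₀ : Keep 12 s (s.setR 8 0) := (Keep.refl _ s).setR (by omega) (by omega) _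
  have g0 : (s.setR 8 0).r 0 = n := by rw [hk₀.1 0 (by omega), h0]
  obtain ⟨s', t, φ', hr, hk, hI, ht⟩ := HRuns.for_flag (n := n) (r := 11)
    (p := HP.for 10 (.const 1) (HP.for 9 (.add (.reg 10) (.const 1))
      (.cond HE.redundant HP.replace .skip))) (by omega) (by omega) (.const 2)
    (n * (n * (c + 14) + 14 + 14) + 11) 2
    (fun i φ a flag => PassInv n w G E P
      (∀ i', 2 ≤ i' → i' < i → ∀ j, 1 ≤ j → ∀ j', j < j' → j' ≤ n → ¬ Redundant E P i' j j') φ a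
        flag) (s.setR 8 0)
    (w * pot n E P) g0 trivial rfl (by omega)
    ⟨E, P, ⟨hinv, hrel, fun _ => le_rfl, .refl _ _ _⟩, by simp, fun _ => ⟨rfl, rfl, by omega⟩⟩ (by
      intro i φ s₁ hi hin e11 hk₁ hI
      obtain ⟨s', t, φ', hr, hk, hI, ht⟩ := HRuns.for_flag (n := n) (r := 10)
        (p := HP.for 9 (.add (.reg 10) (.const 1)) (.cond HE.redundant HP.replace .skip))
        (by omega) (by omega) (.const 1) (n * (c + 14) + 14) 1
        (fun j φ a flag => PassInv n w G E P
          ((∀ i', 2 ≤ i' → i' < i → ∀ j, 1 ≤ j → ∀ j', j < j' → j' ≤ n →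
            ¬ Redundant E P i' j j') ∧
          ∀ j₁, 1 ≤ j₁ → j₁ < j → ∀ j', j₁ < j' → j' ≤ n → ¬ Redundant E P i j₁ j') φ a flag) s₁ φ
        (by rw [hk₁.1 0 (by omega), g0]) trivial rfl (by omega)
        (hI.imp fun h => ⟨h, by omega⟩) (by
          intro j φ s₂ hj hjn e10 hk₂ hI
          have f0 : s₂.r 0 = n := by rw [hk₂.1 0 (by omega), hk₁.1 0 (by omega), g0]
          have f11 : s₂.r 11 = i := by rw [hk₂.1 11 (by omega), e11]
          obtain ⟨s', t, φ', hr, hk, hI, ht⟩ := HRuns.for_flag (n := n) (r := 9)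
            (p := .cond HE.redundant HP.replace .skip)
            (by omega) (by omega) (.add (.reg 10) (.const 1)) c (j + 1)
            (fun j₀ φ a flag => PassInv n w G E P
              (((∀ i', 2 ≤ i' → i' < i → ∀ j, 1 ≤ j → ∀ j', j < j' → j' ≤ n →
                ¬ Redundant E P i' j j') ∧
              ∀ j₁, 1 ≤ j₁ → j₁ < j → ∀ j', j₁ < j' → j' ≤ n → ¬ Redundant E P i j₁ j') ∧
              ∀ j', j < j' → j' < j₀ → ¬ Redundant E P i j j') φ a flag) s₂ φ
            f0 ⟨HE.ok_reg (by omega), trivial⟩ (by simp only [HE.eval, e10]) (by omega)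
            (hI.imp fun h => ⟨h, by omega⟩) (by
              intro j' φ s₃ hj' hjn' e9 hk₃ hI
              obtain ⟨s', t, φ', hr, hk, hI, ht⟩ := hc n w s₃ G E P _ φ i j j'
                (le_trans (Nat.mul_le_mul_right _ (by omega)) hw) (by rw [hk₃.1 0 (by omega), f0])
                (by rw [hk₃.1 11 (by omega), f11]) (by rw [hk₃.1 10 (by omega), e10]) e9 hi hin hj
                (by omega) hjn' hI
              refine ⟨s', t, φ', hr, hk, hI.imp ?_, ht⟩
              rintro ⟨⟨h1, h2⟩, h3⟩
              refine ⟨h1, fun j₁ hj₁ hlt => ?_⟩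
              by_cases hlt' : j₁ < j'
              · exact h2 j₁ hj₁ hlt'
              · obtain rfl : j₁ = j' := by omega
                exact h3)
          refine ⟨s', t, φ', hr, hk, hI.imp ?_, ?_⟩
          · rintro ⟨⟨h1, h2⟩, h3⟩
            refine ⟨h1, fun j₁ hj₁ hlt => ?_⟩
            by_cases hlt' : j₁ < j
            · exact h2 j₁ hj₁ hlt'
            · obtain rfl : j₁ = j := by omega
              exact fun j' h h' => h3 j' h (by omega)
          · have e : (HE.add (.reg 10) (.const 1)).comp.cost = 4 := rfl
            rw [e] at ht
            have : (n + 1 - (j + 1)) * (c + 14) ≤ n * (c + 14) :=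
              Nat.mul_le_mul_right _ (by omega)
            omega)
      refine ⟨s', t, φ', hr, hk, hI.imp ?_, ?_⟩
      · rintro ⟨h1, h2⟩ i' hi' hlt
        by_cases hlt' : i' < i
        · exact h1 i' hi' hlt'
        · obtain rfl : i' = i := by omega
          exact fun j hj j' h h' => h2 j hj (by omega) j' h h'
      · have e : (HE.const 1).comp.cost = 1 := rfl
        rw [e, Nat.add_sub_cancel] at ht
        omega)
  refine ⟨s', _, φ', .seq hset hr, hk₀.trans hk, hI.imp ?_, ?_⟩
  · intro h i hi hin j hj j' hj' h1 h2 h3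
    by_contra hne
    rcases lt_or_gt_of_ne hne with hlt | hlt
    · exact h (i + 1) (by omega) (by omega) j hj.1 j' hlt hj'.2 ⟨h1, h2, h3⟩
    · exact h (i + 1) (by omega) (by omega) j' hj'.1 j hlt hj.2 ⟨h2, h1, h3.symm⟩
  · have e : (HE.const 2).comp.cost = 1 := rfl
    have e' : (HE.const 0).comp.cost = 1 := rfl
    rw [e] at ht
    rw [e']
    have h1 : (n + 1 - 2) * (n * (n * (c + 14) + 14 + 14) + 11 + 14) ≤
        n * (n * (n * (c + 14) + 14 + 14) + 11 + 14) := Nat.mul_le_mul_right _ (by omega)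
    have h2 : n ≤ n ^ 3 := Nat.le_self_pow (by omega) n
    have h3 : n ^ 2 ≤ n ^ 3 := Nat.pow_le_pow_right hn (by omega)
    nlinarith

/-- A pass takes O(n³) ≤ w steps besides its replacements. If it has replaced something, the
reserved w pays for it; only the last pass has to be paid for separately. -/
theorem HRuns.clean : ∃ c, ∀ (n w : ℕ) (s : HState) (G : Subgroup (Equiv.Perm ℕ)) (E : Table)
    (P : Labels), 1 ≤ n → c * n ^ 3 ≤ w → s.r 0 = n → Inv n G E P → Rel n s.a E P →
    ∃ s' t E' P', HRuns n HP.clean s s' t ∧ Keep 12 s s' ∧ Evolved n G E P s'.a E' P' ∧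
      Irredundant n E' P' ∧ t + w * pot n E' P' ≤ c * n ^ 3 + w * pot n E P := by
  obtain ⟨c, hc⟩ := HRuns.pass
  refine ⟨c + 100, ?_⟩
  intro n w s G E P hn hw h0 hinv hrel
  have h13 : 1 ≤ n ^ 3 := Nat.one_le_pow _ _ hn
  have key : ∀ m (s : HState) E P, pot n E P = m → s.r 0 = n → s.r 8 ≠ 0 → Inv n G E P →
      Rel n s.a E P →
      ∃ s' t E' P', HRuns n (.loop (.reg 8) HP.pass) s s' t ∧ Keep 12 s s' ∧
        Evolved n G E P s'.a E' P' ∧ Irredundant n E' P' ∧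
        t + w * pot n E' P' ≤ c * n ^ 3 + 10 + w * pot n E P := by
    intro m
    induction m using Nat.strong_induction_on with
    | _ m ih =>
      intro s E P hm h0 h8 hinv hrel
      obtain ⟨s₁, t₁, φ₁, hr₁, hk₁, ⟨E₁, P₁, hev, rfl, hQ⟩, ht₁⟩ := hc n w s G E P hn (by
        refine le_trans ?_ hw
        exact Nat.mul_le_mul (by omega) (Nat.pow_le_pow_right hn (by omega))) h0 hinv hrel
      by_cases h8' : s₁.r 8 = 0
      · rw [h8'] at ht₁
        obtain ⟨rfl, rfl, hirr⟩ := hQ h8'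
        refine ⟨s₁, _, E₁, P₁, .loopTrue (HE.ok_reg (by omega)) h8 hr₁
          (.loopFalse (HE.ok_reg (by omega)) h8'), hk₁, hev, hirr, ?_⟩
        simp only [HE.comp, Expr.cost]
        rw [if_pos rfl] at ht₁
        omega
      · rw [if_neg h8'] at ht₁
        have h9 : t₁ + 3 + w * pot n E₁ P₁ ≤ w * pot n E P := by nlinarith
        -- The accounting also proves termination: a pass that sets the flag strictly lowers `pot`.
        have h10 : pot n E₁ P₁ < pot n E P := by
          by_contra hcon
          have := Nat.mul_le_mul_left w (not_lt.1 hcon)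
          omega
        obtain ⟨s₂, t₂, E₂, P₂, hr₂, hk₂, hev₂, hirr, ht₂⟩ := ih _ (hm ▸ h10) s₁ E₁ P₁ rfl
          (by rw [hk₁.1 0 (by omega), h0]) h8' hev.inv hev.rel
        refine ⟨s₂, _, E₂, P₂, .loopTrue (HE.ok_reg (by omega)) h8 hr₁ hr₂, hk₁.trans hk₂,
          hev.trans hev₂, hirr, ?_⟩
        simp only [HE.comp, Expr.cost]
        omega
  have hset := HRuns.set (n := n) (r := 8) (e := .const 1) (s := s) (by omega) trivial
    (by simp only [HE.eval]; omega)
  have hk₀ : Keep 12 s (s.setR 8 1) := (Keep.refl _ s).setR (by omega) (by omega) _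
  obtain ⟨s', t, E', P', hr, hk, hev, hirr, ht⟩ := key _ (s.setR 8 1) E P rfl
    (by rw [hk₀.1 0 (by omega), h0]) (by simp) hinv hrel
  refine ⟨s', _, E', P', .seq hset hr, hk₀.trans hk, hev, hirr, ?_⟩
  have e : (HE.const 1).comp.cost = 1 := rfl
  rw [e]
  nlinarith

/-! ## Insertion of the Schreier generators of a level -/

open HE in
/-- The program that computes the Schreier generator of the entry of the registers `11`, `10` and
the point of the register `9`, on the level of the register `12`. -/
def HP.generator : HP :=
  HP.assign 2 (const 1) (const 1) (arr 0 (reg 12) (reg 9) (reg 1))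
    (arr 0 (reg 12) (arr 1 (reg 11) (reg 10) (reg 9)) (arr 1 (reg 11) (reg 10) (reg 1)))

open HE in
/-- The program that inserts a Schreier generator if the point of the register `9` is in the
orbit. -/
def HP.schreierStep : HP :=
  .cond (HE.eq (arr 0 (reg 12) (reg 9) (reg 9)) (reg 12))
    (.seq HP.generator (.seq (.set 7 (.sub (reg 12) (const 1))) HP.insert)) .skip

open HE in
/-- The test whether the entry of the registers `11` and `10` is a generator of the level of the
register `12`. -/
def HE.active : HE :=
  .mul (.sub (.add (reg 12) (const 1)) (reg 11)) (arr 1 (reg 11) (reg 10) (reg 11))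

/-- The program that inserts all Schreier generators of the level of the register `12`. -/
def HP.schreier : HP :=
  HP.for 11 (.const 1) (HP.for 10 (.const 1)
    (.cond HE.active (HP.for 9 (.const 1) HP.schreierStep) .skip))

/-- The data `E`, `P` in the arrays `a` have evolved from `E₀`, `P₀` by insertions on levels
below `k`, which include the Schreier generators given by `D`. -/
structure Schreier (n : ℕ) (G : Subgroup (Equiv.Perm ℕ)) (E₀ : Table) (P₀ : Labels) (k : ℕ)
    (D : ℕ → ℕ → ℕ → Prop) (a : ℕ → ℕ → ℕ → ℕ → ℕ) (E : Table) (P : Labels) : Prop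
    extends Evolved n G E₀ P₀ a E P where
  inc : ∀ i j s, E₀ i j = some s → E i j = some s
  label : P k = P₀ k
  mem : ∀ i j v, D i j v → ∀ s, E₀ i j = some s → s ∈ perms k → P₀.root k v = k →
    P₀.schreier k s v ∈ gen E (k - 1)

theorem Schreier.imp {n : ℕ} {G : Subgroup (Equiv.Perm ℕ)} {E₀ E : Table} {P₀ P : Labels} {k : ℕ}
    {D D' : ℕ → ℕ → ℕ → Prop} {a : ℕ → ℕ → ℕ → ℕ → ℕ} (h : Schreier n G E₀ P₀ k D a E P)
    (hD : ∀ i j v s, E₀ i j = some s → s ∈ perms k → P₀.root k v = k → D' i j v → D i j v) :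
    Schreier n G E₀ P₀ k D' a E P :=
  { h with mem := fun i j v hd s hs hsk hr => h.mem i j v (hD i j v s hs hsk hr hd) s hs hsk hr }

theorem HRuns.generator : ∃ c, ∀ (n : ℕ) (s : HState) (G : Subgroup (Equiv.Perm ℕ)) (E : Table)
    (P : Labels) (i j v k : ℕ) (g : Equiv.Perm ℕ), s.r 0 = n → s.r 12 = k → s.r 11 = i →
    s.r 10 = j → s.r 9 = v → k ∈ Set.Icc 1 n → v ∈ Set.Icc 1 n → Inv n G E P → Rel n s.a E P →
    E i j = some g → g ∈ perms k →
    ∃ s' t, HRuns n HP.generator s s' t ∧ Keep 2 s s' ∧ Rel n s'.a E P ∧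
      Hand n s'.a (P.schreier k g v) ∧ t ≤ c * n := by
  refine ⟨HP.assignCost 2 (.const 1) (.const 1) (.arr 0 (.reg 12) (.reg 9) (.reg 1))
    (.arr 0 (.reg 12) (.arr 1 (.reg 11) (.reg 10) (.reg 9))
      (.arr 1 (.reg 11) (.reg 10) (.reg 1))), ?_⟩
  intro n s G E P i j v k g h0 h12 h11 h10 h9 hk hv hinv hrel hg hgk
  obtain ⟨hj1, hj2, hin, -, -⟩ := hinv.wf _ _ _ hg
  have hiI : i ∈ Set.Icc 1 n := ⟨by omega, hin⟩
  have hjI : j ∈ Set.Icc 1 n := ⟨hj1, by omega⟩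
  have hn : 1 ≤ n := hjI.1.trans hjI.2
  have h1I : 1 ∈ Set.Icc 1 n := ⟨le_rfl, hn⟩
  have hgn := perms_mono hk.2 hgk
  have hgv := perms_apply_mem hgn le_rfl hv
  have hPv : P k v ∈ perms n := perms_mono hk.2 (gen_le_permsSub _ _ (hinv.lab k hk v hv))
  have hPgv : P k (g v) ∈ perms n :=
    perms_mono hk.2 (gen_le_permsSub _ _ (hinv.lab k hk _ hgv))
  obtain ⟨s₁, t₁, hr₁, hk₁, hs₁, hq₁, ht₁⟩ := HRuns.assign (n := n) (s := s) (c := 2)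
    (k := .const 1) (j := .const 1) (e₁ := .arr 0 (.reg 12) (.reg 9) (.reg 1))
    (e₂ := .arr 0 (.reg 12) (.arr 1 (.reg 11) (.reg 10) (.reg 9))
      (.arr 1 (.reg 11) (.reg 10) (.reg 1))) (kv := 1) (jv := 1) (by omega) hn h0 h1I h1I
    (fun w => P k v w) (fun w => P k (g v) (g w)) (fun w hw => perms_apply_mem hPv le_rfl hw)
    (fun w hw => (perms_apply_mem hPgv le_rfl (perms_apply_mem hgn le_rfl hw)).2)
    (fun w _ w' _ h => (P k v).injective h) (by
      intro s₁ w hw hk' h1 ha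
      have e0 : s₁.r 0 = n := by rw [hk'.1 0 (by omega), h0]
      have e9 : s₁.r 9 = v := by rw [hk'.1 9 (by omega), h9]
      have e10 : s₁.r 10 = j := by rw [hk'.1 10 (by omega), h10]
      have e11 : s₁.r 11 = i := by rw [hk'.1 11 (by omega), h11]
      have e12 : s₁.r 12 = k := by rw [hk'.1 12 (by omega), h12]
      have ea : ∀ c' ≠ 2, ∀ k' j' x', s₁.a c' k' j' x' = s.a c' k' j' x' :=
        fun c' hc' k' j' x' => ha c' k' j' x' fun h => absurd h hc'
      have o : ∀ r < 16, (HE.reg r).Ok n s₁ := fun r hr => HE.ok_reg hr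
      have m1 : (HE.reg 1).eval s₁ ∈ Set.Icc 1 n := by rw [HE.eval, h1]; exact hw
      have m9 : (HE.reg 9).eval s₁ ∈ Set.Icc 1 n := by rw [HE.eval, e9]; exact hv
      have m10 : (HE.reg 10).eval s₁ ∈ Set.Icc 1 n := by rw [HE.eval, e10]; exact hjI
      have m11 : (HE.reg 11).eval s₁ ∈ Set.Icc 1 n := by rw [HE.eval, e11]; exact hiI
      have m12 : (HE.reg 12).eval s₁ ∈ Set.Icc 1 n := by rw [HE.eval, e12]; exact hk
      have ev : (HE.arr 1 (.reg 11) (.reg 10) (.reg 9)).eval s₁ = g v := by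
        simp only [HE.eval, e11, e10, e9]
        rw [ea 1 (by omega), hrel.some _ hiI _ hjI _ hg _ hv]
      have ew : (HE.arr 1 (.reg 11) (.reg 10) (.reg 1)).eval s₁ = g w := by
        simp only [HE.eval, e11, e10, h1]
        rw [ea 1 (by omega), hrel.some _ hiI _ hjI _ hg _ hw]
      have hgw := perms_apply_mem hgn le_rfl hw
      refine ⟨⟨trivial, rfl⟩, ⟨trivial, rfl⟩, ⟨?_, ?_⟩, ?_, ?_⟩
      · exact HE.ok_arr e0 (by omega) (o 12 (by omega)) m12 (o 9 (by omega)) m9 (o 1 (by omega)) m1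
      · simp only [HE.eval, e12, e9, h1]
        rw [ea 0 (by omega), hrel.lab _ hk _ hv _ hw]
      · exact HE.ok_arr e0 (by omega) (o 12 (by omega)) m12
          (HE.ok_arr e0 (by omega) (o 11 (by omega)) m11 (o 10 (by omega)) m10 (o 9 (by omega)) m9)
          (by rw [ev]; exact hgv)
          (HE.ok_arr e0 (by omega) (o 11 (by omega)) m11 (o 10 (by omega)) m10 (o 1 (by omega)) m1)
          (by rw [ew]; exact hgw)
      · rw [HE.eval, ev, ew, HE.eval, e12, ea 0 (by omega), hrel.lab _ hk _ hgv _ hgw])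
  have hs₁' : ∀ c' ≠ 2, ∀ k' j' x', s₁.a c' k' j' x' = s.a c' k' j' x' :=
    fun c' hc' k' j' x' => hs₁ c' k' j' x' fun h => absurd h hc'
  refine ⟨s₁, t₁, hr₁, hk₁, ⟨fun k hk v hv x hx => ?_, fun a ha b hb g hg x hx => ?_,
    fun a ha b hb hg => ?_⟩, fun u hu => ?_, ht₁⟩
  · rw [hs₁' 0 (by omega), hrel.lab k hk v hv x hx]
  · rw [hs₁' 1 (by omega), hrel.some a ha b hb g hg x hx]
  · rw [hs₁' 1 (by omega), hrel.none a ha b hb hg]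
  · have := hq₁ _ (perm_inv_mem hPv hu)
    rw [show P k v ((P k v)⁻¹ u) = u from Equiv.apply_symm_apply _ u] at this
    rw [this]; rfl

/-! ### Accounting for entries that arise during the loops -/

/-- The pairs of a level and a point of the loops over all entries that follow `x`, `y`. -/
def remaining (n : ℕ) (E : Table) (x y : ℕ) : ℕ :=
  ((ent n E).filter fun p => x < p.1 ∨ p.1 = x ∧ y ≤ p.2).card

/-- Each additional remaining entry is a new entry of the table, so the increase of the one number
is at most that of the other. -/
theorem remaining_inc {n : ℕ} {E E' : Table} (h : ∀ i j s, E i j = some s → E' i j = some s)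
    (x y : ℕ) :
    remaining n E' x y + (ent n E).card ≤ remaining n E x y + (ent n E').card := by
  have hsub := ent_mono (n := n) h
  have h1 : ((ent n E').filter fun p => x < p.1 ∨ p.1 = x ∧ y ≤ p.2) ⊆
      ((ent n E).filter fun p => x < p.1 ∨ p.1 = x ∧ y ≤ p.2) ∪ (ent n E' \ ent n E) := by
    intro p hp
    rw [Finset.mem_filter] at hp
    by_cases hpE : p ∈ ent n E
    · exact Finset.mem_union_left _ (Finset.mem_filter.2 ⟨hpE, hp.2⟩)
    · exact Finset.mem_union_right _ (Finset.mem_sdiff.2 ⟨hp.1, hpE⟩)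
  have h2 := (Finset.card_le_card h1).trans (Finset.card_union_le _ _)
  rw [Finset.card_sdiff_of_subset hsub] at h2
  have h3 := Finset.card_le_card hsub
  unfold remaining
  omega

theorem remaining_succ_le (n : ℕ) (E : Table) (x y : ℕ) :
    remaining n E x (y + 1) ≤ remaining n E x y :=
  Finset.card_le_card fun p hp => by
    rw [Finset.mem_filter] at hp ⊢
    exact ⟨hp.1, by omega⟩

theorem remaining_next_le (n : ℕ) (E : Table) (x y : ℕ) :
    remaining n E (x + 1) 1 ≤ remaining n E x y :=
  Finset.card_le_card fun p hp => by
    rw [Finset.mem_filter] at hp ⊢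
    exact ⟨hp.1, by omega⟩

theorem remaining_succ_lt {n : ℕ} {E : Table} {x y : ℕ} (hx : x ∈ Set.Icc 1 n)
    (hy : y ∈ Set.Icc 1 n) (h : (E x y).isSome) :
    remaining n E x (y + 1) < remaining n E x y := by
  refine Finset.card_lt_card (Finset.ssubset_iff_of_subset (fun p hp => ?_) |>.2 ⟨(x, y), ?_, ?_⟩)
  · rw [Finset.mem_filter] at hp ⊢
    exact ⟨hp.1, by omega⟩
  · exact Finset.mem_filter.2 ⟨mem_ent.2 ⟨⟨hx, hy⟩, h⟩, by simp⟩
  · simp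

theorem remaining_le (n : ℕ) (E : Table) (x y : ℕ) : remaining n E x y ≤ (ent n E).card :=
  Finset.card_filter_le _ _

theorem HRuns.schreierStep : ∃ c, ∀ (n w : ℕ) (s : HState) (G : Subgroup (Equiv.Perm ℕ))
    (E₀ E : Table) (P₀ P : Labels) (D : ℕ → ℕ → ℕ → Prop) (i j v k : ℕ) (g : Equiv.Perm ℕ),
    c * n ^ 2 ≤ w → s.r 0 = n → s.r 12 = k → s.r 11 = i →
    s.r 10 = j → s.r 9 = v → k ∈ Set.Icc 1 n → v ∈ Set.Icc 1 n →
    Schreier n G E₀ P₀ k D s.a E P → E i j = some g → g ∈ perms k →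
    ∃ s' t E' P', HRuns n HP.schreierStep s s' t ∧ Keep 8 s s' ∧
      Schreier n G E₀ P₀ k (fun i' j' v' => D i' j' v' ∨ i' = i ∧ j' = j ∧ v' = v) s'.a E' P' ∧
      CountLe n E P E' P' ∧ (∀ i j s, E i j = some s → E' i j = some s) ∧
      t + w * pot n E' P' ≤ c * n ^ 2 + w * pot n E P := by
  obtain ⟨c₁, hc₁⟩ := HRuns.generator
  obtain ⟨c₂, hc₂⟩ := HRuns.insert
  obtain ⟨d, hd⟩ : ∃ d, d = (HE.eq (.arr 0 (.reg 12) (.reg 9) (.reg 9)) (.reg 12)).comp.cost + 1 :=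
    ⟨_, rfl⟩
  refine ⟨c₁ + c₂ + d + 10, ?_⟩
  intro n w s G E₀ E P₀ P D i j v k g hw h0 h12 h11 h10 h9 hk hv hS hg hgk
  have hn : 1 ≤ n := hk.1.trans hk.2
  have hinv := hS.inv
  have m9 : (HE.reg 9).eval s ∈ Set.Icc 1 n := by rw [HE.eval, h9]; exact hv
  have hok : (HE.eq (.arr 0 (.reg 12) (.reg 9) (.reg 9)) (.reg 12)).Ok n s :=
    HE.ok_eq (HE.ok_arr h0 (by omega) (HE.ok_reg (by omega)) (by rw [HE.eval, h12]; exact hk)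
      (HE.ok_reg (by omega)) m9 (HE.ok_reg (by omega)) m9) (HE.ok_reg (by omega))
  have hval : (HE.eq (.arr 0 (.reg 12) (.reg 9) (.reg 9)) (.reg 12)).eval s ≠ 0 ↔
      P.root k v = k := by
    rw [HE.eval_eq]
    simp only [HE.eval, h12, h9]
    rw [hS.rel.lab _ hk _ hv _ hv]; rfl
  have hroot : P.root k v = P₀.root k v := by unfold Labels.root; rw [hS.label]
  have hn2 : 1 ≤ n ^ 2 := Nat.one_le_pow _ _ hn
  by_cases hr : P.root k v = k
  · obtain ⟨s₁, t₁, hr₁, hk₁, hrel₁, hhand₁, ht₁⟩ :=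
      hc₁ n s G E P i j v k g h0 h12 h11 h10 h9 hk hv hinv hS.rel hg hgk
    have e12 : s₁.r 12 = k := by rw [hk₁.1 12 (by omega), h12]
    have hk1 : k - 1 + 1 = k := by have := hk.1; omega
    obtain ⟨hz, hzk⟩ := hinv.schreier_mem (k := k - 1) (hk1.symm ▸ hk)
      (hk1.symm ▸ mem_gen hg hgk) hv (hk1.symm ▸ hr)
    rw [hk1] at hz hzk
    have hset := HRuns.set (n := n) (r := 7) (e := .sub (.reg 12) (.const 1)) (s := s₁) (by omega)
      ⟨HE.ok_reg (by omega), trivial⟩ (by simp only [HE.eval, e12]; have := hk.2; omega)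
    simp only [HE.eval, e12] at hset
    have hk₂ : Keep 8 s₁ (s₁.setR 7 (k - 1)) := (Keep.refl _ s₁).setR (by omega) (by omega) _
    obtain ⟨s₃, t₃, E', P', hr₃, hk₃, hins, hrel₃, hcount, ht₃⟩ := hc₂ n w (s₁.setR 7 (k - 1)) G
      E P _ (k - 1) hn (le_trans (Nat.mul_le_mul_right _ (by omega)) hw)
      (by rw [hk₂.1 0 (by omega), hk₁.1 0 (by omega), h0]) (by simp) (by have := hk.2; omega)
      (hinv.sift hzk (gen_le_of_forall hinv.inG _ hz)) hrel₁ hhand₁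
    have hgen : ∀ k', gen E k' ≤ gen E' k' := fun k' => gen_mono le_rfl hins.inc
    refine ⟨s₃, _, E', P', .condTrue hok (hval.2 hr) (.seq hr₁ (.seq hset hr₃)),
      (hk₁.mono (by omega)).trans (hk₂.trans hk₃),
      ⟨⟨hins.toInv, hrel₃, fun k' => (hS.gen_le k').trans (hgen k'), hS.count.trans hcount⟩,
        fun a b f hf => hins.inc a b f (hS.inc a b f hf), ?_, ?_⟩, hcount, hins.inc, ?_⟩
    -- The Schreier generator is in the group of level k, so it preserves the classes there, and its
    -- insertion leaves the labels of level k unchanged.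
    · rw [hins.same k hk (by omega) (hinv.compat_of_mem hk hz), hS.label]
    · rintro a b u (hD | ⟨rfl, rfl, rfl⟩) f hf hfk hroot'
      · exact hgen _ (hS.mem a b u hD f hf hfk hroot')
      · have := hS.inc _ _ _ hf
        rw [hg] at this
        simp only [Option.some.injEq] at this
        subst this
        have := hins.start_mem
        unfold Labels.schreier at this ⊢
        rwa [hS.label] at this
    · rw [← hd]
      have hsq : n ≤ n ^ 2 := Nat.le_self_pow (by omega) n
      have h1 := Nat.mul_le_mul_left c₁ hsq
      have h2 : d + 10 ≤ (d + 10) * n ^ 2 := Nat.le_mul_of_pos_right _ (by omega)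
      have h3 : (c₁ + c₂ + d + 10) * n ^ 2 = c₁ * n ^ 2 + c₂ * n ^ 2 + (d + 10) * n ^ 2 := by ring
      have h4 : (HE.sub (.reg 12) (.const 1)).comp.cost = 4 := rfl
      rw [h4]
      omega
  · refine ⟨s, _, E, P, .condFalse hok (not_not.1 (mt hval.1 hr)) (.skip _), Keep.refl _ _,
      ⟨hS.toEvolved, hS.inc, hS.label, ?_⟩, .refl _ _ _, fun _ _ _ h => h, ?_⟩
    · rintro a b u (hD | ⟨rfl, rfl, rfl⟩) f hf hfk hroot'
      · exact hS.mem a b u hD f hf hfk hroot'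
      · exact absurd (hroot.trans hroot') hr
    · rw [← hd]
      have h2 : d + 10 ≤ (d + 10) * n ^ 2 := Nat.le_mul_of_pos_right _ (by omega)
      have h3 : (c₁ + c₂ + d + 10) * n ^ 2 = (c₁ + c₂) * n ^ 2 + (d + 10) * n ^ 2 := by ring
      omega

/-- An active entry causes up to n insertions, O(n³) ≤ w steps, and then no longer counts as
remaining. Entries created meanwhile may have to be visited, too; since `unc` plus the number of
entries does not increase, the extra term `unc` covers them. -/
theorem HRuns.schreierEntry : ∃ c, ∀ (n w : ℕ) (s : HState) (G : Subgroup (Equiv.Perm ℕ))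
    (E₀ E : Table) (P₀ P : Labels) (D : ℕ → ℕ → ℕ → Prop) (i j k : ℕ),
    c * n ^ 3 ≤ w → s.r 0 = n → s.r 12 = k → s.r 11 = i →
    s.r 10 = j → k ∈ Set.Icc 1 n → i ∈ Set.Icc 1 n → j ∈ Set.Icc 1 n →
    Schreier n G E₀ P₀ k D s.a E P →
    ∃ s' t E' P', HRuns n (.cond HE.active (HP.for 9 (.const 1) HP.schreierStep) .skip) s s' t ∧
      Keep 10 s s' ∧
      Schreier n G E₀ P₀ k (fun i' j' v' => D i' j' v' ∨ i' = i ∧ j' = j ∧ v' ∈ Set.Icc 1 n)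
        s'.a E' P' ∧
      t + w * (pot n E' P' + unc n P' + remaining n E' i (j + 1)) ≤
        c + w * (pot n E P + unc n P + remaining n E i j) := by
  obtain ⟨c, hc⟩ := HRuns.schreierStep
  obtain ⟨d, hd⟩ : ∃ d, d = HE.active.comp.cost + 1 := ⟨_, rfl⟩
  refine ⟨c + d + 40, ?_⟩
  intro n w s G E₀ E P₀ P D i j k hw h0 h12 h11 h10 hk hi hj hS
  have hn : 1 ≤ n := hk.1.trans hk.2
  have m11 : (HE.reg 11).eval s ∈ Set.Icc 1 n := by rw [HE.eval, h11]; exact hi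
  have hok : HE.active.Ok n s :=
    ⟨⟨⟨HE.ok_reg (by omega), trivial⟩, HE.ok_reg (by omega)⟩,
      HE.ok_arr h0 (by omega) (HE.ok_reg (by omega)) m11 (HE.ok_reg (by omega))
      (by rw [HE.eval, h10]; exact hj) (HE.ok_reg (by omega)) m11⟩
  have hval : HE.active.eval s ≠ 0 ↔ i ≤ k ∧ (E i j).isSome := by
    rw [HE.active, HE.eval, mul_ne_zero_iff]
    simp only [HE.eval, h12, h11, h10]
    rw [hS.rel.entry_ne_zero hS.inv.toCore hi hj]
    exact and_congr_left fun _ => by omega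
  by_cases hact : i ≤ k ∧ (E i j).isSome
  · obtain ⟨g, hg⟩ := Option.isSome_iff_exists.1 hact.2
    have hgk : g ∈ perms k := perms_mono hact.1 (hS.inv.wf _ _ _ hg).2.2.2.1
    have hw2 : (c + d + 40) * n ^ 2 ≤ w :=
      le_trans (Nat.mul_le_mul_left _ (Nat.pow_le_pow_right hn (by omega))) hw
    obtain ⟨s', t, φ', hr', hk', ⟨E', P', hS', hcount, hinc, rfl⟩, ht⟩ := HRuns.for_keep (n := n)
      (r := 9) (p := HP.schreierStep) (by omega) (by omega) (.const 1) (c * n ^ 2) 1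
      (fun v φ a => ∃ E' P', Schreier n G E₀ P₀ k
        (fun i' j' v' => D i' j' v' ∨ i' = i ∧ j' = j ∧ v' ∈ Set.Icc 1 n ∧ v' < v) a E' P' ∧
        CountLe n E P E' P' ∧ (∀ i j s, E i j = some s → E' i j = some s) ∧
        φ = w * pot n E' P') s (w * pot n E P) h0 trivial rfl (by omega)
      ⟨E, P, hS.imp fun a b u _ _ _ _ h => h.resolve_right fun h' => by
        have := h'.2.2.1.1; omega, .refl _ _ _, fun _ _ _ h => h, rfl⟩ (by
        rintro v φ s₁ hv1 hvn e9 hk₁ ⟨E₁, P₁, hS₁, hcount, hinc, rfl⟩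
        obtain ⟨s', t, E', P', hr, hk', hS', hcount', hinc', ht⟩ := hc n w s₁ G E₀ E₁ P₀ P₁ _ i j v
          k g (le_trans (Nat.mul_le_mul_right _ (by omega)) hw2) (by rw [hk₁.1 0 (by omega), h0])
          (by rw [hk₁.1 12 (by omega), h12]) (by rw [hk₁.1 11 (by omega), h11])
          (by rw [hk₁.1 10 (by omega), h10]) e9 hk ⟨hv1, hvn⟩ hS₁ (hinc _ _ _ hg) hgk
        refine ⟨s', t, _, hr, hk'.mono (by omega), ⟨E', P', hS'.imp ?_, hcount.trans hcount',
          fun a b f hf => hinc' a b f (hinc a b f hf), rfl⟩, ht⟩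
        rintro a b u f _ _ _ (h | ⟨h1, h2, h3, h4⟩)
        · exact .inl (.inl h)
        · by_cases hlt : u < v
          · exact .inl (.inr ⟨h1, h2, h3, hlt⟩)
          · exact .inr ⟨h1, h2, by omega⟩)
    refine ⟨s', _, E', P', .condTrue hok (hval.2 hact) hr', hk', hS'.imp ?_, ?_⟩
    · rintro a b u f _ _ _ (h | ⟨h1, h2, h3⟩)
      · exact .inl h
      · exact .inr ⟨h1, h2, h3, by have := h3.2; omega⟩
    · rw [← hd]
      have e : (HE.const 1).comp.cost = 1 := rfl
      rw [e, Nat.add_sub_cancel] at ht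
      have h1 := remaining_inc (n := n) hinc i (j + 1)
      have h2 := remaining_succ_lt hi hj hact.2
      have h3 : w * (unc n P' + remaining n E' i (j + 1)) + w ≤
          w * (unc n P + remaining n E i j) := by
        rw [← Nat.mul_succ]
        exact Nat.mul_le_mul_left _ (by have := hcount.2; omega)
      have h4 : n * (c * n ^ 2 + 14) + 30 ≤ w + 11 := by
        have h5 : n ≤ n ^ 3 := Nat.le_self_pow (by omega) n
        have h6 : n * (c * n ^ 2 + 14) = c * n ^ 3 + 14 * n := by ring
        have h7 : (c + d + 40) * n ^ 3 = c * n ^ 3 + d * n ^ 3 + 40 * n ^ 3 := by ring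
        have h8 : 1 ≤ n ^ 3 := Nat.one_le_pow _ _ hn
        omega
      rw [add_assoc (pot n E' P'), add_assoc (pot n E P), mul_add, mul_add w (pot n E P)]
      omega
  · refine ⟨s, _, E, P, .condFalse hok (not_not.1 (mt hval.1 hact)) (.skip _), Keep.refl _ _,
      hS.imp ?_, ?_⟩
    -- No required generator is missed: an entry of row i moves i, so it is in Π(k) only if i ≤ k,
    -- and entries of E₀ are still present.
    · rintro a b u f hf hfk _ (h | ⟨rfl, rfl, -⟩)
      · exact h
      · refine absurd ⟨?_, by rw [hS.inc _ _ _ hf]; rfl⟩ hact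
        by_contra hlt
        have h1 := hS.inv.wf _ _ _ (hS.inc _ _ _ hf)
        have := hfk a fun h' => hlt h'.2
        omega
    · rw [← hd]
      have h1 := Nat.mul_le_mul_left w (Nat.add_le_add_left (remaining_succ_le n E i j)
        (pot n E P + unc n P))
      omega

theorem HRuns.schreier : ∃ c, ∀ (n w : ℕ) (s : HState) (G : Subgroup (Equiv.Perm ℕ))
    (E : Table) (P : Labels) (k : ℕ), c * n ^ 3 ≤ w → s.r 0 = n → s.r 12 = k →
    k ∈ Set.Icc 1 n → Inv n G E P → Rel n s.a E P →
    ∃ s' t E' P', HRuns n HP.schreier s s' t ∧ Keep 12 s s' ∧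
      Schreier n G E P k (fun i j v => i ∈ Set.Icc 1 n ∧ j ∈ Set.Icc 1 n ∧ v ∈ Set.Icc 1 n)
        s'.a E' P' ∧
      t + w * (pot n E' P' + unc n P') ≤
        c * n ^ 2 + w * (pot n E P + unc n P + (ent n E).card) := by
  obtain ⟨c, hc⟩ := HRuns.schreierEntry
  refine ⟨c + 60, ?_⟩
  intro n w s G E P k hw h0 h12 hk hinv hrel
  have hn : 1 ≤ n := hk.1.trans hk.2
  obtain ⟨s', t, φ', hr, hk', ⟨E', P', hS, rfl⟩, ht⟩ := HRuns.for_keep (n := n) (r := 11)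
    (p := HP.for 10 (.const 1) (.cond HE.active (HP.for 9 (.const 1) HP.schreierStep) .skip))
    (by omega) (by omega) (.const 1) (n * (c + 14) + 11) 1
    (fun i φ a => ∃ E' P', Schreier n G E P k (fun i' j' v' => i' ∈ Set.Icc 1 n ∧ i' < i ∧
      j' ∈ Set.Icc 1 n ∧ v' ∈ Set.Icc 1 n) a E' P' ∧
      φ = w * (pot n E' P' + unc n P' + remaining n E' i 1)) s
    (w * (pot n E P + unc n P + remaining n E 1 1)) h0 trivial rfl (by omega)
    ⟨E, P, ⟨⟨hinv, hrel, fun _ => le_rfl, .refl _ _ _⟩, fun _ _ _ h => h, rfl,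
      fun i _ _ h => absurd h.1.1 (by omega)⟩, rfl⟩ (by
      rintro i φ s₁ hi1 hin e11 hk₁ ⟨E₁, P₁, hS₁, rfl⟩
      have hi : i ∈ Set.Icc 1 n := ⟨hi1, hin⟩
      have f0 : s₁.r 0 = n := by rw [hk₁.1 0 (by omega), h0]
      obtain ⟨s', t, φ', hr, hk', ⟨E', P', hS, rfl⟩, ht⟩ := HRuns.for_keep (n := n) (r := 10)
        (p := .cond HE.active (HP.for 9 (.const 1) HP.schreierStep) .skip)
        (by omega) (by omega) (.const 1) c 1
        (fun j φ a => ∃ E' P', Schreier n G E P k (fun i' j' v' => (i' ∈ Set.Icc 1 n ∧ i' < i ∧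
          j' ∈ Set.Icc 1 n ∧ v' ∈ Set.Icc 1 n) ∨ i' = i ∧ j' ∈ Set.Icc 1 n ∧ j' < j ∧
          v' ∈ Set.Icc 1 n) a E' P' ∧
          φ = w * (pot n E' P' + unc n P' + remaining n E' i j)) s₁
        (w * (pot n E₁ P₁ + unc n P₁ + remaining n E₁ i 1)) f0 trivial rfl (by omega)
        ⟨E₁, P₁, hS₁.imp fun a b u _ _ _ _ h => h.resolve_right fun h' => by
          have := h'.2.1.1; omega, rfl⟩ (by
          rintro j φ s₂ hj1 hjn e10 hk₂ ⟨E₂, P₂, hS₂, rfl⟩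
          obtain ⟨s', t, E', P', hr, hk', hS', ht⟩ := hc n w s₂ G E E₂ P P₂ _ i j k
            (le_trans (Nat.mul_le_mul_right _ (by omega)) hw) (by rw [hk₂.1 0 (by omega), f0])
            (by rw [hk₂.1 12 (by omega), hk₁.1 12 (by omega), h12])
            (by rw [hk₂.1 11 (by omega), e11]) e10 hk hi ⟨hj1, hjn⟩ hS₂
          refine ⟨s', t, _, hr, hk', ⟨E', P', hS'.imp ?_, rfl⟩, ht⟩
          rintro a b u f _ _ _ (h | ⟨h1, h2, h3, h4⟩)
          · exact .inl (.inl h)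
          · by_cases hlt : b < j
            · exact .inl (.inr ⟨h1, h2, hlt, h4⟩)
            · exact .inr ⟨h1, by omega, h4⟩)
      refine ⟨s', t, _, hr, hk', ⟨E', P', hS.imp ?_, rfl⟩, ?_⟩
      · rintro a b u f _ _ _ ⟨h1, h2, h3, h4⟩
        by_cases hlt : a < i
        · exact .inl ⟨h1, hlt, h3, h4⟩
        · exact .inr ⟨by omega, h3, by have := h3.2; omega, h4⟩
      · have e : (HE.const 1).comp.cost = 1 := rfl
        rw [e, Nat.add_sub_cancel] at ht
        have h1 := Nat.mul_le_mul_left w (Nat.add_le_add_left (remaining_next_le n E' i (n + 1))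
          (pot n E' P' + unc n P'))
        omega)
  refine ⟨s', t, E', P', hr, hk', hS.imp ?_, ?_⟩
  · rintro a b u f _ _ _ ⟨h1, h2, h3⟩
    exact ⟨h1, by have := h1.2; omega, h2, h3⟩
  · have e : (HE.const 1).comp.cost = 1 := rfl
    rw [e, Nat.add_sub_cancel] at ht
    have h1 := Nat.mul_le_mul_left w (Nat.add_le_add_left (remaining_le n E 1 1)
      (pot n E P + unc n P))
    have h2 : w * (pot n E' P' + unc n P') ≤
        w * (pot n E' P' + unc n P' + remaining n E' (n + 1) 1) :=
      Nat.mul_le_mul_left _ (by omega)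
    have h3 : n ≤ n ^ 2 := Nat.le_self_pow (by omega) n
    have h4 : n * (n * (c + 14) + 11 + 14) + 11 ≤ (c + 60) * n ^ 2 := by nlinarith
    omega

/-! ## The levels from the top to the bottom -/

/-- The program that makes the entries irredundant and then treats all levels, starting with the
highest one. -/
def HP.levels : HP := .seq (.set 12 (.reg 0)) (HP.down 12 (.seq HP.clean HP.schreier))

/-- On level k+1 both tables generate G ∩ Π(k+1), and its labels are the same. So the Schreier
generators of the old entries suffice for the stabilizer of k+1, although the table has grown. -/
theorem Schreier.full {n : ℕ} {G : Subgroup (Equiv.Perm ℕ)} {E E' : Table} {P P' : Labels} {k : ℕ}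
    {a : ℕ → ℕ → ℕ → ℕ → ℕ}
    (h : Schreier n G E P (k + 1)
      (fun i j v => i ∈ Set.Icc 1 n ∧ j ∈ Set.Icc 1 n ∧ v ∈ Set.Icc 1 n) a E' P')
    (hinv : Inv n G E P) (hk : k + 1 ∈ Set.Icc 1 n) (hG : G ⊓ permsSub (k + 1) ≤ gen E (k + 1)) :
    G ⊓ permsSub k ≤ gen E' k := by
  intro g hg
  have hgk : g ∈ perms k := hg.2
  have hmem : g ∈ gen E' (k + 1) :=
    h.gen_le _ (hG ⟨hg.1, perms_mono (Nat.le_succ k) hgk⟩)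
  refine h.inv.stabilizer_mem hk (E₀ := E) ?_ ?_ (h.gen_le _) hmem (hgk _ (by simp))
  · exact fun f hf => hG ⟨gen_le_of_forall h.inv.inG _ hf, gen_le_permsSub _ _ hf⟩
  · intro i j s hs hsk _ v hv hr
    obtain ⟨h1, h2, h3, -⟩ := hinv.wf _ _ _ hs
    unfold Labels.root at hr
    rw [h.label] at hr
    have := h.mem i j v ⟨⟨by omega, h3⟩, ⟨h1, by omega⟩, hv⟩ s hs hsk hr
    unfold Labels.schreier at this ⊢
    rwa [h.label]

/-- Cleaning leaves at most n entries, so a level costs w n beyond lower order terms and the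
decrease of the potential; n levels give w n². Cleaning keeps completed levels complete because no
generated group shrinks. -/
theorem HRuns.levels : ∃ c, ∀ (n w : ℕ) (s : HState) (G : Subgroup (Equiv.Perm ℕ)) (E : Table)
    (P : Labels), 1 ≤ n → c * n ^ 3 ≤ w → s.r 0 = n → Inv n G E P → Rel n s.a E P →
    G ≤ gen E n →
    ∃ s' t E' P', HRuns n HP.levels s s' t ∧ Keep 13 s s' ∧ Inv n G E' P' ∧ Rel n s'.a E' P' ∧
      (∀ k ∈ Set.Icc 1 n, G ⊓ permsSub k ≤ gen E' k) ∧
      t ≤ c * n ^ 4 + w * n ^ 2 + w * (pot n E P + unc n P) := by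
  obtain ⟨c₁, hc₁⟩ := HRuns.clean
  obtain ⟨c₂, hc₂⟩ := HRuns.schreier
  refine ⟨c₁ + c₂ + 40, ?_⟩
  intro n w s G E P hn hw h0 hinv hrel hG
  have hset := HRuns.set (n := n) (r := 12) (e := .reg 0) (s := s) (by omega)
    (HE.ok_reg (by omega)) (by simp only [HE.eval, h0]; omega)
  simp only [HE.eval, h0] at hset
  have hk₀ : Keep 13 s (s.setR 12 n) := (Keep.refl _ s).setR (by omega) (by omega) _
  obtain ⟨s', t, φ', hr, hk, ⟨E', P', h1, h2, h3, rfl⟩, ht⟩ := HRuns.down_keep (n := n) (r := 12)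
    (p := .seq HP.clean HP.schreier) (by omega) (by omega) (c₁ * n ^ 3 + c₂ * n ^ 2 + w * n) n
    (fun x φ a => ∃ E P, Inv n G E P ∧ Rel n a E P ∧
      (∀ k ∈ Set.Icc 1 n, x ≤ k → G ⊓ permsSub k ≤ gen E k) ∧
      φ = w * (pot n E P + unc n P)) (s.setR 12 n) (w * (pot n E P + unc n P)) (by simp) le_rfl
    ⟨E, P, hinv, hrel, fun k hk hnk => by
      obtain rfl : n = k := le_antisymm hnk hk.2
      exact inf_le_left.trans hG, rfl⟩ (by
    rintro k φ s₁ hkn e12 hk₁ ⟨E₁, P₁, hinv₁, hrel₁, hG₁, rfl⟩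
    have hkI : k + 1 ∈ Set.Icc 1 n := ⟨by omega, hkn⟩
    have e0 : s₁.r 0 = n := by rw [hk₁.1 0 (by omega), hk₀.1 0 (by omega), h0]
    obtain ⟨s₂, t₂, E₂, P₂, hr₂, hk₂, hev, hirr, ht₂⟩ := hc₁ n w s₁ G E₁ P₁ hn
      (le_trans (Nat.mul_le_mul_right _ (by omega)) hw) e0 hinv₁ hrel₁
    obtain ⟨s₃, t₃, E₃, P₃, hr₃, hk₃, hS, ht₃⟩ := hc₂ n w s₂ G E₂ P₂ (k + 1)
      (le_trans (Nat.mul_le_mul_right _ (by omega)) hw) (by rw [hk₂.1 0 (by omega), e0])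
      (by rw [hk₂.1 12 (by omega), e12]) hkI hev.inv hev.rel
    have hG₂ : ∀ k' ∈ Set.Icc 1 n, k + 1 ≤ k' → G ⊓ permsSub k' ≤ gen E₂ k' :=
      fun k' hk' hle => (hG₁ k' hk' hle).trans (hev.gen_le k')
    refine ⟨s₃, _, _, .seq hr₂ hr₃, hk₂.trans hk₃, ⟨E₃, P₃, hS.inv, hS.rel, ?_, rfl⟩, ?_⟩
    · intro k' hk' hle
      rcases hle.eq_or_lt with rfl | hlt
      · exact hS.full hev.inv hkI (hG₂ _ hkI le_rfl)
      · exact (hG₂ k' hk' hlt).trans (hS.gen_le k')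
    · have h1 : w * (ent n E₂).card ≤ w * n := Nat.mul_le_mul_left _ (hev.inv.ent_card hirr)
      have h2 : w * unc n P₂ ≤ w * unc n P₁ := Nat.mul_le_mul_left _ hev.count.1
      rw [mul_add w _ (ent n E₂).card, mul_add w _ (unc n P₂)] at ht₃
      rw [mul_add w _ (unc n P₁)]
      omega)
  refine ⟨s', _, E', P', .seq hset hr, hk₀.trans hk, h1, h2, fun k hk => h3 k hk (by omega), ?_⟩
  have e : (HE.reg 0).comp.cost = 2 := rfl
  have e1 : n * (c₁ * n ^ 3 + c₂ * n ^ 2 + w * n + 14) =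
      c₁ * n ^ 4 + c₂ * n ^ 3 + w * n ^ 2 + 14 * n := by ring
  have e2 : (c₁ + c₂ + 40) * n ^ 4 = c₁ * n ^ 4 + c₂ * n ^ 4 + 40 * n ^ 4 := by ring
  have e3 : c₂ * n ^ 3 ≤ c₂ * n ^ 4 := Nat.mul_le_mul_left _ (Nat.pow_le_pow_right hn (by omega))
  have e4 : n ≤ n ^ 4 := Nat.le_self_pow (by omega) n
  omega

/-! ## Initialization and output -/

/-- A rule for programs that modify all rows of the array `0` in turn. -/
theorem HRuns.rows {n : ℕ} {p : HP} (c : ℕ) (f : ℕ → ℕ → ℕ → ℕ) (s : HState) (hn : 1 ≤ n)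
    (h0 : s.r 0 = n)
    (h : ∀ s₁ : HState, ∀ k ∈ Set.Icc 1 n, ∀ j ∈ Set.Icc 1 n, s₁.r 0 = n → s₁.r 11 = k →
      s₁.r 10 = j → (∀ x ∈ Set.Icc 1 n, s₁.a 0 k j x = s.a 0 k j x) →
      ∃ s' t, HRuns n p s₁ s' t ∧ Keep 10 s₁ s' ∧
        (∀ x ∈ Set.Icc 1 n, s'.a 0 k j x = f k j x) ∧
        (∀ c' k' j' x', (c' = 0 → k' = k → j' ≠ j) → s'.a c' k' j' x' = s₁.a c' k' j' x') ∧
        t ≤ c * n) :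
    ∃ s' t, HRuns n (HP.for 11 (.const 1) (HP.for 10 (.const 1) p)) s s' t ∧ Keep 12 s s' ∧
      (∀ k ∈ Set.Icc 1 n, ∀ j ∈ Set.Icc 1 n, ∀ x ∈ Set.Icc 1 n, s'.a 0 k j x = f k j x) ∧
      (∀ c' ≠ 0, ∀ k j x, s'.a c' k j x = s.a c' k j x) ∧ t ≤ (c + 50) * n ^ 3 := by
  have e1 : (HE.const 1).comp.cost = 1 := rfl
  obtain ⟨s', t, φ', hr, hk, ⟨h1, h2⟩, ht⟩ := HRuns.for_keep (n := n) (r := 11)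
    (p := HP.for 10 (.const 1) p) (by omega) (by omega) (.const 1) (n * (c * n + 14) + 11) 1
    (fun i _ a => (∀ k ∈ Set.Icc 1 n, ∀ j ∈ Set.Icc 1 n, ∀ x ∈ Set.Icc 1 n,
      a 0 k j x = if k < i then f k j x else s.a 0 k j x) ∧
      ∀ c' ≠ 0, ∀ k j x, a c' k j x = s.a c' k j x) s 0 h0 trivial rfl (by omega)
    ⟨fun k hk _ _ _ _ => by rw [if_neg (by have := hk.1; omega)], fun _ _ _ _ _ => rfl⟩ (by
    rintro i φ s₁ hi1 hin e11 hk₁ ⟨h1, h2⟩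
    have hi : i ∈ Set.Icc 1 n := ⟨hi1, hin⟩
    obtain ⟨s', t, φ', hr, hk, ⟨h3, h4⟩, ht⟩ := HRuns.for_keep (n := n) (r := 10)
      (p := p) (by omega) (by omega) (.const 1) (c * n) 1
      (fun y _ a => (∀ k ∈ Set.Icc 1 n, ∀ j ∈ Set.Icc 1 n, ∀ x ∈ Set.Icc 1 n,
        a 0 k j x = if k < i ∨ k = i ∧ j < y then f k j x else s.a 0 k j x) ∧
        ∀ c' ≠ 0, ∀ k j x, a c' k j x = s.a c' k j x) s₁ 0
      (by rw [hk₁.1 0 (by omega), h0]) trivial rfl (by omega)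
      ⟨fun k hk j hj x hx => by
        rw [h1 k hk j hj x hx]
        exact if_congr (by have := hj.1; omega) rfl rfl, h2⟩ (by
      rintro y φ s₂ hy1 hyn e10 hk₂ ⟨h3, h4⟩
      have hy : y ∈ Set.Icc 1 n := ⟨hy1, hyn⟩
      obtain ⟨s', t, hr, hk, h5, h6, ht⟩ := h s₂ i hi y hy
        (by rw [hk₂.1 0 (by omega), hk₁.1 0 (by omega), h0]) (by rw [hk₂.1 11 (by omega), e11])
        e10 (fun x hx => by rw [h3 i hi y hy x hx, if_neg (by omega)])
      refine ⟨s', t, 0, hr, hk, ⟨fun k hk j hj x hx => ?_, fun c' hc' k j x => ?_⟩, by omega⟩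
      · by_cases hkj : k = i ∧ j = y
        · rw [hkj.1, hkj.2, h5 x hx, if_pos (by omega)]
        · rw [h6 0 k j x (fun _ e e' => hkj ⟨e, e'⟩), h3 k hk j hj x hx]
          exact if_congr (by omega) rfl rfl
      · rw [h6 c' k j x (fun e => absurd e hc'), h4 c' hc'])
    refine ⟨s', t, 0, hr, hk, ⟨fun k hk j hj x hx => ?_, h4⟩, ?_⟩
    · rw [h3 k hk j hj x hx]
      exact if_congr (by have := hj.2; omega) rfl rfl
    · rw [e1, Nat.add_sub_cancel] at ht
      omega)
  refine ⟨s', t, hr, hk, fun k hk j hj x hx => ?_, h2, ?_⟩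
  · rw [h1 k hk j hj x hx, if_pos (by have := hk.2; omega)]
  · rw [e1, Nat.add_sub_cancel] at ht
    have e2 : n * (n * (c * n + 14) + 11 + 14) = c * n ^ 3 + 14 * n ^ 2 + 25 * n := by ring
    have e3 : (c + 50) * n ^ 3 = c * n ^ 3 + 50 * n ^ 3 := by ring
    have e4 : n ^ 2 ≤ n ^ 3 := Nat.pow_le_pow_right hn (by omega)
    have e5 : n ≤ n ^ 3 := Nat.le_self_pow (by omega) n
    omega

/-- The program that makes all labels trivial. -/
def HP.init : HP :=
  HP.for 11 (.const 1) (HP.for 10 (.const 1) (HP.assign 0 (.reg 11) (.reg 10) (.reg 1) (.reg 1)))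

/-- The program that clears the labels of the points outside of the orbits. -/
def HP.output : HP :=
  HP.for 11 (.const 1) (HP.for 10 (.const 1)
    (.cond (HE.dist (.reg 11) (.arr 0 (.reg 11) (.reg 10) (.reg 10)))
      (HP.assign 0 (.reg 11) (.reg 10) (.reg 1) (.const 0)) .skip))

theorem HRuns.assignRow (e : HE) : ∃ c, ∀ (n : ℕ) (s : HState) (k j : ℕ) (f : ℕ → ℕ),
    1 ≤ n → s.r 0 = n → s.r 11 = k → s.r 10 = j → k ∈ Set.Icc 1 n → j ∈ Set.Icc 1 n →
    (∀ w ∈ Set.Icc 1 n, f w ≤ n) →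
    (∀ s₁ : HState, ∀ w ∈ Set.Icc 1 n, s₁.r 1 = w → e.Ok n s₁ ∧ e.eval s₁ = f w) →
    ∃ s' t, HRuns n (HP.assign 0 (.reg 11) (.reg 10) (.reg 1) e) s s' t ∧ Keep 10 s s' ∧
      (∀ x ∈ Set.Icc 1 n, s'.a 0 k j x = f x) ∧
      (∀ c' k' j' x', (c' = 0 → k' = k → j' ≠ j) → s'.a c' k' j' x' = s.a c' k' j' x') ∧
      t ≤ c * n := by
  refine ⟨HP.assignCost 0 (.reg 11) (.reg 10) (.reg 1) e, ?_⟩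
  intro n s k j f hn h0 h11 h10 hk hj hf he
  obtain ⟨s', t, hr, hk', h1, h2, ht⟩ := HRuns.assign (n := n) (s := s) (c := 0) (k := .reg 11)
    (j := .reg 10) (e₁ := .reg 1) (e₂ := e) (kv := k) (jv := j) (by omega) hn h0 hk hj id f
    (fun _ h => h) hf (fun _ _ _ _ h => h) (by
      intro s₁ w hw hk₁ h1 _
      exact ⟨⟨HE.ok_reg (by omega), by rw [HE.eval, hk₁.1 11 (by omega), h11]⟩,
        ⟨HE.ok_reg (by omega), by rw [HE.eval, hk₁.1 10 (by omega), h10]⟩,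
        ⟨HE.ok_reg (by omega), h1⟩, he s₁ w hw h1⟩)
  exact ⟨s', t, hr, hk'.mono (by omega), h2,
    fun c' k' j' x' h => h1 c' k' j' x' fun e1 e2 e3 => absurd e3 (h e1 e2), ht⟩

theorem HRuns.init : ∃ c, ∀ (n : ℕ) (s : HState), 1 ≤ n → s.r 0 = n →
    (∀ c k j x, s.a c k j x = 0) →
    ∃ s' t, HRuns n HP.init s s' t ∧ Keep 12 s s' ∧ Rel n s'.a (fun _ _ => none) (fun _ _ => 1) ∧
      t ≤ c * n ^ 3 := by
  obtain ⟨c, hc⟩ := HRuns.assignRow (.reg 1)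
  refine ⟨c + 50, ?_⟩
  intro n s hn h0 ha
  obtain ⟨s', t, hr, hk, h1, h2, ht⟩ := HRuns.rows c (fun _ _ x => x) s hn h0
    (fun s₁ k hk j hj e0 e11 e10 _ => hc n s₁ k j id hn e0 e11 e10 hk hj (fun _ h => h.2)
      fun _ _ _ h1 => ⟨HE.ok_reg (by omega), h1⟩)
  exact ⟨s', t, hr, hk, ⟨h1, fun _ _ _ _ _ h => absurd h (by simp),
    fun i _ j _ _ => by rw [h2 1 (by omega), ha]⟩, ht⟩

theorem HRuns.output : ∃ c, ∀ (n : ℕ) (s : HState) (E : Table) (P : Labels), 1 ≤ n → s.r 0 = n →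
    Rel n s.a E P →
    ∃ s' t, HRuns n HP.output s s' t ∧
      (∀ k ∈ Set.Icc 1 n, ∀ j ∈ Set.Icc 1 n, ∀ x ∈ Set.Icc 1 n,
        s'.a 0 k j x = if P.root k j = k then P k j x else 0) ∧ t ≤ c * n ^ 3 := by
  obtain ⟨c, hc⟩ := HRuns.assignRow (.const 0)
  obtain ⟨d, hd⟩ : ∃ d, d =
      (HE.dist (.reg 11) (.arr 0 (.reg 11) (.reg 10) (.reg 10))).comp.cost + 1 := ⟨_, rfl⟩
  refine ⟨c + d + 1 + 50, ?_⟩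
  intro n s E P hn h0 hrel
  obtain ⟨s', t, hr, hk, h1, h2, ht⟩ := HRuns.rows
    (p := .cond (HE.dist (.reg 11) (.arr 0 (.reg 11) (.reg 10) (.reg 10)))
      (HP.assign 0 (.reg 11) (.reg 10) (.reg 1) (.const 0)) .skip) (c + d + 1)
    (fun k j x => if P.root k j = k then P k j x else 0) s hn h0 (by
    intro s₁ k hk j hj e0 e11 e10 hrow
    have m11 : (HE.reg 11).eval s₁ ∈ Set.Icc 1 n := by rw [HE.eval, e11]; exact hk
    have m10 : (HE.reg 10).eval s₁ ∈ Set.Icc 1 n := by rw [HE.eval, e10]; exact hj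
    have hok : (HE.dist (.reg 11) (.arr 0 (.reg 11) (.reg 10) (.reg 10))).Ok n s₁ :=
      HE.ok_dist (HE.ok_reg (by omega)) (HE.ok_arr e0 (by omega) (HE.ok_reg (by omega)) m11
        (HE.ok_reg (by omega)) m10 (HE.ok_reg (by omega)) m10)
    have hval : (HE.dist (.reg 11) (.arr 0 (.reg 11) (.reg 10) (.reg 10))).eval s₁ = 0 ↔
        P.root k j = k := by
      rw [HE.eval_dist]
      simp only [HE.eval, e11, e10]
      rw [hrow j hj, hrel.lab k hk j hj j hj]
      exact eq_comm
    have hcost : c * n + d + 1 ≤ (c + d + 1) * n := by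
      rw [add_assoc c, add_mul]
      have := Nat.le_mul_of_pos_right (d + 1) hn
      omega
    by_cases hroot : P.root k j = k
    · refine ⟨s₁, _, .condFalse hok (hval.2 hroot) (.skip _), Keep.refl _ _, fun x hx => ?_,
        fun _ _ _ _ _ => rfl, by rw [← hd]; omega⟩
      rw [hrow x hx, hrel.lab k hk j hj x hx, if_pos hroot]
    · obtain ⟨s', t, hr, hk', h1, h2, ht⟩ := hc n s₁ k j (fun _ => 0) hn e0 e11 e10 hk hj
        (fun _ _ => Nat.zero_le _) (fun _ _ _ _ => ⟨trivial, rfl⟩)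
      refine ⟨s', _, .condTrue hok (mt hval.1 hroot) hr, hk', fun x hx => ?_, h2,
        by rw [← hd]; omega⟩
      rw [h1 x hx, if_neg hroot])
  exact ⟨s', t, hr, h1, ht⟩

/-! ## Input -/

/-- The images of `1, …, n`. -/
def images (n : ℕ) (z : Equiv.Perm ℕ) : List ℕ := (List.range n).map fun i => z (i + 1)

theorem images_cons {n : ℕ} (hn : 1 ≤ n) (z : Equiv.Perm ℕ) :
    images n z = z 1 :: (List.range' 2 (n - 1)).map z := by
  have h : images n z = (List.range' 1 n).map z := by
    rw [images, List.range'_eq_map_range, List.map_map]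
    exact List.map_congr_left fun i _ => by simp [add_comm]
  obtain ⟨m, rfl⟩ : ∃ m, n = m + 1 := ⟨n - 1, by omega⟩
  rw [h, List.range'_succ, List.map_cons, Nat.add_sub_cancel]

/-- The program reads one number ahead. The number is 0 only at the end of the input, since images
are positive; this is how the input loop ends without knowing m. -/
theorem exists_stream_cons {n : ℕ} (hn : 1 ≤ n) {L : List (Equiv.Perm ℕ)}
    (hL : ∀ z ∈ L, z ∈ perms n) :
    ∃ v l, (L.map (images n)).flatten ++ [0] = v :: l ∧ v ≤ n + 1 := by
  cases L with
  | nil => exact ⟨0, [], rfl, by omega⟩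
  | cons z L =>
    rw [List.map_cons, List.flatten_cons, List.append_assoc, images_cons hn, List.cons_append]
    exact ⟨_, _, rfl,
      (perms_apply_mem (hL z (by simp)) le_rfl ⟨le_rfl, hn⟩).2.trans (by omega)⟩

theorem HRuns.read {n : ℕ} {r v : ℕ} {s : HState} {l : List ℕ} (hr : r < 16) (hl : s.inp = v :: l)
    (hv : v ≤ n + 1) :
    ∃ s', HRuns n (.readr r) s s' 2 ∧ s'.r r = v ∧ (∀ i ≠ r, s'.r i = s.r i) ∧ s'.a = s.a ∧
      s'.inp = l :=
  ⟨_, .readr hr hl hv, s.setR_r_self r v, fun _ h => s.setR_r_of_ne v h, rfl, rfl⟩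

/-- The program that reads a permutation whose first image is in the register `13` and inserts
it. -/
def HP.readPerm : HP :=
  .seq (.seta 2 (.const 1) (.const 1) (.const 1) (.reg 13))
    (.seq (HP.for 9 (.const 2)
      (.seq (.readr 13) (.seta 2 (.const 1) (.const 1) (.reg 9) (.reg 13))))
      (.seq (.set 7 (.reg 0)) HP.insert))

/-- The program that reads and inserts permutations, until the number in the register `13` is
`0`. -/
def HP.readPerms : HP := .loop (.reg 13) (.seq HP.readPerm (.readr 13))

theorem HRuns.readPerm : ∃ c, ∀ (n w : ℕ) (s : HState) (G : Subgroup (Equiv.Perm ℕ)) (E : Table)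
    (P : Labels) (z : Equiv.Perm ℕ) (l : List ℕ), 1 ≤ n → c * n ^ 2 ≤ w → s.r 0 = n →
    s.r 13 :: s.inp = images n z ++ l → z ∈ perms n → z ∈ G → Inv n G E P → Rel n s.a E P →
    ∃ s' t E' P', HRuns n HP.readPerm s s' t ∧ s'.r 0 = n ∧ s'.inp = l ∧ Inv n G E' P' ∧
      Rel n s'.a E' P' ∧ gen E n ≤ gen E' n ∧ z ∈ gen E' n ∧
      t + w * pot n E' P' ≤ c * n ^ 2 + w * pot n E P := by
  obtain ⟨c, hc⟩ := HRuns.insert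
  obtain ⟨d, hd⟩ : ∃ d, d = (addrExpr 2 (HE.const 1).comp (HE.const 1).comp
    (HE.const 1).comp).cost + (HE.reg 13).comp.cost + 1 := ⟨_, rfl⟩
  obtain ⟨d', hd'⟩ : ∃ d, d = (addrExpr 2 (HE.const 1).comp (HE.const 1).comp
    (HE.reg 9).comp).cost + (HE.reg 13).comp.cost + 1 := ⟨_, rfl⟩
  refine ⟨c + d + d' + 40, ?_⟩
  intro n w s G E P z l hn hw h0 hinp hz hzG hinv hrel
  have h1I : 1 ∈ Set.Icc 1 n := ⟨le_rfl, hn⟩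
  rw [images_cons hn, List.cons_append, List.cons.injEq] at hinp
  obtain ⟨h13, hinp⟩ := hinp
  have hz1 := perms_apply_mem hz le_rfl h1I
  have hr₁ := HRuns.seta (n := n) (c := 2) (k := .const 1) (j := .const 1) (x := .const 1)
    (e := .reg 13) (s := s) (HE.ok_arr h0 (by omega) trivial h1I trivial h1I trivial h1I)
    (HE.ok_reg (by omega)) (by rw [HE.eval, h13]; have := hz1.2; omega)
  simp only [HE.eval, h13] at hr₁
  rw [← hd] at hr₁
  obtain ⟨s₂, t₂, φ₂, hr₂, e0, ⟨hinp₂, hhand₂, hsame₂⟩, ht₂⟩ := HRuns.for_loop (n := n) (r := 9)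
    (p := .seq (.readr 13) (.seta 2 (.const 1) (.const 1) (.reg 9) (.reg 13))) (by omega)
    (by omega) (.const 2) (2 + d') 2
    (fun x _ s₁ => s₁.inp = (List.range' x (n + 1 - x)).map z ++ l ∧
      (∀ v ∈ Set.Icc 1 n, v < x → s₁.a 2 1 1 v = z v) ∧
      ∀ c' ≠ 2, ∀ k' j' x', s₁.a c' k' j' x' = s.a c' k' j' x') (s.setA 2 1 1 1 (z 1)) 0 h0 trivial
    rfl (by omega)
    ⟨by simpa using hinp, fun v hv hlt => by
      obtain rfl : v = 1 := by have := hv.1; omega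
      simp [HState.setA], fun c' hc' k' j' x' => by
      simp [HState.setA, hc']⟩ (by
    rintro x φ s₁ hx2 hxn e9 e0 ⟨h1, h2, h3⟩
    have hx : x ∈ Set.Icc 1 n := ⟨by omega, hxn⟩
    have hzx := perms_apply_mem hz le_rfl hx
    rw [show n + 1 - x = n + 1 - (x + 1) + 1 by omega, List.range'_succ, List.map_cons,
      List.cons_append] at h1
    obtain ⟨s₂, hr₁, f13, hreg, ha, hinp₂⟩ := HRuns.read (n := n) (r := 13) (by omega) h1
      (by have := hzx.2; omega)
    have f0 : s₂.r 0 = n := by rw [hreg 0 (by omega), e0]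
    have f9 : s₂.r 9 = x := by rw [hreg 9 (by omega), e9]
    have hr₂ := HRuns.seta (n := n) (c := 2) (k := .const 1) (j := .const 1) (x := .reg 9)
      (e := .reg 13) (HE.ok_arr f0 (by omega) trivial h1I trivial h1I (HE.ok_reg (by omega))
        (by rw [HE.eval, f9]; exact hx))
      (HE.ok_reg (by omega)) (by rw [HE.eval, f13]; have := hzx.2; omega)
    simp only [HE.eval, f9, f13] at hr₂
    rw [← hd'] at hr₂
    refine ⟨_, _, 0, .seq hr₁ hr₂, f9, f0, ⟨hinp₂, fun v hv hlt => ?_, fun c' hc' k' j' x' => ?_⟩,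
      by omega⟩
    · by_cases hvx : v = x
      · subst hvx; simp [HState.setA]
      · simp [HState.setA, hvx, ha, h2 v hv (by omega)]
    · simp [HState.setA, hc', ha, h3 c' hc'])
  have hset := HRuns.set (n := n) (r := 7) (e := .reg 0) (s := s₂) (by omega)
    (HE.ok_reg (by omega)) (by simp only [HE.eval, e0]; omega)
  simp only [HE.eval, e0] at hset
  obtain ⟨s₃, t₃, E', P', hr₃, hk₃, hins, hrel₃, -, ht₃⟩ := hc n w (s₂.setR 7 n) G E P z n hn
    (le_trans (Nat.mul_le_mul_right _ (by omega)) hw)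
    (by rw [HState.setR_r_of_ne _ _ (by omega), e0]) (by simp) le_rfl (hinv.sift hz hzG)
    ⟨fun k hk v hv x hx => by rw [HState.setR_a, hsame₂ 0 (by omega), hrel.lab k hk v hv x hx],
      fun i hi j hj f hf x hx => by
        rw [HState.setR_a, hsame₂ 1 (by omega), hrel.some i hi j hj f hf x hx],
      fun i hi j hj hE => by rw [HState.setR_a, hsame₂ 1 (by omega), hrel.none i hi j hj hE]⟩
    (fun x hx => hhand₂ x hx (by have := hx.2; omega))
  refine ⟨s₃, _, E', P', .seq hr₁ (.seq hr₂ (.seq hset hr₃)), ?_, ?_, hins.toInv, hrel₃,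
    gen_mono le_rfl hins.inc, hins.start_mem, ?_⟩
  · rw [hk₃.1 0 (by omega), HState.setR_r_of_ne _ _ (by omega), e0]
  · rw [hk₃.2, HState.setR_inp, hinp₂]; simp
  · have e1 : (HE.const 2).comp.cost = 1 := rfl
    have e2 : (HE.reg 0).comp.cost = 2 := rfl
    rw [e1] at ht₂
    rw [e2]
    have e3 : (n + 1 - 2) * (2 + d' + 14) ≤ (d' + 16) * n := by
      rw [mul_comm, show 2 + d' + 14 = d' + 16 by omega]
      exact Nat.mul_le_mul_left _ (by omega)
    have e4 : n ≤ n ^ 2 := Nat.le_self_pow (by omega) n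
    have e5 := Nat.mul_le_mul_left (d' + 16) e4
    have e6 : d + 24 ≤ (d + 24) * n ^ 2 := Nat.le_mul_of_pos_right _ (by omega)
    have e7 : (c + d + d' + 40) * n ^ 2 = c * n ^ 2 + (d' + 16) * n ^ 2 + (d + 24) * n ^ 2 := by
      ring
    omega

theorem HRuns.readPerms : ∃ c, ∀ (n w : ℕ) (G : Subgroup (Equiv.Perm ℕ))
    (L : List (Equiv.Perm ℕ)) (s : HState) (E : Table) (P : Labels), 1 ≤ n → c * n ^ 2 ≤ w →
    s.r 0 = n → s.r 13 :: s.inp = (L.map (images n)).flatten ++ [0] →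
    (∀ z ∈ L, z ∈ perms n ∧ z ∈ G) → Inv n G E P → Rel n s.a E P →
    ∃ s' t E' P', HRuns n HP.readPerms s s' t ∧ s'.r 0 = n ∧ Inv n G E' P' ∧
      Rel n s'.a E' P' ∧ gen E n ≤ gen E' n ∧ (∀ z ∈ L, z ∈ gen E' n) ∧
      t + w * pot n E' P' ≤ L.length * (c * n ^ 2) + 3 + w * pot n E P := by
  obtain ⟨c, hc⟩ := HRuns.readPerm
  refine ⟨c + 5, ?_⟩
  intro n w G L
  induction L with
  | nil =>
    intro s E P hn hw h0 hinp _ hinv hrel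
    have h13 : s.r 13 = 0 := by simpa using (List.cons.inj hinp).1
    refine ⟨s, _, E, P, .loopFalse (HE.ok_reg (by omega)) h13, h0, hinv, hrel, le_rfl, by simp, ?_⟩
    have e : (HE.reg 13).comp.cost = 2 := rfl
    rw [e, List.length_nil, zero_mul]
  | cons z L ih =>
    intro s E P hn hw h0 hinp hL hinv hrel
    obtain ⟨hz, hzG⟩ := hL z (by simp)
    rw [List.map_cons, List.flatten_cons, List.append_assoc] at hinp
    have h13 : s.r 13 ≠ 0 := by
      rw [images_cons hn, List.cons_append, List.cons.injEq] at hinp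
      rw [hinp.1]
      have := (perms_apply_mem hz le_rfl (⟨le_rfl, hn⟩ : 1 ∈ Set.Icc 1 n)).1
      omega
    obtain ⟨s₁, t₁, E₁, P₁, hr₁, e0, hinp₁, hinv₁, hrel₁, hgen₁, hz₁, ht₁⟩ := hc n w s G E P z _ hn
      (le_trans (Nat.mul_le_mul_right _ (by omega)) hw) h0 hinp hz hzG hinv hrel
    obtain ⟨v, l, hvl, hv⟩ := exists_stream_cons hn (L := L)
      fun z' hz' => (hL z' (by simp [hz'])).1
    obtain ⟨s₂, hr₂, f13, hreg, ha, hinp₂⟩ := HRuns.read (n := n) (r := 13) (by omega)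
      (hinp₁.trans hvl) hv
    obtain ⟨s', t, E', P', hr, f0, hinv', hrel', hgen', hmem, ht⟩ := ih s₂ E₁ P₁ hn hw
      (by rw [hreg 0 (by omega), e0]) (by rw [f13, hinp₂, hvl]) (fun z hz => hL z (by simp [hz]))
      hinv₁ (by rwa [ha])
    refine ⟨s', _, E', P', .loopTrue (HE.ok_reg (by omega)) h13 (.seq hr₁ hr₂) hr, f0, hinv',
      hrel', hgen₁.trans hgen', ?_, ?_⟩
    · intro z' hz'
      rcases List.mem_cons.1 hz' with rfl | h
      · exact hgen' hz₁
      · exact hmem z' h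
    · have e : (HE.reg 13).comp.cost = 2 := rfl
      have h1 : 1 ≤ n ^ 2 := Nat.one_le_pow _ _ hn
      have h2 : (L.length + 1) * ((c + 5) * n ^ 2) =
        L.length * ((c + 5) * n ^ 2) + c * n ^ 2 + 5 * n ^ 2 := by ring
      rw [e, List.length_cons, h2]
      omega

/-! ## The complete program -/

/-- The program that finds a transversal system. -/
def HP.main : HP :=
  .seq (.readr 0) (.seq HP.init (.seq (.readr 13) (.seq HP.readPerms (.seq HP.levels HP.output))))

/-- The state of the memory at the beginning. -/
def HState.start (l : List ℕ) : HState := ⟨fun _ => 0, fun _ _ _ _ => 0, l⟩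

theorem inputStream_eq (n m : ℕ) (g : Fin m → Equiv.Perm ℕ) :
    inputStream n m g = n :: (((List.ofFn g).map (images n)).flatten ++ [0]) := by
  rw [inputStream, List.map_ofFn]; rfl

theorem HRuns.main : ∃ c, ∀ (n m : ℕ) (g : Fin m → Equiv.Perm ℕ), 1 ≤ n →
    (∀ r, g r ∈ perms n) →
    ∃ s' t E P, HRuns n HP.main (HState.start (inputStream n m g)) s' t ∧
      Inv n (Subgroup.closure (Set.range g)) E P ∧
      (∀ k ∈ Set.Icc 1 n, Subgroup.closure (Set.range g) ⊓ permsSub k ≤ gen E k) ∧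
      (∀ k ∈ Set.Icc 1 n, ∀ j ∈ Set.Icc 1 n, ∀ x ∈ Set.Icc 1 n,
        s'.a 0 k j x = if P.root k j = k then P k j x else 0) ∧
      t ≤ c * (n ^ 5 + m * n ^ 2) := by
  obtain ⟨c₁, hc₁⟩ := HRuns.init
  obtain ⟨c₂, hc₂⟩ := HRuns.readPerms
  obtain ⟨c₃, hc₃⟩ := HRuns.levels
  obtain ⟨c₄, hc₄⟩ := HRuns.output
  refine ⟨c₁ + 9 * c₂ + 9 * c₃ + c₄ + 7, ?_⟩
  intro n m g hn hg
  set G := Subgroup.closure (Set.range g) with hGdef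
  set L := List.ofFn g with hL
  have hLmem : ∀ z ∈ L, z ∈ perms n ∧ z ∈ G := fun z hz => by
    obtain ⟨r, rfl⟩ := List.mem_ofFn.1 hz
    exact ⟨hg r, Subgroup.subset_closure ⟨r, rfl⟩⟩
  obtain ⟨v, l, hvl, hv⟩ := exists_stream_cons hn fun z hz => (hLmem z hz).1
  obtain ⟨s₀, hr₀, e0₀, -, ha₀, hinp₀⟩ := HRuns.read (n := n) (r := 0)
    (s := HState.start (inputStream n m g)) (by omega) (inputStream_eq n m g) (by omega)
  rw [← hL] at hinp₀
  obtain ⟨s₁, t₁, hr₁, hk₁, hrel₁, ht₁⟩ := hc₁ n s₀ hn e0₀ (by rw [ha₀]; exact fun _ _ _ _ => rfl)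
  obtain ⟨s₂, hr₂, e13, hreg₂, ha₂, hinp₂⟩ := HRuns.read (n := n) (r := 13) (s := s₁) (by omega)
    ((hk₁.2.trans hinp₀).trans hvl) hv
  have hinv₁ : Inv n G (fun _ _ => none) (fun _ _ => 1) :=
    { wf := by simp
      diag := by simp
      compat := by simp
      lab := fun _ _ _ _ => one_mem _
      inG := by simp }
  have hle2 : n ^ 2 ≤ n ^ 3 := Nat.pow_le_pow_right hn (by omega)
  -- The same weight is used for the input and for the levels, so the potential left over from the
  -- former pays in the latter.
  obtain ⟨s₃, t₃, E₃, P₃, hr₃, e0₃, hinv₃, hrel₃, -, hmem₃, ht₃⟩ := hc₂ n ((c₂ + c₃) * n ^ 3) G L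
    s₂ _ _ hn
    ((Nat.mul_le_mul_right _ (by omega)).trans (Nat.mul_le_mul_left _ hle2))
    (by rw [hreg₂ 0 (by omega), hk₁.1 0 (by omega), e0₀]) (by rw [e13, hinp₂, hvl]) hLmem hinv₁
    (by rwa [ha₂])
  have hfull : G ≤ gen E₃ n := by
    rw [hGdef, Subgroup.closure_le]
    rintro _ ⟨r, rfl⟩
    exact hmem₃ _ (List.mem_ofFn.2 ⟨r, rfl⟩)
  obtain ⟨s₄, t₄, E₄, P₄, hr₄, hk₄, hinv₄, hrel₄, hG₄, ht₄⟩ := hc₃ n ((c₂ + c₃) * n ^ 3) s₃ G E₃ P₃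
    hn (Nat.mul_le_mul_right _ (by omega)) e0₃ hinv₃ hrel₃ hfull
  obtain ⟨s₅, t₅, hr₅, hout, ht₅⟩ := hc₄ n s₄ E₄ P₄ hn (by rw [hk₄.1 0 (by omega), e0₃]) hrel₄
  refine ⟨s₅, _, E₄, P₄, .seq hr₀ (.seq hr₁ (.seq hr₂ (.seq hr₃ (.seq hr₄ hr₅)))), hinv₄, hG₄,
    hout, ?_⟩
  -- The sum 3 + 1 + 2 of the coefficients, each quantity being at most n².
  have hpot : pot n (fun _ _ => none) (fun _ _ => 1) ≤ 6 * n ^ 2 := by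
    have h1 := unc_le n fun _ _ => 1
    have h2 := imc_le n fun _ _ => 1
    have h3 := ent_card_le n fun _ _ => none
    unfold pot
    omega
  have hlen : L.length = m := List.length_ofFn
  have a1 := Nat.mul_le_mul_left ((c₂ + c₃) * n ^ 3) hpot
  have a2 := Nat.mul_le_mul_left ((c₂ + c₃) * n ^ 3) (unc_le n P₃)
  have a3 : (c₂ + c₃) * n ^ 3 * (6 * n ^ 2) = 6 * (c₂ * n ^ 5) + 6 * (c₃ * n ^ 5) := by ring
  have a4 : (c₂ + c₃) * n ^ 3 * n ^ 2 = c₂ * n ^ 5 + c₃ * n ^ 5 := by ring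
  have a5 : c₁ * n ^ 3 ≤ c₁ * n ^ 5 := Nat.mul_le_mul_left _ (Nat.pow_le_pow_right hn (by omega))
  have a6 : c₃ * n ^ 4 ≤ c₃ * n ^ 5 := Nat.mul_le_mul_left _ (Nat.pow_le_pow_right hn (by omega))
  have a7 : c₄ * n ^ 3 ≤ c₄ * n ^ 5 := Nat.mul_le_mul_left _ (Nat.pow_le_pow_right hn (by omega))
  have a8 : 1 ≤ n ^ 5 := Nat.one_le_pow _ _ hn
  have a9 : (c₁ + 9 * c₂ + 9 * c₃ + c₄ + 7) * (n ^ 5 + m * n ^ 2) =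
      c₁ * n ^ 5 + 9 * (c₂ * n ^ 5) + 9 * (c₃ * n ^ 5) + c₄ * n ^ 5 + 7 * n ^ 5 +
      (m * (c₂ * n ^ 2) + (c₁ + 8 * c₂ + 9 * c₃ + c₄ + 7) * (m * n ^ 2)) := by ring
  rw [hlen] at ht₃
  rw [mul_add] at ht₄
  omega

end PermRep

theorem mainTheorem3 :
    ∃ (p : PermRep.Prog) (b C : ℕ),
      ∀ (n m : ℕ), 1 ≤ n →
        ∀ g : Fin m → Equiv.Perm ℕ, (∀ r, g r ∈ PermRep.perms n) →
          ∃ (s : PermRep.State) (t : ℕ),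
            PermRep.Runs (C * n ^ 3) ((n + 1) ^ C) p
              ⟨fun _ => 0, PermRep.inputStream n m g⟩ s t ∧
            t ≤ C * (n ^ 5 + m * n ^ 2) ∧
            ∃ σ : PermRep.Table,
              PermRep.HoldsTable n s.mem b σ ∧
              b + n ^ 3 ≤ C * n ^ 3 ∧
              PermRep.IsTransversalSystem n σ (Subgroup.closure (Set.range g)) := by
  obtain ⟨c, hc⟩ := PermRep.HRuns.main
  obtain ⟨d, hd⟩ : ∃ d, d = PermRep.HP.main.comp.deg := ⟨_, rfl⟩
  -- The labels are array 0, right behind the 16 registers. The 20 covers the 16 + 4 n³ cells, c the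
  -- time and d the exponent of the word bound.
  refine ⟨PermRep.HP.main.comp, 16, c + d + 20, fun n m hn g hg => ?_⟩
  obtain ⟨s, t, E, P, hr, hinv, hG, hout, ht⟩ := hc n m g hn hg
  have h1 : 1 ≤ n ^ 3 := Nat.one_le_pow _ _ hn
  have h2 : 20 * n ^ 3 ≤ (c + d + 20) * n ^ 3 := Nat.mul_le_mul_right _ (by omega)
  have hruns := (hr.runs (S := (c + d + 20) * n ^ 3) (W := (n + 1) ^ (c + d + 20)) hn (by omega)
    ⟨fun _ => Nat.zero_le _, fun _ _ _ _ => Nat.zero_le _⟩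
    (Nat.pow_le_pow_right (by omega) (by omega))).1
  have hstart : (PermRep.HState.start (PermRep.inputStream n m g)).conc n =
      ⟨fun _ => 0, PermRep.inputStream n m g⟩ := by
    simp [PermRep.HState.conc, PermRep.HState.start]
  rw [hstart] at hruns
  refine ⟨_, t, hruns, ht.trans (Nat.mul_le_mul_right _ (by omega)), P.table, ?_, by omega,
    hinv.isTransversalSystem hG ?_⟩
  -- The table consists of inverse labels, so the inverse images required in the output are the
  -- values of the labels themselves.
  · intro k hk j hj x hx
    have hj' : j ∈ Set.Icc 1 n := ⟨hj.1, hj.2.trans hk.2⟩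
    have hx' : x ∈ Set.Icc 1 n := ⟨hx.1, hx.2.trans hk.2⟩
    have h := s.conc_mem_addr (c := 0) hk hj' hx'
    rw [hout k hk j hj' x hx', PermRep.addr, zero_mul, zero_add, ← add_assoc] at h
    rw [PermRep.Labels.table, show 16 + ((k - 1) * n + (j - 1)) * n + (x - 1) =
      16 + (((k - 1) * n + (j - 1)) * n) + (x - 1) from rfl, h]
    split_ifs <;> simp
  · rw [Subgroup.closure_le]
    rintro _ ⟨r, rfl⟩
    exact hg r
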